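/- **Setting.** Fix $k_2,k_3\in\mathbb R$, put $(Lx)_j=\sum_{m=1}^{3}k_m(x_{j-m}-2x_j+x_{j+m})$ with $k_1=1$, and let $S=\{1,2,3,4\}\subset\mathbb Z$. For $\rho\ne0$ let $x_\rho$ be the nonlinear oscillation $\gamma^2x''+x+x^3=0$, $x(0)=\rho$, $x'(0)=0$, where $\gamma=\gamma(\rho)>0$ is its frequency, i.e. $x_\rho$ has least period $2\pi$; let $a_n=a_n(\rho)$ be its cosine coefficients. The equation for $2\pi$-periodic orbits of frequency $\gamma$ of the Klein–Gordon (KG) chain is $$\gamma^2u''+u+u^3-\epsilon Lu=0,\qquad u\in X_2=H^2_{\rm per}([0,2\pi],\ell^2(\mathbb Z;\mathbb R)).$$ *First Lyapunov–Schmidt decomposition.* For $\phi\in\ell^2(\mathbb Z;\mathbb C)$ let $\mathsf v=\mathrm{Re}\,\phi\cos\tau+\mathrm{Im}\,\phi\sin\tau$. Let $V$ be the space of such functions, $W$ the space of functions without first harmonics, $\Pi_V,\Pi_W$ the projections ($V$ being identified with $\ell^2(\mathbb Z;\mathbb C)$ through $\phi$), and $\mathsf w(\mathsf v,\epsilon)\in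 W\cap X_2$ the small solution (the one of least norm) of $\gamma^2\mathsf w''+\mathsf w-\epsilon L\mathsf w+\Pi_W(\mathsf v+\mathsf w)^3=0$. Put $\mathscr R(\phi,\epsilon)=\Pi_V(\mathsf v+\mathsf w(\mathsf v,\epsilon))^3-\Pi_V\mathsf v^3$, $\mathscr R_\rho(\phi,\epsilon)=\rho^{-5}\mathscr R(\rho\phi,\epsilon)$, $X_N(\phi)=\frac34\phi|\phi|^2$, and define $\omega_\rho$ by $\gamma^2=1+\rho^2\omega_\rho$. For $v,w\in\ell^2(\mathbb Z;\mathbb C)$ let $$F^{\omega}(v;w,\epsilon)=-\omega w-\epsilon L(v+w)+X_N(v+w)-X_N(v),$$ $$\mathcal F(v;w,\rho,\epsilon)=F^{\omega_\rho}(v;w,\epsilon)+\rho^2\big[\mathscr R_\rho(v+w,\rho^2\epsilon)-\mathscr R_\rho(v,0)\big].$$ Here $\epsilon$ is the scaled coupling; the coupling of the KG chain is $\rho^2\epsilon$. *Reference solutions.* For small $\rho\neq0$ let $\theta^\rho\in\mathbb R^4$ be phases whose differences $\varphi_j=\theta^\rho_{j+1}-\theta^\rho_j$ satisfy the KG persistence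 conditions $$\begin{aligned}&M(\varphi_1)+k_2M(\varphi_1+\varphi_2)+k_3M(\varphi_1+\varphi_2+\varphi_3)=0,\\&M(\varphi_2)+k_2M(\varphi_1+\varphi_2)+k_2M(\varphi_2+\varphi_3)+k_3M(\varphi_1+\varphi_2+\varphi_3)=0,\\&M(\varphi_3)+k_2M(\varphi_2+\varphi_3)+k_3M(\varphi_1+\varphi_2+\varphi_3)=0,\end{aligned}$$ where $M(\varphi)=\sum_{m\ge1}(2m-1)a_{2m-1}^2\sin((2m-1)\varphi)$. Let $v^*_{\rho,j}=\frac{a_1}{\rho}e^{-i\theta^\rho_j}$ for $j\in S$ and $v^*_{\rho,j}=0$ otherwise. Suppose $v_\rho^*\to v^*$ as $\rho\to0$, where $v^*_j=e^{-i\theta_j}$ for $j\in S$ and $v^*_j=0$ otherwise (note $\lim a_1/\rho=1$). The dNLS map is $F(v^*;w,\epsilon)=F^{3/4}(v^*;w,\epsilon)$. *Second Lyapunov–Schmidt decomposition.* Let $G(w,\epsilon)$ be $\mathcal F(v^*_\rho;w,\rho,\epsilon)$ or $F(v^*;w,\epsilon)$, let $v$ be the corresponding reference solution, and $\Lambda=D_wG(0,0)$.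 The kernel of $\Lambda$ is four-dimensional, with orthonormal basis the unit vectors in the directions $iv_j$, $j\in S$; it is identified with $\mathbb R^4$ by this basis. For $k\in\mathrm{Ker}\,\Lambda$ let $h(k,\epsilon)\in\mathrm{Range}\,\Lambda$ be the small solution (the one of least norm) of the range equation, which says that the $\mathrm{Range}\,\Lambda$-component of $G(k+h,\epsilon)$ along $\mathrm{Ker}\,\Lambda$ is $0$. Let $G_K(k,\epsilon)\in\mathbb R^4$ be the $\mathrm{Ker}\,\Lambda$-component of $G(k+h(k,\epsilon),\epsilon)$, and define $P_\rho(k,\epsilon)$ (for KG), respectively $P(k,\epsilon)$ (for dNLS), by $G_K=\epsilon P$, with value $\partial_\epsilon G_K(k,0)$ at $\epsilon=0$. The gauge direction is $g=(1,1,1,1)$. **Proposition.** Suppose that $v^*$ is linearly non-degenerate: for every $\epsilon\in\mathbb R$ the linearized bifurcation equation $$\epsilon\,\partial_\epsilon P(0,0)+D_kP(0,0)[k]=0$$ has a solution $k\in\mathbb R^4$, and its set of solutions is $k+\mathbb Rg$. Then there are $\rho^*,\epsilon^*,\delta,C>0$ such that, for $0<|\rho|<\rho^*$: 1. for every $\epsilon\in\mathbb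 R$ the equation $\epsilon\,\partial_\epsilon P_\rho(0,0)+D_kP_\rho(0,0)[k]=0$ has a solution $k\in\mathbb R^4$, and its set of solutions is $k+\mathbb Rg$; 2. for $|\epsilon|<\epsilon^*$ each of the bifurcation equations $P_\rho(k,\epsilon)=0$ and $P(k,\epsilon)=0$ has exactly one solution $k\perp g$ with $\|k\|<\delta$; these solutions, $k_\rho(\epsilon)$ and $k(\epsilon)$ respectively, depend continuously on $\epsilon$, vanish at $\epsilon=0$, and satisfy $$\|k_\rho(\epsilon)-k(\epsilon)\|<C\rho^2\qquad\text{for }|\epsilon|<\epsilon^*.$$ -/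

import Mathlib

open Filter Topology

noncomputable section

namespace KGChain

/-! ### The lattice operator -/

/-- `L = Δ₁ + k₂ Δ₂ + k₃ Δ₃`, where `(Δ_m x)_j = x_{j-m} - 2 x_j + x_{j+m}`. -/
def latticeOp (k₂ k₃ : ℝ) (x : ℤ → ℂ) (j : ℤ) : ℂ :=
  (x (j - 1) - 2 * x j + x (j + 1)) + k₂ * (x (j - 2) - 2 * x j + x (j + 2))
    + k₃ * (x (j - 3) - 2 * x j + x (j + 3))

/-! ### The single anharmonic oscillator and the persistence conditions -/

/-- `x` is the nonlinear oscillation of amplitude `ρ` (normalised to start at rest, so that it has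
a cosine expansion), in the time rescaled by its frequency `γ`: `2π` is its least period. -/
structure IsOscillation (ρ γ : ℝ) (x : ℝ → ℝ) : Prop where
  freq_pos : 0 < γ
  smooth : ContDiff ℝ 2 x
  ode : ∀ τ, γ ^ 2 * deriv (deriv x) τ + x τ + x τ ^ 3 = 0
  init : x 0 = ρ
  init_deriv : deriv x 0 = 0
  periodic : Function.Periodic x (2 * Real.pi)
  least_period : ∀ T, 0 < T → T < 2 * Real.pi → ¬ Function.Periodic x T

/-- Coefficient `a_n` of `cos (n τ)`, for `n ≥ 1`. -/
def cosCoeff (x : ℝ → ℝ) (n : ℕ) : ℝ :=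
  (1 / Real.pi) * ∫ τ in (0 : ℝ)..(2 * Real.pi), x τ * Real.cos (n * τ)

/-- `M(φ) = ∑_{m ≥ 1} (2m-1) a_{2m-1}² sin ((2m-1) φ)`. -/
def persistenceM (x : ℝ → ℝ) (φ : ℝ) : ℝ :=
  ∑' m : ℕ, (2 * m + 1 : ℝ) * cosCoeff x (2 * m + 1) ^ 2 * Real.sin ((2 * m + 1 : ℝ) * φ)

/-- The persistence conditions for the phases `θ` of the four central oscillators. -/
def Persistence (k₂ k₃ : ℝ) (x : ℝ → ℝ) (θ : Fin 4 → ℝ) : Prop :=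
  let M := persistenceM x
  let φ₁ := θ 1 - θ 0
  let φ₂ := θ 2 - θ 1
  let φ₃ := θ 3 - θ 2
  M φ₁ + k₂ * M (φ₁ + φ₂) + k₃ * M (φ₁ + φ₂ + φ₃) = 0 ∧
  M φ₂ + k₂ * M (φ₁ + φ₂) + k₂ * M (φ₂ + φ₃) + k₃ * M (φ₁ + φ₂ + φ₃) = 0 ∧
  M φ₃ + k₂ * M (φ₂ + φ₃) + k₃ * M (φ₁ + φ₂ + φ₃) = 0

/-! ### The first Lyapunov-Schmidt decomposition: first harmonics against all others -/

/-- The `k`-th complex Fourier coefficient `(2π)⁻¹ ∫₀^{2π} f(τ) e^{-ikτ} dτ`. -/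
def fourierC (f : ℝ → ℝ) (k : ℤ) : ℂ :=
  fourierCoeffOn Real.two_pi_pos (fun τ => (f τ : ℂ)) k

/-- Density of the squared norm of `H²` of the circle with values in `ℓ²(ℤ)`, at site `p.1` and
frequency `p.2`. -/
def sobolevTerm (u : ℤ → ℝ → ℝ) (p : ℤ × ℤ) : ℝ :=
  2 * Real.pi * (1 + (p.2 : ℝ) ^ 2 + (p.2 : ℝ) ^ 4) * ‖fourierC (u p.1) p.2‖ ^ 2

/-- `u` (site, then time) is in the space `H²` of `2π`-periodic functions with values in `ℓ²(ℤ)`;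
elements are given by their continuous representatives. -/
structure MemX2 (u : ℤ → ℝ → ℝ) : Prop where
  cont : ∀ j, Continuous (u j)
  periodic : ∀ j, Function.Periodic (u j) (2 * Real.pi)
  summable : Summable (sobolevTerm u)

def normX2 (u : ℤ → ℝ → ℝ) : ℝ := Real.sqrt (∑' p, sobolevTerm u p)

/-- The element `u₁ cos τ + u₋₁ sin τ` of `V`, where `φ = u₁ + i u₋₁`. -/
def lift (φ : ℤ → ℂ) (j : ℤ) (τ : ℝ) : ℝ :=
  (φ j).re * Real.cos τ + (φ j).im * Real.sin τ

/-- The projection on `V` in complex notation: `u₁ + i u₋₁`, with `u₁`, `u₋₁` the coefficients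
of `cos τ` and `sin τ`. -/
def firstHarmonic (f : ℝ → ℝ) : ℂ := 2 * fourierC f (-1)

/-- The range equation `Π_W (γ² w'' + w - ε L w + (v + w)³) = 0` for `w ∈ W`, expressed through
the Fourier coefficients of index different from `±1`. -/
structure SolvesRange (k₂ k₃ γ ε : ℝ) (v w : ℤ → ℝ → ℝ) : Prop where
  mem : MemX2 w
  memW : ∀ j, ∀ k : ℤ, k.natAbs = 1 → fourierC (w j) k = 0
  eqn : ∀ j, ∀ k : ℤ, k.natAbs ≠ 1 →
    ((1 - γ ^ 2 * k ^ 2 : ℝ) : ℂ) * fourierC (w j) k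
      - ε * latticeOp k₂ k₃ (fun i => fourierC (w i) k) j
      + fourierC (fun τ => (v j τ + w j τ) ^ 3) k = 0

/-- The small solution `w(v, ε)` of the range equation: the one of least norm (for small `v`, with
`ε` near `0` and `γ` near `1`, there is exactly one solution in a fixed ball around `0`). -/
def rangeSol (k₂ k₃ γ ε : ℝ) (v : ℤ → ℝ → ℝ) : ℤ → ℝ → ℝ :=
  Classical.epsilon fun w => SolvesRange k₂ k₃ γ ε v w ∧
    ∀ w', SolvesRange k₂ k₃ γ ε v w' → normX2 w ≤ normX2 w'

/-- The remainder `Π_V (v + w(v, ε))³ - Π_V v³` of the kernel equation, in complex notation. -/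
def remainder (k₂ k₃ γ ε : ℝ) (φ : ℤ → ℂ) (j : ℤ) : ℂ :=
  firstHarmonic (fun τ => (lift φ j τ + rangeSol k₂ k₃ γ ε (lift φ) j τ) ^ 3)
    - firstHarmonic (fun τ => lift φ j τ ^ 3)

/-- The remainder after the scaling `φ = ρ φ'`, when a factor `ρ⁵` is taken out. -/
def scaledRemainder (k₂ k₃ γ ρ ε : ℝ) (φ : ℤ → ℂ) (j : ℤ) : ℂ :=
  ((ρ ^ 5 : ℝ) : ℂ)⁻¹ * remainder k₂ k₃ γ ε (fun i => ρ * φ i) j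

/-! ### The kernel equation around the reference solution -/

/-- `ℓ²(ℤ; ℂ)`. -/
abbrev Chain := lp (fun _ : ℤ => ℂ) 2

/-- A square summable sequence as an element of `ℓ²` (and `0` for any other sequence). -/
def toChain (f : ℤ → ℂ) : Chain :=
  open Classical in if h : Memℓp f 2 then ⟨f, h⟩ else 0

/-- The sites `S = {1, 2, 3, 4}`. -/
def site (j : Fin 4) : ℤ := (j : ℤ) + 1

/-- The sequence equal to `r e^{-iθ_j}` at the sites of `S` and to `0` elsewhere. -/
def torusPoint (r : ℝ) (θ : Fin 4 → ℝ) : Chain :=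
  ∑ j, lp.single 2 (site j) ((r : ℂ) * Complex.exp (-(θ j : ℂ) * Complex.I))

/-- The cubic vector field `X_N(φ) = (3/4) φ |φ|²`. -/
def cubic (z : ℂ) : ℂ := (3 / 4 : ℂ) * z * ((‖z‖ ^ 2 : ℝ) : ℂ)

/-- `F(v; w, ε) = -ω w - ε L (v + w) + X_N(v + w) - X_N(v)`. -/
def dnlsPart (k₂ k₃ ω : ℝ) (v w : Chain) (ε : ℝ) (j : ℤ) : ℂ :=
  -ω * w j - ε * latticeOp k₂ k₃ (fun i => v i + w i) j + (cubic (v j + w j) - cubic (v j))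

/-- The dNLS reference solution `v*`: its amplitude is `lim a₁(ρ) / ρ = 1`. -/
def vDNLS (θ : Fin 4 → ℝ) : Chain := torusPoint 1 θ

/-- The dNLS map `F(v*; w, ε)`, with frequency `ω = (3/4) |v*_j|² = 3/4`. -/
def mapDNLS (k₂ k₃ : ℝ) (θ : Fin 4 → ℝ) (w : Chain) (ε : ℝ) : Chain :=
  toChain (dnlsPart k₂ k₃ (3 / 4) (vDNLS θ) w ε)

/-- The KG reference solution `v_ρ*`: the projection on `V` of the periodic orbit
`x(τ + θ_j)`, `j ∈ S`, in complex notation and divided by `ρ`. -/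
def vKG (ρ : ℝ) (x : ℝ → ℝ) (θ : Fin 4 → ℝ) : Chain := torusPoint (cosCoeff x 1 / ρ) θ

/-- The scaled detuning `ω_ρ`, given by `γ² = 1 + ρ² ω_ρ`. This is the sign for which
`γ² v'' + v = -ρ² ω_ρ v` on `V`. -/
def detuning (ρ γ : ℝ) : ℝ := (γ ^ 2 - 1) / ρ ^ 2

/-- The KG map `𝓕(v_ρ*; w, ρ, ε)`: the scaled kernel equation in the correction `w` of `v_ρ*`.
Here `ε` is the scaled coupling; the coupling of the KG chain is `ρ² ε`. -/
def mapKG (k₂ k₃ ρ γ : ℝ) (x : ℝ → ℝ) (θ : Fin 4 → ℝ) (w : Chain) (ε : ℝ) : Chain :=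
  let v := vKG ρ x θ
  toChain fun j => dnlsPart k₂ k₃ (detuning ρ γ) v w ε j
    + ((ρ ^ 2 : ℝ) : ℂ) * (scaledRemainder k₂ k₃ γ ρ (ρ ^ 2 * ε) (fun i => v i + w i) j
        - scaledRemainder k₂ k₃ γ ρ 0 (fun i => v i) j)

/-! ### The second Lyapunov-Schmidt decomposition

`F` stands for one of the two maps `(w, ε) ↦ F(w, ε)` above and `θ` for the phases of the
corresponding reference solution `v`. -/

abbrev R4 := EuclideanSpace ℝ (Fin 4)

/-- `Λ = D_w F(0, 0)`. -/
def Lam (F : Chain → ℝ → Chain) : Chain →L[ℝ] Chain := fderiv ℝ (fun w => F w 0) 0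

/-- The unit vector in the direction `i v_j`. -/
def kerDir (θ : Fin 4 → ℝ) (j : Fin 4) : ℂ := Complex.I * Complex.exp (-(θ j : ℂ) * Complex.I)

/-- The element of the (four-dimensional) kernel of `Λ` with coordinates `κ` in the orthonormal
basis of the directions `i v_j` tangent to the torus. -/
def kerVec (θ : Fin 4 → ℝ) (κ : R4) : Chain :=
  ∑ j, lp.single 2 (site j) ((κ j : ℂ) * kerDir θ j)

/-- The range equation for `h ∈ Range Λ`: the component of `F(k + h, ε)` in `Range Λ` along
`Ker Λ` vanishes. -/
def SolvesRange2 (F : Chain → ℝ → Chain) (θ : Fin 4 → ℝ) (κ : R4) (ε : ℝ) (h : Chain) : Prop :=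
  h ∈ Set.range (Lam F) ∧ Lam F (F (kerVec θ κ + h) ε) = 0

/-- The solution `h(k, ε)` of the range equation given by the implicit function theorem: the one
of least norm. -/
def rangeSol2 (F : Chain → ℝ → Chain) (θ : Fin 4 → ℝ) (κ : R4) (ε : ℝ) : Chain :=
  Classical.epsilon fun h => SolvesRange2 F θ κ ε h ∧
    ∀ h', SolvesRange2 F θ κ ε h' → ‖h‖ ≤ ‖h'‖

/-- The bifurcation function `F_K(k, ε)`, in the coordinates of `kerVec`. -/
def bifurcation (F : Chain → ℝ → Chain) (θ : Fin 4 → ℝ) (κ : R4) (ε : ℝ) : R4 :=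
  WithLp.toLp 2 fun j =>
    (starRingEnd ℂ (kerDir θ j) * F (kerVec θ κ + rangeSol2 F θ κ ε) ε (site j)).re

/-- The function `P` with `F_K(k, ε) = ε P(k, ε)`. -/
def reducedBif (F : Chain → ℝ → Chain) (θ : Fin 4 → ℝ) (κ : R4) (ε : ℝ) : R4 :=
  open Classical in
  if ε = 0 then deriv (fun e => bifurcation F θ κ e) 0 else ε⁻¹ • bifurcation F θ κ ε

/-- The function `P(v*; k, ε)` of the dNLS model. -/
def PDNLS (k₂ k₃ : ℝ) (θ : Fin 4 → ℝ) : R4 → ℝ → R4 :=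
  reducedBif (mapDNLS k₂ k₃ θ) θ

/-- The function `P_ρ(v_ρ*; k, ρ, ε)` of the KG model. -/
def PKG (k₂ k₃ ρ γ : ℝ) (x : ℝ → ℝ) (θ : Fin 4 → ℝ) : R4 → ℝ → R4 :=
  reducedBif (mapKG k₂ k₃ ρ γ x θ) θ

/-- The gauge direction `i v`, in coordinates and up to a scalar factor. -/
def gaugeDir : R4 := WithLp.toLp 2 fun _ => 1

/-- For every `ε` the linearized bifurcation equation `ε ∂_ε P(0,0) + D_k P(0,0)[k] = 0` has a
solution `k`, unique up to adding multiples of the gauge direction. -/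
def LinearizedUniquelySolvable (P : R4 → ℝ → R4) : Prop :=
  ∀ ε : ℝ, ∃ κ : R4, ∀ κ' : R4,
    ε • deriv (fun e => P 0 e) 0 + fderiv ℝ (fun q => P q 0) 0 κ' = 0 ↔
      ∃ c : ℝ, κ' = κ + c • gaugeDir

/-- `k` is the local branch of solutions of `P(k, ε) = 0`, `|ε| < ε₀`, emanating from `0`: `k(ε)`
is the only solution of norm less than `δ` orthogonal to the gauge direction. -/
structure IsLocalBranch (P : R4 → ℝ → R4) (ε₀ δ : ℝ) (k : ℝ → R4) : Prop where
  zero : k 0 = 0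
  cont : ContinuousOn k (Set.Ioo (-ε₀) ε₀)
  sol_iff : ∀ ε, |ε| < ε₀ → ∀ κ : R4,
    (P κ ε = 0 ∧ inner ℝ gaugeDir κ = 0 ∧ ‖κ‖ < δ) ↔ κ = k ε

end KGChain

end

open KGChain

/-!
The Klein-Gordon problem at amplitude `ρ` and the dNLS problem are members `μ = ρ ^ 2` and `μ = 0`
of one family depending on `μ`, and the proposition is the implicit function theorem for that
family. Three facts make this work.

*One smooth family.* After the scaling `w = ρ ^ 3 W` of the harmonics other than the first, and with
`γ ^ 2 = 1 + μ ω`, the range equation of the first decomposition depends on `ρ` only through `μ`,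
and it remains regular at `μ = 0`. Its solution `W(u, ε, μ, ω)` is therefore continuously
differentiable (`exists_isSolutionMap`), and by uniqueness of small solutions
it gives the solution of least norm (`rangeSol_eq`). At a single uncoupled site the implicit
function theorem yields orbits of amplitude `ρ` with first harmonic `ρ r(μ)` and frequency parameter
`ω(μ)`, where `r(0) = 1` and `ω(0) = 3/4`; the nonlinear oscillation is one of them
(`oscillation_eq`). Hence both kernel maps are values of one continuously differentiable map `N(u,
ε, μ)` (`mapKG_eq`, `mapDNLS_eq`, `exists_kernelFamily`), which vanishes for `ε = 0` on the
four-torus of shifted orbits. The reference solutions are points `ψ` of that torus.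

*The factor `ε` splits off without division.* At a single site the equation is conservative, so
that pairing it with the time derivative leaves only the work of the coupling: the component of `N`
along the rotations of the site `j` is `ε` times the work `B_j` (`site_balance`). Near the torus the
bifurcation function is thus `ε P` with `P` equal to `B_j` divided by a function which is close
to one, and `P` is continuously differentiable in all variables (`eventually_reducedBif_eq`); this
uses the solution `h` of the second range equation, whose linearization is invertible for
`μ = 0`, hence for small `μ` (`rangeLin_zero_invertible`, `exists_rangeSol`). On the torus
itself, Parseval's identity turns `B = 0` into the persistence conditions (`pairing_timeShift_deriv`).

*Symmetries account for the kernel.* A global rotation of the phases leaves `P` unchanged, and the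
total action is conserved, so that at the reference solutions the range of the derivative of `P` is
orthogonal to `g` (`eventually_inner_fderiv`). Moving along the torus amounts to changing the
kernel variable `κ`, which relates the derivatives of `P` in `κ` and in `ψ`
(`eventually_fderiv_redBif`). Linear non-degeneracy then says that the completed derivative
`D_κ P + ⟨g, ·⟩ g` is invertible, an open condition: it persists for small `μ`, which is the
linear statement (`eventually_linearizedUniquelySolvable`), and the implicit function theorem solves
`P = 0` with `κ ⊥ g` by a function of `(ε, ψ, μ)`. The zeros of `P` on the torus are, modulo the
gauge direction, a differentiable function of `μ` as well. The resulting branch is Lipschitz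
in `μ = ρ ^ 2`, uniformly in `ε`, and this is the estimate (`exists_branches`).
-/

noncomputable section

namespace KGChain

/-! ### Square summable sequences indexed by the sites -/

/-- Square summable sequences `ℤ → X`. -/
abbrev L2 (X : Type*) [NormedAddCommGroup X] := lp (fun _ : ℤ => X) 2

section SiteMaps

variable {X Y Z : Type*} [NormedAddCommGroup X] [NormedAddCommGroup Y] [NormedAddCommGroup Z]

theorem memlp_two_iff {f : ℤ → X} : Memℓp f 2 ↔ Summable fun j => ‖f j‖ ^ 2 := by
  rw [memℓp_gen_iff (by norm_num)]
  simp

theorem hasSum_norm_sq (u : L2 X) : HasSum (fun j => ‖u j‖ ^ 2) (‖u‖ ^ 2) := by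
  have := lp.hasSum_norm (p := 2) (by norm_num) u
  simpa using this

theorem memlp_of_le {f : ℤ → Y} (u : L2 X) (σ : ℤ ≃ ℤ) (C : ℝ)
    (h : ∀ j, ‖f j‖ ≤ C * ‖u (σ j)‖) : Memℓp f 2 := by
  rw [memlp_two_iff]
  have h1 : Summable fun j => C ^ 2 * ‖u (σ j)‖ ^ 2 :=
    ((σ.summable_iff (f := fun j => ‖u j‖ ^ 2)).2 (hasSum_norm_sq u).summable).mul_left _
  refine h1.of_nonneg_of_le (fun j => by positivity) fun j => ?_
  rw [← mul_pow]
  exact pow_le_pow_left₀ (norm_nonneg _) (h j) 2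

theorem norm_le_of_le {v : L2 Y} (u : L2 X) (σ : ℤ ≃ ℤ) {C : ℝ} (hC : 0 ≤ C)
    (h : ∀ j, ‖v j‖ ≤ C * ‖u (σ j)‖) : ‖v‖ ≤ C * ‖u‖ := by
  refine le_of_sq_le_sq ?_ (by positivity)
  rw [mul_pow]
  have h1 : HasSum (fun j => C ^ 2 * ‖u (σ j)‖ ^ 2) (C ^ 2 * ‖u‖ ^ 2) :=
    ((σ.hasSum_iff (f := fun j => ‖u j‖ ^ 2)).2 (hasSum_norm_sq u)).mul_left _
  refine hasSum_le (fun j => ?_) (hasSum_norm_sq v) h1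
  rw [← mul_pow]
  exact pow_le_pow_left₀ (norm_nonneg _) (h j) 2

theorem norm_site_le (u : L2 X) (j : ℤ) : ‖u j‖ ≤ ‖u‖ := lp.norm_apply_le_norm (by norm_num) u j

theorem site_add (u v : L2 X) (j : ℤ) : (u + v) j = u j + v j := rfl

theorem site_sub (u v : L2 X) (j : ℤ) : (u - v) j = u j - v j := rfl

theorem site_zero (j : ℤ) : (0 : L2 X) j = 0 := rfl

theorem site_smul [NormedSpace ℝ X] (c : ℝ) (u : L2 X) (j : ℤ) : (c • u) j = c • u j := rfl

theorem site_ext {u v : L2 X} (h : ∀ j, u j = v j) : u = v := lp.ext (funext h)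

variable [NormedSpace ℝ X] [NormedSpace ℝ Y] [NormedSpace ℝ Z]

/-- The bounded operator `(T u)_j = A_j u_{σ j}` on square summable sequences, for a uniformly
bounded family of operators `A_j`. -/
def siteMap (σ : ℤ ≃ ℤ) (A : ℤ → X →L[ℝ] Y) (C : ℝ) (hC : 0 ≤ C)
    (hA : ∀ j x, ‖A j x‖ ≤ C * ‖x‖) : L2 X →L[ℝ] L2 Y :=
  LinearMap.mkContinuous
    { toFun := fun u => ⟨fun j => A j (u (σ j)), memlp_of_le u σ C fun j => hA j _⟩
      map_add' := fun _ _ => site_ext fun j => (A j).map_add _ _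
      map_smul' := fun _ _ => site_ext fun j => (A j).map_smul _ _ }
    C fun u => norm_le_of_le u σ hC fun j => hA j _

/-- The same bounded operator applied at every site. -/
def constMap (A : X →L[ℝ] Y) : L2 X →L[ℝ] L2 Y :=
  siteMap (Equiv.refl ℤ) (fun _ => A) ‖A‖ (norm_nonneg A) fun _ x => A.le_opNorm x

@[simp] theorem constMap_apply (A : X →L[ℝ] Y) (u : L2 X) (j : ℤ) :
    constMap A u j = A (u j) := rfl

/-- The same bounded bilinear map applied at every site. -/
def siteMul (b : X →L[ℝ] Y →L[ℝ] Z) : L2 X →L[ℝ] L2 Y →L[ℝ] L2 Z :=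
  LinearMap.mkContinuous₂
    (LinearMap.mk₂ ℝ (fun u v => (⟨fun j => b (u j) (v j),
        memlp_of_le v (Equiv.refl ℤ) (‖b‖ * ‖u‖) fun j => (b.le_opNorm₂ _ _).trans (by
          gcongr
          · exact lp.norm_apply_le_norm (by norm_num) u j
          · rfl)⟩ : L2 Z))
      (fun u u' v => site_ext fun j => b.map_add₂ _ _ _)
      (fun c u v => site_ext fun j => b.map_smul₂ _ _ _)
      (fun u v v' => site_ext fun j => (b (u j)).map_add _ _)
      (fun c u v => site_ext fun j => (b (u j)).map_smul _ _))
    ‖b‖ fun u v => norm_le_of_le v (Equiv.refl ℤ) (by positivity) fun j =>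
      (b.le_opNorm₂ _ _).trans (by
        gcongr
        · exact lp.norm_apply_le_norm (by norm_num) u j
        · rfl)

/-- Evaluation at a site, as a bounded operator. -/
def evalSite (X : Type*) [NormedAddCommGroup X] [NormedSpace ℝ X] (j : ℤ) : L2 X →L[ℝ] X :=
  LinearMap.mkContinuous
    { toFun := fun u => u j
      map_add' := fun _ _ => rfl
      map_smul' := fun _ _ => rfl }
    1 fun u => (norm_site_le u j).trans (one_mul _).ge

@[simp] theorem evalSite_apply (j : ℤ) (u : L2 X) : evalSite X j u = u j := rfl

/-- The shift `(T u)_j = u_{j+m}`. -/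
def shiftSite (X : Type*) [NormedAddCommGroup X] [NormedSpace ℝ X] (m : ℤ) : L2 X →L[ℝ] L2 X :=
  siteMap (Equiv.addRight m) (fun _ => ContinuousLinearMap.id ℝ X) 1 zero_le_one
    fun _ x => by simp

/-- The lattice operator `L` on square summable sequences with values in a normed space. -/
def latticeL (X : Type*) [NormedAddCommGroup X] [NormedSpace ℝ X] (k₂ k₃ : ℝ) :
    L2 X →L[ℝ] L2 X :=
  (shiftSite X (-1) - (2 : ℝ) • ContinuousLinearMap.id ℝ _ + shiftSite X 1)
    + k₂ • (shiftSite X (-2) - (2 : ℝ) • ContinuousLinearMap.id ℝ _ + shiftSite X 2)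
    + k₃ • (shiftSite X (-3) - (2 : ℝ) • ContinuousLinearMap.id ℝ _ + shiftSite X 3)

theorem latticeL_apply (k₂ k₃ : ℝ) (u : L2 X) (j : ℤ) :
    latticeL X k₂ k₃ u j = (u (j - 1) - (2 : ℝ) • u j + u (j + 1))
      + k₂ • (u (j - 2) - (2 : ℝ) • u j + u (j + 2))
      + k₃ • (u (j - 3) - (2 : ℝ) • u j + u (j + 3)) := rfl

theorem latticeL_constMap (k₂ k₃ : ℝ) (A : X →L[ℝ] Y) (u : L2 X) :
    latticeL Y k₂ k₃ (constMap A u) = constMap A (latticeL X k₂ k₃ u) := by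
  refine site_ext fun j => ?_
  simp only [latticeL_apply, constMap_apply, map_add, map_sub, map_smul]

theorem latticeL_complex (k₂ k₃ : ℝ) (u : L2 ℂ) (j : ℤ) :
    latticeL ℂ k₂ k₃ u j = latticeOp k₂ k₃ u j := by
  simp only [latticeL_apply, latticeOp, Complex.real_smul, Complex.ofReal_ofNat]

end SiteMaps

/-! ### Continuous functions on the circle -/

/-- The length of the circle is positive, as `AddCircle` requires. -/
instance factTwoPiPos : Fact (0 < 2 * Real.pi) := ⟨Real.two_pi_pos⟩

/-- The circle of length `2π`. -/
abbrev Circ := AddCircle (2 * Real.pi)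

/-- Continuous real functions on the circle, with the maximum norm. -/
abbrev CircFun := C(Circ, ℝ)

/-- A function on the circle as a `2π`-periodic function on the line. -/
def onLine (f : CircFun) (τ : ℝ) : ℝ := f (τ : Circ)

/-- A continuous `2π`-periodic function as a function on the circle. -/
def ofPeriodic (f : ℝ → ℝ) (hc : Continuous f) (hp : Function.Periodic f (2 * Real.pi)) :
    CircFun :=
  ⟨hp.lift, hc.quotient_liftOn' _⟩

@[simp] theorem onLine_ofPeriodic (f : ℝ → ℝ) (hc : Continuous f)
    (hp : Function.Periodic f (2 * Real.pi)) : onLine (ofPeriodic f hc hp) = f := by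
  funext τ
  exact hp.lift_coe τ

theorem onLine_continuous (f : CircFun) : Continuous (onLine f) :=
  f.continuous.comp (AddCircle.continuous_mk' _)

theorem onLine_periodic (f : CircFun) : Function.Periodic (onLine f) (2 * Real.pi) := fun τ => by
  simp [onLine]

theorem circ_ext {f g : CircFun} (h : ∀ τ, onLine f τ = onLine g τ) : f = g := by
  ext t
  induction t using QuotientAddGroup.induction_on with
  | H τ => exact h τ

@[simp] theorem onLine_add (f g : CircFun) (τ : ℝ) : onLine (f + g) τ = onLine f τ + onLine g τ :=
  rfl

@[simp] theorem onLine_sub (f g : CircFun) (τ : ℝ) : onLine (f - g) τ = onLine f τ - onLine g τ :=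
  rfl

@[simp] theorem onLine_neg (f : CircFun) (τ : ℝ) : onLine (-f) τ = -onLine f τ := rfl

@[simp] theorem onLine_mul (f g : CircFun) (τ : ℝ) : onLine (f * g) τ = onLine f τ * onLine g τ :=
  rfl

@[simp] theorem onLine_smul (c : ℝ) (f : CircFun) (τ : ℝ) : onLine (c • f) τ = c * onLine f τ :=
  rfl

@[simp] theorem onLine_pow (f : CircFun) (n : ℕ) (τ : ℝ) : onLine (f ^ n) τ = onLine f τ ^ n := rfl

theorem abs_onLine_le (f : CircFun) (τ : ℝ) : |onLine f τ| ≤ ‖f‖ := f.norm_coe_le_norm τ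

theorem circ_norm_le {f : CircFun} {C : ℝ} (hC : 0 ≤ C)
    (h : ∀ τ ∈ Set.Ico 0 (2 * Real.pi), |onLine f τ| ≤ C) : ‖f‖ ≤ C := by
  rw [ContinuousMap.norm_le _ hC]
  intro t
  induction t using QuotientAddGroup.induction_on with
  | H τ =>
    obtain ⟨y, hy, he⟩ := (onLine_periodic f).exists_mem_Ico₀ Real.two_pi_pos τ
    change |onLine f τ| ≤ C
    rw [he]
    exact h y hy

/-! ### Integration and differentiation -/

theorem onLine_intervalIntegrable (f : CircFun) (a b : ℝ) :
    IntervalIntegrable (onLine f) MeasureTheory.volume a b :=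
  (onLine_continuous f).intervalIntegrable a b

/-- The integral over a period. -/
def integ : CircFun →L[ℝ] ℝ :=
  LinearMap.mkContinuous
    { toFun := fun f => ∫ τ in (0 : ℝ)..(2 * Real.pi), onLine f τ
      map_add' := fun f g => intervalIntegral.integral_add (onLine_intervalIntegrable f _ _)
        (onLine_intervalIntegrable g _ _)
      map_smul' := fun c f => intervalIntegral.integral_const_mul c _ }
    (2 * Real.pi) fun f => by
      have := intervalIntegral.norm_integral_le_of_norm_le_const (a := 0) (b := 2 * Real.pi)
        (f := onLine f) (C := ‖f‖) fun τ _ => abs_onLine_le f τ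
      rw [sub_zero, abs_of_pos Real.two_pi_pos] at this
      exact this.trans_eq (mul_comm _ _)

theorem integ_apply (f : CircFun) : integ f = ∫ τ in (0 : ℝ)..(2 * Real.pi), onLine f τ := rfl

/-- The `L²` pairing `∫ f g` over a period. -/
def pairing : CircFun →L[ℝ] CircFun →L[ℝ] ℝ :=
  (ContinuousLinearMap.compL ℝ CircFun CircFun ℝ integ).comp (ContinuousLinearMap.mul ℝ CircFun)

theorem pairing_apply (f g : CircFun) : pairing f g = integ (f * g) := rfl

theorem pairing_comm (f g : CircFun) : pairing f g = pairing g f := by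
  rw [pairing_apply, pairing_apply, mul_comm f g]

/-- `g` is the derivative of `f`. -/
def HasD (f g : CircFun) : Prop := ∀ τ, HasDerivAt (onLine f) (onLine g τ) τ

namespace HasD

variable {f f' g g' : CircFun}

theorem add (hf : HasD f f') (hg : HasD g g') : HasD (f + g) (f' + g') :=
  fun τ => (hf τ).add (hg τ)

theorem sub (hf : HasD f f') (hg : HasD g g') : HasD (f - g) (f' - g') :=
  fun τ => (hf τ).sub (hg τ)

theorem neg (hf : HasD f f') : HasD (-f) (-f') := fun τ => (hf τ).neg

theorem smul (hf : HasD f f') (c : ℝ) : HasD (c • f) (c • f') := fun τ => (hf τ).const_mul c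

theorem mul (hf : HasD f f') (hg : HasD g g') : HasD (f * g) (f' * g + f * g') :=
  fun τ => (hf τ).mul (hg τ)

theorem congr (hf : HasD f f') (h : f' = g') : HasD f g' := h ▸ hf

theorem integ_eq_zero (hf : HasD f f') : integ f' = 0 := by
  rw [integ_apply, intervalIntegral.integral_eq_sub_of_hasDerivAt (f := onLine f)
    (fun τ _ => hf τ) (onLine_intervalIntegrable f' _ _)]
  have := onLine_periodic f 0
  rw [zero_add] at this
  rw [this, sub_self]

theorem pairing_deriv (hf : HasD f f') (hg : HasD g g') :
    pairing f' g = -pairing f g' := by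
  have := (hf.mul hg).integ_eq_zero
  rw [map_add] at this
  rw [pairing_apply, pairing_apply]
  linarith

theorem pairing_self (hf : HasD f f') : pairing f f' = 0 := by
  have h := hf.pairing_deriv hf
  rw [pairing_comm] at h
  linarith

end HasD

/-- The periodic primitive `τ ↦ ∫₀^τ (f - mean f)`. -/
def primitiveFun (f : CircFun) : CircFun :=
  ofPeriodic (fun τ => (∫ s in (0 : ℝ)..τ, onLine f s) - τ / (2 * Real.pi) * integ f)
    (by
      refine Continuous.sub ?_ (by fun_prop)
      exact intervalIntegral.continuous_primitive (onLine_intervalIntegrable f) 0)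
    (fun τ => by
      have h1 := intervalIntegral.integral_add_adjacent_intervals
        (onLine_intervalIntegrable f 0 τ) (onLine_intervalIntegrable f τ (τ + 2 * Real.pi))
      have h2 := (onLine_periodic f).intervalIntegral_add_eq τ 0
      rw [zero_add, ← integ_apply] at h2
      have h3 : 2 * Real.pi ≠ 0 := Real.two_pi_pos.ne'
      beta_reduce
      rw [← h1, h2]
      field_simp
      ring)

theorem onLine_primitiveFun (f : CircFun) (τ : ℝ) : onLine (primitiveFun f) τ =
    (∫ s in (0 : ℝ)..τ, onLine f s) - τ / (2 * Real.pi) * integ f := by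
  exact congrFun (onLine_ofPeriodic _ _ _) τ

/-- The periodic primitive as a bounded operator. -/
def primitive : CircFun →L[ℝ] CircFun :=
  LinearMap.mkContinuous
    { toFun := primitiveFun
      map_add' := fun f g => circ_ext fun τ => by
        simp only [onLine_primitiveFun, onLine_add, map_add]
        rw [intervalIntegral.integral_add (onLine_intervalIntegrable f _ _)
          (onLine_intervalIntegrable g _ _)]
        ring
      map_smul' := fun c f => circ_ext fun τ => by
        simp only [onLine_primitiveFun, onLine_smul, map_smul,
          intervalIntegral.integral_const_mul, RingHom.id_apply, smul_eq_mul]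
        ring }
    (4 * Real.pi) fun f => by
      refine circ_norm_le (by positivity) fun τ hτ => ?_
      simp only [LinearMap.coe_mk, AddHom.coe_mk, onLine_primitiveFun]
      have h1 := intervalIntegral.norm_integral_le_of_norm_le_const (a := 0) (b := τ)
        (f := onLine f) (C := ‖f‖) fun τ _ => abs_onLine_le f τ
      have h2 := intervalIntegral.norm_integral_le_of_norm_le_const (a := 0) (b := 2 * Real.pi)
        (f := onLine f) (C := ‖f‖) fun τ _ => abs_onLine_le f τ
      rw [sub_zero, abs_of_pos Real.two_pi_pos, ← integ_apply, Real.norm_eq_abs] at h2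
      rw [sub_zero, abs_of_nonneg hτ.1, Real.norm_eq_abs] at h1
      refine (abs_sub _ _).trans ?_
      rw [abs_mul, abs_of_nonneg (div_nonneg hτ.1 Real.two_pi_pos.le)]
      have h3 : τ / (2 * Real.pi) ≤ 1 := (div_le_one Real.two_pi_pos).2 hτ.2.le
      have h4 : τ / (2 * Real.pi) * |integ f| ≤ 1 * (‖f‖ * (2 * Real.pi)) := by gcongr
      have h5 : ‖f‖ * τ ≤ ‖f‖ * (2 * Real.pi) := by gcongr; exact hτ.2.le
      linarith

theorem onLine_primitive (f : CircFun) (τ : ℝ) : onLine (primitive f) τ =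
    (∫ s in (0 : ℝ)..τ, onLine f s) - τ / (2 * Real.pi) * integ f := onLine_primitiveFun f τ

theorem hasD_primitive {f : CircFun} (h : integ f = 0) : HasD (primitive f) f := fun τ => by
  have : onLine (primitive f) = fun τ => ∫ s in (0 : ℝ)..τ, onLine f s := by
    funext τ
    rw [onLine_primitive, h, mul_zero, sub_zero]
  rw [this]
  exact intervalIntegral.integral_hasDerivAt_right (onLine_intervalIntegrable f _ _)
    ((onLine_continuous f).stronglyMeasurableAtFilter _ _)
    (onLine_continuous f).continuousAt

/-! ### Fourier coefficients -/

theorem fourierC_eq (f : ℝ → ℝ) (k : ℤ) : fourierC f k =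
    (1 / (2 * Real.pi) : ℂ) * ∫ τ in (0 : ℝ)..(2 * Real.pi),
      Complex.exp (-(k * Complex.I * τ)) * f τ := by
  rw [fourierC, fourierCoeffOn_eq_integral]
  simp only [sub_zero, Complex.real_smul, smul_eq_mul, fourier_coe_apply]
  push_cast
  congr 1
  refine intervalIntegral.integral_congr fun τ _ => ?_
  have : (Real.pi : ℂ) ≠ 0 := by exact_mod_cast Real.pi_ne_zero
  congr 2
  field_simp

theorem fourier_integrand_continuous (f : CircFun) (k : ℤ) :
    Continuous fun τ : ℝ => Complex.exp (-(k * Complex.I * τ)) * onLine f τ := by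
  have := onLine_continuous f
  fun_prop

/-- The Fourier coefficient of index `k` of a function on the circle. -/
def coef (k : ℤ) : CircFun →L[ℝ] ℂ :=
  LinearMap.mkContinuous
    { toFun := fun f => fourierC (onLine f) k
      map_add' := fun f g => by
        simp only [fourierC_eq]
        rw [← mul_add, ← intervalIntegral.integral_add
          ((fourier_integrand_continuous f k).intervalIntegrable _ _)
          ((fourier_integrand_continuous g k).intervalIntegrable _ _)]
        simp [mul_add]
      map_smul' := fun c f => by
        simp only [fourierC_eq, RingHom.id_apply, onLine_smul, Complex.real_smul]
        rw [mul_left_comm, ← intervalIntegral.integral_const_mul (c : ℂ)]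
        congr 1
        refine intervalIntegral.integral_congr fun τ _ => ?_
        push_cast
        ring }
    1 fun f => by
      simp only [LinearMap.coe_mk, AddHom.coe_mk, fourierC_eq]
      have h := intervalIntegral.norm_integral_le_of_norm_le_const (a := 0) (b := 2 * Real.pi)
        (f := fun τ : ℝ => Complex.exp (-(k * Complex.I * τ)) * onLine f τ) (C := ‖f‖)
        fun τ _ => by
          have h1 : ‖Complex.exp (-(k * Complex.I * τ))‖ = 1 := by
            rw [Complex.norm_exp]; simp
          rw [norm_mul, h1, one_mul, Complex.norm_real]
          exact abs_onLine_le f τ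
      rw [sub_zero, abs_of_pos Real.two_pi_pos] at h
      rw [norm_mul, one_mul]
      have h2 : ‖(1 / (2 * Real.pi) : ℂ)‖ = 1 / (2 * Real.pi) := by
        rw [show (1 / (2 * Real.pi) : ℂ) = ((1 / (2 * Real.pi) : ℝ) : ℂ) by push_cast; rfl,
          Complex.norm_real, Real.norm_eq_abs, abs_of_pos (by positivity)]
      rw [h2, one_div_mul_eq_div, div_le_iff₀ Real.two_pi_pos]
      exact h

theorem coef_apply (k : ℤ) (f : CircFun) : coef k f = fourierC (onLine f) k := rfl

theorem coef_eq_integral (k : ℤ) (f : CircFun) : coef k f =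
    (1 / (2 * Real.pi) : ℂ) * ∫ τ in (0 : ℝ)..(2 * Real.pi),
      Complex.exp (-(k * Complex.I * τ)) * onLine f τ := fourierC_eq _ k

/-- The complexification of a function on the circle. -/
def toComplex (f : CircFun) : C(Circ, ℂ) := ⟨fun t => (f t : ℂ), by fun_prop⟩

theorem fourierCoeff_toComplex (f : CircFun) (k : ℤ) : fourierCoeff (toComplex f) k = coef k f := by
  rw [fourierCoeff_eq_intervalIntegral _ k 0, coef_eq_integral, zero_add, Complex.real_smul]
  push_cast
  congr 1
  refine intervalIntegral.integral_congr fun τ _ => ?_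
  have : (Real.pi : ℂ) ≠ 0 := by exact_mod_cast Real.pi_ne_zero
  simp only [fourier_coe_apply, smul_eq_mul]
  congr 2
  push_cast
  field_simp

theorem coef_neg (k : ℤ) (f : CircFun) : coef (-k) f = starRingEnd ℂ (coef k f) := by
  rw [coef_eq_integral, coef_eq_integral, map_mul, ← intervalIntegral.intervalIntegral_conj]
  congr 1
  · simp [Complex.conj_ofNat]
  · refine intervalIntegral.integral_congr fun τ _ => ?_
    simp [← Complex.exp_conj]

theorem HasD.coef_eq {f g : CircFun} (h : HasD f g) (k : ℤ) :
    coef k g = k * Complex.I * coef k f := by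
  have h1 : ∀ τ : ℝ, HasDerivAt (fun τ : ℝ => Complex.exp (-(k * Complex.I * τ)) * onLine f τ)
      (Complex.exp (-(k * Complex.I * τ)) * onLine g τ
        - k * Complex.I * (Complex.exp (-(k * Complex.I * τ)) * onLine f τ)) τ := fun τ => by
    have h2 : HasDerivAt (fun τ : ℝ => Complex.exp (-(k * Complex.I * τ)))
        (Complex.exp (-(k * Complex.I * τ)) * (-(k * Complex.I * 1))) τ :=
      (((hasDerivAt_id τ).ofReal_comp.const_mul (k * Complex.I)).neg).cexp
    refine (h2.mul (h τ).ofReal_comp).congr_deriv ?_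
    ring
  have h3 := intervalIntegral.integral_eq_sub_of_hasDerivAt (a := 0) (b := 2 * Real.pi)
    (fun τ _ => h1 τ) (((fourier_integrand_continuous g k).sub
      ((fourier_integrand_continuous f k).const_mul _)).intervalIntegrable _ _)
  have h4 : Complex.exp (-(k * Complex.I * (2 * Real.pi : ℝ))) = 1 := by
    rw [Complex.exp_eq_one_iff]
    exact ⟨-k, by push_cast; ring⟩
  have h5 := onLine_periodic f 0
  rw [zero_add] at h5
  rw [intervalIntegral.integral_sub ((fourier_integrand_continuous g k).intervalIntegrable _ _)
    (((fourier_integrand_continuous f k).const_mul _).intervalIntegrable _ _), h4, h5,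
    intervalIntegral.integral_const_mul] at h3
  rw [coef_eq_integral, coef_eq_integral]
  simp only [Complex.ofReal_zero, mul_zero, neg_zero, Complex.exp_zero, sub_self] at h3
  linear_combination (1 / (2 * Real.pi) : ℂ) * h3

theorem circ_eq_zero_of_coef {f : CircFun} (h : ∀ k, coef k f = 0) : f = 0 := by
  have h1 : fourierCoeff (toComplex f) = 0 := funext fun k => by
    rw [fourierCoeff_toComplex, h k, Pi.zero_apply]
  have h2 := hasSum_fourier_series_of_summable (f := toComplex f) (by rw [h1]; exact summable_zero)
  rw [h1] at h2
  simp only [Pi.zero_apply, zero_smul] at h2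
  have h3 := h2.unique hasSum_zero
  ext t
  have := DFunLike.congr_fun h3 t
  simpa [toComplex] using this

theorem hasSum_coef_sq (f : CircFun) :
    HasSum (fun k => ‖coef k f‖ ^ 2) ((2 * Real.pi)⁻¹ * pairing f f) := by
  have h1 : Continuous fun τ => (onLine f τ : ℂ) :=
    Complex.continuous_ofReal.comp (onLine_continuous f)
  have h := hasSum_sq_fourierCoeffOn (f := fun τ => (onLine f τ : ℂ)) Real.two_pi_pos
    (MeasureTheory.MemLp.of_bound h1.aestronglyMeasurable ‖f‖
      (Eventually.of_forall fun τ => by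
        rw [Complex.norm_real]; exact abs_onLine_le f τ))
  suffices h2 : (2 * Real.pi)⁻¹ * pairing f f =
      (2 * Real.pi - 0)⁻¹ • ∫ τ in (0 : ℝ)..(2 * Real.pi), ‖(onLine f τ : ℂ)‖ ^ 2 by
    rw [h2]; exact h
  rw [sub_zero, smul_eq_mul, pairing_apply, integ_apply]
  congr 1
  refine intervalIntegral.integral_congr fun τ _ => ?_
  simp only [onLine_mul, Complex.norm_real, Real.norm_eq_abs, sq_abs]
  ring

theorem tsum_coef_sq_le (f : CircFun) : ∑' k, ‖coef k f‖ ^ 2 ≤ ‖f‖ ^ 2 := by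
  rw [(hasSum_coef_sq f).tsum_eq, pairing_apply]
  have h1 := intervalIntegral.norm_integral_le_of_norm_le_const (a := 0) (b := 2 * Real.pi)
    (f := onLine (f * f)) (C := ‖f‖ ^ 2) fun τ _ => by
      rw [onLine_mul, norm_mul, ← sq]
      exact pow_le_pow_left₀ (abs_nonneg _) (abs_onLine_le f τ) 2
  rw [sub_zero, abs_of_pos Real.two_pi_pos, ← integ_apply, Real.norm_eq_abs] at h1
  rw [inv_mul_le_iff₀ Real.two_pi_pos]
  exact (le_abs_self _).trans (h1.trans_eq (mul_comm _ _))

/-- The maximum norm is bounded by the `ℓ¹` norm of the Fourier coefficients. -/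
theorem norm_le_tsum_coef {f : CircFun} (h : Summable fun k => ‖coef k f‖) :
    ‖f‖ ≤ ∑' k, ‖coef k f‖ := by
  have h0 : fourierCoeff (toComplex f) = fun k => coef k f :=
    funext (fourierCoeff_toComplex f)
  have h1 : Summable (fourierCoeff (toComplex f)) := by
    rw [h0]; exact h.of_norm
  have h2 := hasSum_fourier_series_of_summable h1
  refine circ_norm_le (tsum_nonneg fun _ => norm_nonneg _) fun τ _ => ?_
  have h3 := has_pointwise_sum_fourier_series_of_summable h1 (τ : Circ)
  have h4 : ‖toComplex f (τ : Circ)‖ ≤ ∑' k, ‖coef k f‖ := by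
    rw [← h3.tsum_eq]
    refine (norm_tsum_le_tsum_norm ?_).trans_eq ?_
    · simp only [h0, norm_smul]
      refine h.congr fun k => ?_
      rw [fourier_apply, Circle.norm_coe, mul_one]
    · refine tsum_congr fun k => ?_
      rw [h0, norm_smul, fourier_apply, Circle.norm_coe, mul_one]
  rwa [toComplex, ContinuousMap.coe_mk, Complex.norm_real] at h4

/-! ### The first harmonics -/

/-- The cosine as a function on the circle. -/
def cosFun : CircFun := ofPeriodic Real.cos Real.continuous_cos Real.cos_periodic

/-- The sine as a function on the circle. -/
def sinFun : CircFun := ofPeriodic Real.sin Real.continuous_sin Real.sin_periodic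

@[simp] theorem onLine_cosFun (τ : ℝ) : onLine cosFun τ = Real.cos τ := by simp [cosFun]

@[simp] theorem onLine_sinFun (τ : ℝ) : onLine sinFun τ = Real.sin τ := by simp [sinFun]

theorem hasD_cosFun : HasD cosFun (-sinFun) := fun τ => by
  simpa [cosFun] using Real.hasDerivAt_cos τ

theorem hasD_sinFun : HasD sinFun cosFun := fun τ => by
  simpa [sinFun] using Real.hasDerivAt_sin τ

/-- The function `Re z cos τ + Im z sin τ`. -/
def harm : ℂ →L[ℝ] CircFun :=
  Complex.reCLM.smulRight cosFun + Complex.imCLM.smulRight sinFun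

theorem harm_apply (z : ℂ) : harm z = z.re • cosFun + z.im • sinFun := by
  simp [harm]

theorem onLine_harm (z : ℂ) (τ : ℝ) :
    onLine (harm z) τ = z.re * Real.cos τ + z.im * Real.sin τ := by
  simp [harm_apply]

theorem hasD_harm (z : ℂ) : HasD (harm z) (harm (-Complex.I * z)) := by
  rw [harm_apply, harm_apply]
  refine ((hasD_cosFun.smul _).add (hasD_sinFun.smul _)).congr ?_
  simp
  abel

/-- The first harmonic `u₁ + i u₋₁` of a function on the circle. -/
def firstHarm : CircFun →L[ℝ] ℂ := (2 : ℝ) • coef (-1)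

theorem firstHarm_apply (f : CircFun) : firstHarm f = firstHarmonic (onLine f) := by
  simp [firstHarm, firstHarmonic, coef_apply]

theorem coef_neg_one (f : CircFun) : coef (-1) f = firstHarm f / 2 := by
  simp [firstHarm]

theorem pairing_harm (z : ℂ) (f : CircFun) :
    pairing (harm z) f = Real.pi * (starRingEnd ℂ z * firstHarm f).re := by
  have h0 : ∀ τ : ℝ, Complex.exp (-((-1 : ℤ) * Complex.I * τ)) * onLine f τ =
      ((Real.cos τ * onLine f τ : ℝ) : ℂ) + ((Real.sin τ * onLine f τ : ℝ) : ℂ) * Complex.I := by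
    intro τ
    rw [show (-((-1 : ℤ) * Complex.I * τ) : ℂ) = τ * Complex.I by push_cast; ring,
      Complex.exp_mul_I]
    push_cast
    ring
  have hc : Continuous fun τ => Real.cos τ * onLine f τ :=
    Real.continuous_cos.mul (onLine_continuous f)
  have hs : Continuous fun τ => Real.sin τ * onLine f τ :=
    Real.continuous_sin.mul (onLine_continuous f)
  have h1 : firstHarm f = (1 / Real.pi : ℝ) *
      (((∫ τ in (0 : ℝ)..(2 * Real.pi), Real.cos τ * onLine f τ : ℝ) : ℂ) +
      ((∫ τ in (0 : ℝ)..(2 * Real.pi), Real.sin τ * onLine f τ : ℝ) : ℂ) * Complex.I) := by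
    have h2 : firstHarm f = 2 * coef (-1) f := by simp [firstHarm]
    rw [h2, coef_eq_integral, intervalIntegral.integral_congr fun τ _ => h0 τ,
      intervalIntegral.integral_add, intervalIntegral.integral_mul_const,
      intervalIntegral.integral_ofReal, intervalIntegral.integral_ofReal]
    · push_cast
      ring
    · exact (Complex.continuous_ofReal.comp hc).intervalIntegrable _ _
    · exact ((Complex.continuous_ofReal.comp hs).mul continuous_const).intervalIntegrable _ _
  have h3 : pairing (harm z) f = z.re * (∫ τ in (0 : ℝ)..(2 * Real.pi), Real.cos τ * onLine f τ)
      + z.im * ∫ τ in (0 : ℝ)..(2 * Real.pi), Real.sin τ * onLine f τ := by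
    rw [pairing_apply, integ_apply, ← intervalIntegral.integral_const_mul,
      ← intervalIntegral.integral_const_mul, ← intervalIntegral.integral_add]
    · refine intervalIntegral.integral_congr fun τ _ => ?_
      simp only [onLine_mul, onLine_harm]
      ring
    · exact (hc.const_mul _).intervalIntegrable _ _
    · exact (hs.const_mul _).intervalIntegrable _ _
  have hpi : Real.pi ≠ 0 := Real.pi_ne_zero
  rw [h3, h1]
  simp
  field_simp

theorem complex_eq_of_re_mul {a b : ℂ}
    (h : ∀ z : ℂ, (starRingEnd ℂ z * a).re = (starRingEnd ℂ z * b).re) : a = b := by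
  have h1 := h 1
  have h2 := h Complex.I
  simp at h1 h2
  exact Complex.ext h1 h2

theorem integ_cos_sq : integ (cosFun * cosFun) = Real.pi := by
  have : integ (cosFun * cosFun) = ∫ τ in (0 : ℝ)..(2 * Real.pi), Real.cos τ ^ 2 := by
    rw [integ_apply]
    exact intervalIntegral.integral_congr fun τ _ => by simp [sq]
  rw [this, integral_cos_sq]
  simp

theorem integ_sin_sq : integ (sinFun * sinFun) = Real.pi := by
  have : integ (sinFun * sinFun) = ∫ τ in (0 : ℝ)..(2 * Real.pi), Real.sin τ ^ 2 := by
    rw [integ_apply]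
    exact intervalIntegral.integral_congr fun τ _ => by simp [sq]
  rw [this, integral_sin_sq]
  simp

theorem integ_sin_cos : integ (sinFun * cosFun) = 0 := hasD_sinFun.pairing_self

theorem firstHarm_harm (z : ℂ) : firstHarm (harm z) = z := by
  refine complex_eq_of_re_mul fun w => ?_
  have h := pairing_harm w (harm z)
  have h2 : pairing (harm w) (harm z) = Real.pi * (w.re * z.re + w.im * z.im) := by
    rw [pairing_apply, harm_apply, harm_apply]
    have h3 : (w.re • cosFun + w.im • sinFun) * (z.re • cosFun + z.im • sinFun) =
        (w.re * z.re) • (cosFun * cosFun) + (w.im * z.im) • (sinFun * sinFun)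
        + (w.re * z.im + w.im * z.re) • (sinFun * cosFun) := by
      refine circ_ext fun τ => ?_
      simp
      ring
    rw [h3]
    simp only [map_add, map_smul, integ_cos_sq, integ_sin_sq, integ_sin_cos, smul_eq_mul]
    ring
  have hpi : Real.pi ≠ 0 := Real.pi_ne_zero
  rw [h2] at h
  have h4 := mul_left_cancel₀ hpi h
  rw [← h4]
  simp

/-- The projection that removes the first harmonics. -/
def projW : CircFun →L[ℝ] CircFun := ContinuousLinearMap.id ℝ CircFun - harm.comp firstHarm

theorem projW_apply (f : CircFun) : projW f = f - harm (firstHarm f) := rfl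

theorem firstHarm_projW (f : CircFun) : firstHarm (projW f) = 0 := by
  rw [projW_apply, map_sub, firstHarm_harm, sub_self]

theorem pairing_harm_of_firstHarm {f : CircFun} (h : firstHarm f = 0) (z : ℂ) :
    pairing (harm z) f = 0 := by
  rw [pairing_harm, h]
  simp

theorem HasD.firstHarm_eq {f g : CircFun} (h : HasD f g) :
    firstHarm g = -Complex.I * firstHarm f := by
  have := h.coef_eq (-1)
  rw [coef_neg_one, coef_neg_one] at this
  push_cast at this
  linear_combination 2 * this

theorem coef_harm (z : ℂ) {k : ℤ} (hk : k.natAbs ≠ 1) : coef k (harm z) = 0 := by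
  have h1 := (hasD_harm z).coef_eq k
  have h2 := (hasD_harm (-Complex.I * z)).coef_eq k
  have h3 : harm (-Complex.I * (-Complex.I * z)) = -harm z := by
    rw [← map_neg]
    congr 1
    linear_combination z * Complex.I_sq
  rw [h3, h1, map_neg] at h2
  have h4 : ((k : ℂ) ^ 2 - 1) * coef k (harm z) = 0 := by
    linear_combination h2 + (k : ℂ) ^ 2 * coef k (harm z) * Complex.I_sq
  rcases mul_eq_zero.1 h4 with h5 | h5
  · exfalso
    apply hk
    have h6 : k ^ 2 = 1 := by
      have : ((k ^ 2 : ℤ) : ℂ) = ((1 : ℤ) : ℂ) := by push_cast; linear_combination h5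
      exact_mod_cast this
    simpa [Int.natAbs_pow] using congrArg Int.natAbs h6
  · exact h5

theorem coef_of_firstHarm {f : CircFun} (h : firstHarm f = 0) {k : ℤ} (hk : k.natAbs = 1) :
    coef k f = 0 := by
  have h1 : coef (-1) f = 0 := by rw [coef_neg_one, h, zero_div]
  rcases Int.natAbs_eq k with h2 | h2
  · rw [hk] at h2
    have := coef_neg (-1) f
    rw [h1, map_zero, neg_neg] at this
    rw [h2]
    exact_mod_cast this
  · rw [hk] at h2
    rw [h2]
    exact_mod_cast h1

/-! ### The inverse of `∂² + 1` on functions without first harmonics -/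

/-- Multiplication by a function. -/
def mulFun (f : CircFun) : CircFun →L[ℝ] CircFun := ContinuousLinearMap.mul ℝ CircFun f

/-- Variation of constants: a solution of `u'' + u = g` if `g` has no first harmonics. -/
def varConst : CircFun →L[ℝ] CircFun :=
  (mulFun sinFun).comp (primitive.comp (mulFun cosFun))
    - (mulFun cosFun).comp (primitive.comp (mulFun sinFun))

/-- The derivative of `varConst`. -/
def varConstDeriv : CircFun →L[ℝ] CircFun :=
  (mulFun cosFun).comp (primitive.comp (mulFun cosFun))
    + (mulFun sinFun).comp (primitive.comp (mulFun sinFun))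

theorem varConst_apply (g : CircFun) : varConst g =
    sinFun * primitive (cosFun * g) - cosFun * primitive (sinFun * g) := rfl

theorem varConstDeriv_apply (g : CircFun) : varConstDeriv g =
    cosFun * primitive (cosFun * g) + sinFun * primitive (sinFun * g) := rfl

theorem integ_cos_mul {g : CircFun} (h : firstHarm g = 0) : integ (cosFun * g) = 0 := by
  have := pairing_harm_of_firstHarm h 1
  rw [harm_apply] at this
  simpa [pairing_apply] using this

theorem integ_sin_mul {g : CircFun} (h : firstHarm g = 0) : integ (sinFun * g) = 0 := by
  have := pairing_harm_of_firstHarm h Complex.I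
  rw [harm_apply] at this
  simpa [pairing_apply] using this

theorem hasD_varConst {g : CircFun} (h : firstHarm g = 0) :
    HasD (varConst g) (varConstDeriv g) := by
  have hc := hasD_primitive (integ_cos_mul h)
  have hs := hasD_primitive (integ_sin_mul h)
  refine ((hasD_sinFun.mul hc).sub (hasD_cosFun.mul hs)).congr (circ_ext fun τ => ?_)
  simp only [varConstDeriv_apply, onLine_add, onLine_sub, onLine_mul, onLine_neg]
  ring

theorem hasD_varConstDeriv {g : CircFun} (h : firstHarm g = 0) :
    HasD (varConstDeriv g) (g - varConst g) := by
  have hc := hasD_primitive (integ_cos_mul h)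
  have hs := hasD_primitive (integ_sin_mul h)
  refine ((hasD_cosFun.mul hc).add (hasD_sinFun.mul hs)).congr (circ_ext fun τ => ?_)
  simp only [varConst_apply, onLine_add, onLine_sub, onLine_mul, onLine_neg, onLine_cosFun,
    onLine_sinFun]
  linear_combination onLine g τ * Real.sin_sq_add_cos_sq τ

/-- The inverse `K` of `∂² + 1` on the functions without first harmonics, extended by `0`. -/
def invW : CircFun →L[ℝ] CircFun := projW.comp (varConst.comp projW)

/-- The operator `∂ K`. -/
def invWDeriv : CircFun →L[ℝ] CircFun :=
  (varConstDeriv - harm.comp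
    ((-Complex.I • ContinuousLinearMap.id ℝ ℂ : ℂ →L[ℝ] ℂ).comp (firstHarm.comp varConst))).comp
    projW

theorem invW_apply (f : CircFun) : invW f =
    varConst (projW f) - harm (firstHarm (varConst (projW f))) := rfl

theorem hasD_invW (f : CircFun) : HasD (invW f) (invWDeriv f) :=
  (hasD_varConst (firstHarm_projW f)).sub (hasD_harm _)

theorem hasD_invWDeriv (f : CircFun) : HasD (invWDeriv f) (projW f - invW f) := by
  have h : HasD (invWDeriv f) (projW f - varConst (projW f)
      - harm (-Complex.I * (-Complex.I * firstHarm (varConst (projW f))))) :=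
    (hasD_varConstDeriv (firstHarm_projW f)).sub (hasD_harm _)
  refine h.congr ?_
  rw [invW_apply]
  have : -Complex.I * (-Complex.I * firstHarm (varConst (projW f))) =
      -firstHarm (varConst (projW f)) := by
    linear_combination firstHarm (varConst (projW f)) * Complex.I_sq
  rw [this, map_neg]
  abel

theorem firstHarm_invW (f : CircFun) : firstHarm (invW f) = 0 := firstHarm_projW _

theorem coef_second_deriv {u u' g : CircFun} (h1 : HasD u u') (h2 : HasD u' (g - u)) (k : ℤ) :
    (1 - (k : ℂ) ^ 2) * coef k u = coef k g := by
  have h3 := h1.coef_eq k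
  have h4 := h2.coef_eq k
  rw [h3, map_sub] at h4
  linear_combination -h4 - (k : ℂ) ^ 2 * coef k u * Complex.I_sq

theorem coef_invW (f : CircFun) {k : ℤ} (hk : k.natAbs ≠ 1) :
    (1 - (k : ℂ) ^ 2) * coef k (invW f) = coef k f := by
  rw [coef_second_deriv (hasD_invW f) (hasD_invWDeriv f), projW_apply, map_sub, coef_harm _ hk,
    sub_zero]

theorem one_sub_sq_ne_zero {k : ℤ} (hk : k.natAbs ≠ 1) : (1 - (k : ℂ) ^ 2) ≠ 0 := by
  intro h
  apply hk
  have h6 : k ^ 2 = 1 := by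
    have : ((k ^ 2 : ℤ) : ℂ) = ((1 : ℤ) : ℂ) := by push_cast; linear_combination -h
    exact_mod_cast this
  simpa [Int.natAbs_pow] using congrArg Int.natAbs h6

/-- `K f` is the only solution of `u'' + u = f - Π_V f` without first harmonics. -/
theorem eq_invW {u u' f : CircFun} (h1 : HasD u u') (h2 : HasD u' (projW f - u))
    (h3 : firstHarm u = 0) : u = invW f := by
  rw [← sub_eq_zero]
  refine circ_eq_zero_of_coef fun k => ?_
  by_cases hk : k.natAbs = 1
  · exact coef_of_firstHarm (by rw [map_sub, h3, firstHarm_invW, sub_zero]) hk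
  · have h4 := coef_second_deriv h1 h2 k
    have h5 := coef_second_deriv (hasD_invW f) (hasD_invWDeriv f) k
    rw [map_sub]
    have h6 : (1 - (k : ℂ) ^ 2) * (coef k u - coef k (invW f)) = 0 := by
      linear_combination h4 - h5
    exact (mul_eq_zero.1 h6).resolve_left (one_sub_sq_ne_zero hk)

/-! ### The cubic nonlinearity and the symmetries of the circle -/

theorem firstHarm_harm_cube (z : ℂ) : firstHarm (harm z ^ 3) = cubic z := by
  -- Besides the first harmonic, the cube contains only the third one.
  set a := z.re
  set b := z.im
  let c3 : CircFun := ofPeriodic (fun τ => Real.cos (3 * τ)) (by fun_prop) fun τ => by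
    beta_reduce
    rw [show 3 * (τ + 2 * Real.pi) = 3 * τ + (3 : ℕ) * (2 * Real.pi) by push_cast; ring,
      Real.cos_add_nat_mul_two_pi]
  let s3 : CircFun := ofPeriodic (fun τ => Real.sin (3 * τ)) (by fun_prop) fun τ => by
    beta_reduce
    rw [show 3 * (τ + 2 * Real.pi) = 3 * τ + (3 : ℕ) * (2 * Real.pi) by push_cast; ring,
      Real.sin_add_nat_mul_two_pi]
  have hc : HasD c3 ((-3 : ℝ) • s3) := fun τ => by
    have : HasDerivAt (fun τ => Real.cos (3 * τ)) (-Real.sin (3 * τ) * (3 * 1)) τ :=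
      ((hasDerivAt_id τ).const_mul 3).cos
    simpa [c3, s3, mul_comm] using this
  have hs : HasD s3 ((3 : ℝ) • c3) := fun τ => by
    have : HasDerivAt (fun τ => Real.sin (3 * τ)) (Real.cos (3 * τ) * (3 * 1)) τ :=
      ((hasDerivAt_id τ).const_mul 3).sin
    simpa [c3, s3, mul_comm] using this
  have hz : ∀ {f g : CircFun}, HasD f ((-3 : ℝ) • g) → HasD g ((3 : ℝ) • f) →
      firstHarm f = 0 ∧ firstHarm g = 0 := fun {f g} hf hg => by
    have h1 := hf.firstHarm_eq
    have h2 := hg.firstHarm_eq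
    rw [map_smul, Complex.real_smul] at h1 h2
    push_cast at h1 h2
    have h3 : (8 : ℂ) * firstHarm f = 0 := by
      linear_combination Complex.I * h1 + 3 * h2 - firstHarm f * Complex.I_sq
    have h4 : firstHarm f = 0 := by simpa using h3
    rw [h4, mul_zero] at h1
    exact ⟨h4, by simpa using h1⟩
  obtain ⟨hc0, hs0⟩ := hz hc hs
  have key : harm z ^ 3 = (3 / 4 * (a ^ 2 + b ^ 2)) • harm z
      + ((a ^ 3 - 3 * a * b ^ 2) / 4) • c3 + ((3 * a ^ 2 * b - b ^ 3) / 4) • s3 := by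
    refine circ_ext fun τ => ?_
    simp only [onLine_pow, onLine_add, onLine_smul, onLine_harm, c3, s3, onLine_ofPeriodic,
      Real.cos_three_mul, Real.sin_three_mul]
    change (a * Real.cos τ + b * Real.sin τ) ^ 3 = 3 / 4 * (a ^ 2 + b ^ 2)
      * (a * Real.cos τ + b * Real.sin τ) + _ + _
    have h := Real.sin_sq_add_cos_sq τ
    generalize Real.cos τ = c at *
    generalize Real.sin τ = s at *
    linear_combination (3 * a ^ 2 * b * s + 3 * a * b ^ 2 * c) * h
  rw [key]
  simp only [map_add, map_smul, hc0, hs0, smul_zero, add_zero, firstHarm_harm, cubic]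
  have h5 : ‖z‖ ^ 2 = a ^ 2 + b ^ 2 := by
    rw [← Complex.normSq_eq_norm_sq, Complex.normSq_apply]
    ring
  rw [h5, Complex.real_smul]
  push_cast
  ring

/-- Composition with a continuous map of the circle. -/
def pullBack (φ : C(Circ, Circ)) : CircFun →L[ℝ] CircFun :=
  LinearMap.mkContinuous
    { toFun := fun f => f.comp φ
      map_add' := fun _ _ => rfl
      map_smul' := fun _ _ => rfl } 1 fun f => by
    rw [one_mul, ContinuousMap.norm_le _ (norm_nonneg f)]
    exact fun t => f.norm_coe_le_norm _

theorem pullBack_mul (φ : C(Circ, Circ)) (f g : CircFun) :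
    pullBack φ (f * g) = pullBack φ f * pullBack φ g := rfl

theorem norm_pullBack_le (φ : C(Circ, Circ)) (f : CircFun) : ‖pullBack φ f‖ ≤ ‖f‖ :=
  (ContinuousMap.norm_le _ (norm_nonneg f)).2 fun _ => f.norm_coe_le_norm _

/-- The time shift `f ↦ f(· + α)`. -/
def timeShift (α : ℝ) : CircFun →L[ℝ] CircFun :=
  pullBack ⟨fun t => t + (α : Circ), by fun_prop⟩

@[simp] theorem onLine_timeShift (α : ℝ) (f : CircFun) (τ : ℝ) :
    onLine (timeShift α f) τ = onLine f (τ + α) := rfl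

/-- The time reversal `f ↦ f(-·)`. -/
def timeRev : CircFun →L[ℝ] CircFun := pullBack ⟨fun t => -t, by fun_prop⟩

@[simp] theorem onLine_timeRev (f : CircFun) (τ : ℝ) :
    onLine (timeRev f) τ = onLine f (-τ) := rfl

theorem HasD.timeShift {f g : CircFun} (h : HasD f g) (α : ℝ) :
    HasD (timeShift α f) (timeShift α g) := fun τ => (h (τ + α)).comp_add_const τ α

theorem HasD.timeRev {f g : CircFun} (h : HasD f g) :
    HasD (timeRev f) (-timeRev g) := fun τ => by
  have h1 := (h (-τ)).scomp τ (hasDerivAt_neg τ)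
  rw [neg_one_smul] at h1
  exact h1

theorem timeShift_harm (α : ℝ) (z : ℂ) :
    timeShift α (harm z) = harm (Complex.exp (-α * Complex.I) * z) := by
  refine circ_ext fun τ => ?_
  rw [onLine_timeShift, onLine_harm, onLine_harm, Real.cos_add, Real.sin_add,
    show (-α * Complex.I : ℂ) = ((-α : ℝ) : ℂ) * Complex.I by push_cast; ring]
  simp only [Complex.mul_re, Complex.mul_im, Complex.exp_ofReal_mul_I_re,
    Complex.exp_ofReal_mul_I_im, Real.cos_neg, Real.sin_neg]
  ring

theorem timeRev_harm (z : ℂ) : timeRev (harm z) = harm (starRingEnd ℂ z) := by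
  refine circ_ext fun τ => ?_
  rw [onLine_timeRev, onLine_harm, onLine_harm, Real.cos_neg, Real.sin_neg]
  simp

theorem integ_timeShift (α : ℝ) (f : CircFun) : integ (timeShift α f) = integ f := by
  rw [integ_apply, integ_apply]
  simp only [onLine_timeShift]
  rw [intervalIntegral.integral_comp_add_right (onLine f), zero_add, add_comm]
  have := (onLine_periodic f).intervalIntegral_add_eq α 0
  rwa [zero_add] at this

theorem integ_timeRev (f : CircFun) : integ (timeRev f) = integ f := by
  rw [integ_apply, integ_apply]
  simp only [onLine_timeRev]
  rw [intervalIntegral.integral_comp_neg (onLine f), neg_zero]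
  have := (onLine_periodic f).intervalIntegral_add_eq (-(2 * Real.pi)) 0
  rwa [zero_add, neg_add_cancel] at this

theorem firstHarm_timeShift (α : ℝ) (f : CircFun) :
    firstHarm (timeShift α f) = Complex.exp (-α * Complex.I) * firstHarm f := by
  refine complex_eq_of_re_mul fun z => ?_
  have hpi : Real.pi ≠ 0 := Real.pi_ne_zero
  refine mul_left_cancel₀ hpi ?_
  have h1 : harm z = timeShift α (harm (Complex.exp (α * Complex.I) * z)) := by
    rw [timeShift_harm, ← mul_assoc, ← Complex.exp_add]
    simp
  have h2 : starRingEnd ℂ (Complex.exp (α * Complex.I)) = Complex.exp (-α * Complex.I) := by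
    rw [← Complex.exp_conj]
    simp
  rw [← pairing_harm, h1, pairing_apply, timeShift, ← pullBack_mul, ← timeShift, integ_timeShift,
    ← pairing_apply, pairing_harm, map_mul, h2]
  congr 2
  ring

theorem firstHarm_timeRev (f : CircFun) :
    firstHarm (timeRev f) = starRingEnd ℂ (firstHarm f) := by
  refine complex_eq_of_re_mul fun z => ?_
  have hpi : Real.pi ≠ 0 := Real.pi_ne_zero
  refine mul_left_cancel₀ hpi ?_
  have h1 : harm z = timeRev (harm (starRingEnd ℂ z)) := by
    rw [timeRev_harm, Complex.conj_conj]
  rw [← pairing_harm, h1, pairing_apply, timeRev, ← pullBack_mul, ← timeRev, integ_timeRev,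
    ← pairing_apply, pairing_harm]
  simp

theorem timeShift_projW (α : ℝ) (f : CircFun) :
    timeShift α (projW f) = projW (timeShift α f) := by
  rw [projW_apply, projW_apply, map_sub, timeShift_harm, firstHarm_timeShift]

theorem timeRev_projW (f : CircFun) : timeRev (projW f) = projW (timeRev f) := by
  rw [projW_apply, projW_apply, map_sub, timeRev_harm, firstHarm_timeRev]

theorem timeShift_invW (α : ℝ) (f : CircFun) : timeShift α (invW f) = invW (timeShift α f) := by
  refine eq_invW ((hasD_invW f).timeShift α) ?_ ?_
  · exact ((hasD_invWDeriv f).timeShift α).congr (by rw [map_sub, timeShift_projW])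
  · rw [firstHarm_timeShift, firstHarm_invW, mul_zero]

theorem timeRev_invW (f : CircFun) : timeRev (invW f) = invW (timeRev f) := by
  refine eq_invW (hasD_invW f).timeRev ?_ ?_
  · exact (hasD_invWDeriv f).timeRev.neg.congr (by rw [neg_neg, map_sub, timeRev_projW])
  · rw [firstHarm_timeRev, firstHarm_invW, map_zero]

/-! ### The Sobolev norm of a function on the circle -/

theorem one_le_sobolev_weight (k : ℤ) :
    1 + (k : ℝ) ^ 2 ≤ 2 * Real.pi * (1 + (k : ℝ) ^ 2 + (k : ℝ) ^ 4) := by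
  have h1 : (1 : ℝ) ≤ 2 * Real.pi := by linarith [Real.pi_gt_three]
  have h2 : 1 + (k : ℝ) ^ 2 ≤ 1 * (1 + (k : ℝ) ^ 2 + (k : ℝ) ^ 4) := by
    nlinarith [sq_nonneg ((k : ℝ) ^ 2)]
  exact h2.trans (by gcongr)

theorem summable_inv_one_add_sq : Summable fun k : ℤ => (1 + (k : ℝ) ^ 2)⁻¹ := by
  have h := (Real.summable_one_div_int_pow (p := 2)).2 one_lt_two
  refine Summable.of_norm_bounded_eventually (g := fun k : ℤ => 1 / (k : ℝ) ^ 2) h ?_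
  filter_upwards [Set.Finite.compl_mem_cofinite (Set.finite_singleton (0 : ℤ))] with k hk
  have hk' : (k : ℝ) ≠ 0 := by
    simpa using hk
  have : 0 < (k : ℝ) ^ 2 := by positivity
  rw [Real.norm_eq_abs, abs_of_pos (by positivity), one_div]
  gcongr
  linarith

/-- The Sobolev embedding constant, squared. -/
def sobolevConst : ℝ := ∑' k : ℤ, (1 + (k : ℝ) ^ 2)⁻¹

/-- The `H²` norm controls the maximum norm. -/
theorem norm_sq_le_sobolev {f : CircFun} (h : Summable fun k : ℤ =>
    2 * Real.pi * (1 + (k : ℝ) ^ 2 + (k : ℝ) ^ 4) * ‖coef k f‖ ^ 2) :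
    ‖f‖ ^ 2 ≤ sobolevConst *
      ∑' k : ℤ, 2 * Real.pi * (1 + (k : ℝ) ^ 2 + (k : ℝ) ^ 4) * ‖coef k f‖ ^ 2 := by
  set t := fun k : ℤ => 2 * Real.pi * (1 + (k : ℝ) ^ 2 + (k : ℝ) ^ 4) * ‖coef k f‖ ^ 2
  set a : ℤ → ℝ := fun k => √((1 + (k : ℝ) ^ 2)⁻¹)
  set b : ℤ → ℝ := fun k => √(1 + (k : ℝ) ^ 2) * ‖coef k f‖
  have ha2 : ∀ k, a k ^ 2 = (1 + (k : ℝ) ^ 2)⁻¹ := fun k => Real.sq_sqrt (by positivity)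
  have hb2 : ∀ k, b k ^ 2 = (1 + (k : ℝ) ^ 2) * ‖coef k f‖ ^ 2 := fun k => by
    rw [mul_pow, Real.sq_sqrt (by positivity)]
  have hab : ∀ k, a k * b k = ‖coef k f‖ := fun k => by
    simp only [a, b]
    rw [Real.sqrt_inv, ← mul_assoc, inv_mul_cancel₀ (by positivity), one_mul]
  have hbt : ∀ k, b k ^ 2 ≤ t k := fun k => by
    rw [hb2]
    have := one_le_sobolev_weight k
    simp only [t]
    gcongr
  have hsa : Summable fun k => a k ^ 2 := by simp only [ha2]; exact summable_inv_one_add_sq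
  have hsb : Summable fun k => b k ^ 2 := h.of_nonneg_of_le (fun k => by positivity) hbt
  have hcs := Real.inner_le_Lp_mul_Lq_tsum_of_nonneg (p := 2) (q := 2) (f := a) (g := b)
    (by norm_num [Real.holderConjugate_iff]) (fun k => by positivity) (fun k => by positivity)
    (by simpa using hsa) (by simpa using hsb)
  simp only [hab, Real.rpow_two, ha2] at hcs
  have hsm := Real.summable_mul_of_Lp_Lq_of_nonneg (p := 2) (q := 2) (f := a) (g := b)
    (by norm_num [Real.holderConjugate_iff]) (fun k => by positivity) (fun k => by positivity)
    (by simpa using hsa) (by simpa using hsb)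
  simp only [hab] at hsm
  have h2 : ‖f‖ ≤ sobolevConst ^ (1 / 2 : ℝ) * (∑' k, b k ^ 2) ^ (1 / 2 : ℝ) :=
    (norm_le_tsum_coef hsm).trans hcs
  have hS : 0 ≤ sobolevConst := tsum_nonneg fun k => by positivity
  have hB : 0 ≤ ∑' k, b k ^ 2 := tsum_nonneg fun k => by positivity
  rw [← Real.sqrt_eq_rpow, ← Real.sqrt_eq_rpow, ← Real.sqrt_mul hS] at h2
  calc ‖f‖ ^ 2 ≤ (√(sobolevConst * ∑' k, b k ^ 2)) ^ 2 := by gcongr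
    _ = sobolevConst * ∑' k, b k ^ 2 := Real.sq_sqrt (by positivity)
    _ ≤ _ := by
      gcongr
      exact hbt _

/-- The operator `invW` gains two derivatives. -/
theorem sobolev_invW_le (f : CircFun) (k : ℤ) :
    2 * Real.pi * (1 + (k : ℝ) ^ 2 + (k : ℝ) ^ 4) * ‖coef k (invW f)‖ ^ 2 ≤
      6 * Real.pi * ‖coef k f‖ ^ 2 := by
  by_cases hk : k.natAbs = 1
  · rw [coef_of_firstHarm (firstHarm_invW f) hk]
    simp
    positivity
  · rw [← coef_invW f hk, norm_mul, mul_pow]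
    have h1 : ‖(1 - (k : ℂ) ^ 2)‖ ^ 2 = (1 - (k : ℝ) ^ 2) ^ 2 := by
      rw [show (1 - (k : ℂ) ^ 2) = ((1 - (k : ℝ) ^ 2 : ℝ) : ℂ) by push_cast; rfl,
        Complex.norm_real, Real.norm_eq_abs, sq_abs]
    have h2 : 1 + (k : ℝ) ^ 2 + (k : ℝ) ^ 4 ≤ 3 * (1 - (k : ℝ) ^ 2) ^ 2 := by
      by_cases h0 : k = 0
      · subst h0; norm_num
      · have h3 : 2 ≤ |k| := by
          rw [Int.abs_eq_natAbs]
          omega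
        have h4 : (4 : ℝ) ≤ (k : ℝ) ^ 2 := by
          have h5 : (4 : ℤ) ≤ k ^ 2 := by
            rw [← sq_abs]; nlinarith
          exact_mod_cast h5
        nlinarith
    rw [h1]
    calc 2 * Real.pi * (1 + (k : ℝ) ^ 2 + (k : ℝ) ^ 4) * ‖coef k (invW f)‖ ^ 2
        ≤ 2 * Real.pi * (3 * (1 - (k : ℝ) ^ 2) ^ 2) * ‖coef k (invW f)‖ ^ 2 := by gcongr
      _ = _ := by ring

/-! ### The scaled range equation -/

/-- The data of a range equation: the embedding of `V`, the inverse of `∂² + 1` on `W`, the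
coupling operator and the pointwise product. -/
structure RangeData (V E : Type*) [NormedAddCommGroup V] [NormedSpace ℝ V]
    [NormedAddCommGroup E] [NormedSpace ℝ E] where
  lift : V →L[ℝ] E
  inv : E →L[ℝ] E
  coupling : E →L[ℝ] E
  mul : E →L[ℝ] E →L[ℝ] E

namespace RangeData

variable {V E V' E' : Type*} [NormedAddCommGroup V] [NormedSpace ℝ V]
  [NormedAddCommGroup E] [NormedSpace ℝ E] [NormedAddCommGroup V'] [NormedSpace ℝ V']
  [NormedAddCommGroup E'] [NormedSpace ℝ E'] (D : RangeData V E) (D' : RangeData V' E')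

/-- The cube of an element of `E`. -/
def cube (u : E) : E := D.mul u (D.mul u u)

/-- The right hand side `g` in `W = K g / (1 + μω)`. -/
def source (φ : V) (ε μ ω : ℝ) (W : E) : E :=
  (μ * ω) • W + (μ * ε) • D.coupling W - D.cube (D.lift φ + μ • W)

/-- The scaled range equation `(1 + μω) W = K [μω W + με L W - (φ + μ W)³]`. Here `μ = ρ²` and
`w = ρ³ W`; the powers of `ρ` cancel since `γ² = 1 + μω`. -/
def Solves (φ : V) (ε μ ω : ℝ) (W : E) : Prop :=
  (1 + μ * ω) • W = D.inv (D.source φ ε μ ω W)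

variable {D D'}

theorem cube_smul (t : ℝ) (u : E) : D.cube (t • u) = t ^ 3 • D.cube u := by
  simp only [cube, map_smul, smul_apply, smul_smul]
  congr 1
  ring

theorem norm_cube_sub_le (a b : E) {M : ℝ} (ha : ‖a‖ ≤ M) (hb : ‖b‖ ≤ M) :
    ‖D.cube a - D.cube b‖ ≤ 3 * ‖D.mul‖ ^ 2 * M ^ 2 * ‖a - b‖ := by
  have hM : 0 ≤ M := (norm_nonneg a).trans ha
  have h1 : D.cube a - D.cube b = D.mul (a - b) (D.mul a a) + D.mul b (D.mul (a - b) a)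
      + D.mul b (D.mul b (a - b)) := by
    simp only [cube, map_sub, sub_apply]
    abel
  have h2 : ∀ x y z : E, ‖D.mul x (D.mul y z)‖ ≤ ‖D.mul‖ * ‖x‖ * (‖D.mul‖ * ‖y‖ * ‖z‖) :=
    fun x y z => (D.mul.le_opNorm₂ _ _).trans (by gcongr; exact D.mul.le_opNorm₂ _ _)
  have h3 := h2 (a - b) a a
  have h4 := h2 b (a - b) a
  have h5 := h2 b b (a - b)
  have h6 : ‖D.mul‖ * ‖a - b‖ * (‖D.mul‖ * ‖a‖ * ‖a‖) ≤
      ‖D.mul‖ * ‖a - b‖ * (‖D.mul‖ * M * M) := by gcongr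
  have h7 : ‖D.mul‖ * ‖b‖ * (‖D.mul‖ * ‖a - b‖ * ‖a‖) ≤
      ‖D.mul‖ * M * (‖D.mul‖ * ‖a - b‖ * M) := by gcongr
  have h8 : ‖D.mul‖ * ‖b‖ * (‖D.mul‖ * ‖b‖ * ‖a - b‖) ≤
      ‖D.mul‖ * M * (‖D.mul‖ * M * ‖a - b‖) := by gcongr
  rw [h1]
  refine (norm_add₃_le).trans ?_
  nlinarith

/-- Bounded solutions of the scaled range equation are unique for small `μ`. -/
theorem exists_unique_bound (D : RangeData V E) (R : ℝ) : ∃ μ₁ > 0, ∀ (φ : V) (ε μ ω : ℝ),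
    ‖φ‖ < 4 → |ε| < 1 → |μ| < μ₁ → |ω| < 1 → ∀ W₁ W₂ : E, ‖W₁‖ ≤ R → ‖W₂‖ ≤ R →
    D.Solves φ ε μ ω W₁ → D.Solves φ ε μ ω W₂ → W₁ = W₂ := by
  set M := ‖D.lift‖ * 4 + R with hM
  set C := ‖D.inv‖ * (1 + ‖D.coupling‖ + 3 * ‖D.mul‖ ^ 2 * M ^ 2) with hC
  have hC0 : 0 ≤ C := by positivity
  refine ⟨1 / (2 * (C + 1)), by positivity, fun φ ε μ ω hφ hε hμ hω W₁ W₂ h₁ h₂ e₁ e₂ => ?_⟩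
  have hR : 0 ≤ R := (norm_nonneg _).trans h₁
  rw [lt_div_iff₀ (by positivity)] at hμ
  have hμ1 : |μ| ≤ 1 / 2 := by nlinarith [abs_nonneg μ]
  have hμ2 : |μ| * C ≤ 1 / 2 - |μ| := by linarith
  have hle : ∀ W : E, ‖W‖ ≤ R → ‖D.lift φ + μ • W‖ ≤ M := fun W hW => by
    refine (norm_add_le _ _).trans ?_
    have a1 : ‖D.lift φ‖ ≤ ‖D.lift‖ * 4 := (D.lift.le_opNorm φ).trans (by gcongr)
    have a2 : ‖μ • W‖ ≤ 1 * R := by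
      rw [norm_smul, Real.norm_eq_abs]
      gcongr
      linarith
    linarith
  have h3 : (1 + μ * ω) • (W₁ - W₂) = D.inv ((μ * ω) • (W₁ - W₂) + (μ * ε) • D.coupling (W₁ - W₂)
      - (D.cube (D.lift φ + μ • W₁) - D.cube (D.lift φ + μ • W₂))) := by
    rw [smul_sub, e₁, e₂, ← map_sub]
    congr 1
    simp only [source, smul_sub, map_sub]
    abel
  have h4 := norm_cube_sub_le (D := D) _ _ (hle W₁ h₁) (hle W₂ h₂)
  have h5 : D.lift φ + μ • W₁ - (D.lift φ + μ • W₂) = μ • (W₁ - W₂) := by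
    rw [smul_sub]; abel
  rw [h5, norm_smul, Real.norm_eq_abs] at h4
  set d := ‖W₁ - W₂‖
  have hd : 0 ≤ d := norm_nonneg _
  have h6 : ‖(1 + μ * ω) • (W₁ - W₂)‖ ≤ ‖D.inv‖ * (|μ| * d + |μ| * (‖D.coupling‖ * d)
      + 3 * ‖D.mul‖ ^ 2 * M ^ 2 * (|μ| * d)) := by
    rw [h3]
    refine (D.inv.le_opNorm _).trans ?_
    gcongr
    refine (norm_sub_le _ _).trans (add_le_add ((norm_add_le _ _).trans (add_le_add ?_ ?_)) h4)
    · rw [norm_smul, Real.norm_eq_abs, abs_mul]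
      have : |μ| * |ω| ≤ |μ| * 1 := by gcongr
      have : |μ| * |ω| * d ≤ |μ| * 1 * d := by gcongr
      linarith
    · rw [norm_smul, Real.norm_eq_abs, abs_mul]
      have a1 : |μ| * |ε| ≤ |μ| * 1 := by gcongr
      rw [mul_one] at a1
      gcongr
      exact D.coupling.le_opNorm _
  have h7 : (1 - |μ|) * d ≤ ‖(1 + μ * ω) • (W₁ - W₂)‖ := by
    rw [norm_smul, Real.norm_eq_abs]
    gcongr
    have a1 : |μ * ω| ≤ |μ| * 1 := by rw [abs_mul]; gcongr
    have a2 := neg_abs_le (μ * ω)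
    have a3 := le_abs_self (1 + μ * ω)
    linarith
  have h8 : ‖D.inv‖ * (|μ| * d + |μ| * (‖D.coupling‖ * d)
      + 3 * ‖D.mul‖ ^ 2 * M ^ 2 * (|μ| * d)) = |μ| * C * d := by rw [hC]; ring
  have h9 : |μ| * C * d ≤ (1 / 2 - |μ|) * d := by gcongr
  have h10 : d ≤ 0 := by nlinarith
  exact sub_eq_zero.1 (norm_eq_zero.1 (le_antisymm h10 hd))

theorem solves_smul {φ : V} {ε μ ω : ℝ} {W : E} {t : ℝ} (ht : t ≠ 0)
    (h : D.Solves (t • φ) (t ^ 2 * ε) ((t ^ 2)⁻¹ * μ) (t ^ 2 * ω) W) :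
    D.Solves φ ε μ ω ((t ^ 3)⁻¹ • W) := by
  have e1 : (t ^ 2)⁻¹ * μ * (t ^ 2 * ω) = μ * ω := by field_simp
  have e2 : (t ^ 2)⁻¹ * μ * (t ^ 2 * ε) = μ * ε := by field_simp
  have e3 : D.lift (t • φ) + ((t ^ 2)⁻¹ * μ) • W = t • (D.lift φ + μ • ((t ^ 3)⁻¹ • W)) := by
    rw [map_smul, smul_add, smul_smul, smul_smul]
    congr 2
    field_simp
  unfold Solves source at h ⊢
  rw [e1, e2, e3, cube_smul] at h
  rw [smul_comm, h, ← map_smul]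
  congr 1
  rw [smul_sub, smul_add, map_smul, smul_smul, smul_smul ((t ^ 3)⁻¹) (t ^ 3),
    inv_mul_cancel₀ (by positivity), one_smul]
  module

/-- A smooth solution map of the scaled range equation, on a domain that is uniform in `φ`. The
implicit function theorem is applied at `φ = 0`; the scaling
`(φ, ε, μ, ω, W) ↦ (t φ, t² ε, t⁻² μ, t² ω, t³ W)` then enlarges the domain. -/
theorem exists_solution [CompleteSpace V] [CompleteSpace E] (D : RangeData V E) :
    ∃ μ₀ > 0, ∃ R > 0, ∃ W : V × ℝ × ℝ × ℝ → E, ∀ (φ : V) (ε μ ω : ℝ),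
      ‖φ‖ < 4 → |ε| < 1 → |μ| < μ₀ → |ω| < 1 →
      D.Solves φ ε μ ω (W (φ, ε, μ, ω)) ∧ ‖W (φ, ε, μ, ω)‖ ≤ R ∧
      ContDiffAt ℝ 1 W (φ, ε, μ, ω) := by
  let f : (V × ℝ × ℝ × ℝ) × E → E := fun p =>
    (1 + p.1.2.2.1 * p.1.2.2.2) • p.2 - D.inv (D.source p.1.1 p.1.2.1 p.1.2.2.1 p.1.2.2.2 p.2)
  have hf : ContDiff ℝ 1 f := by
    simp only [f, source, cube]
    fun_prop
  have hf0 : f (0, 0) = 0 := by simp [f, source, cube]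
  have hfd : (fderiv ℝ f (0, 0)).comp (ContinuousLinearMap.inr ℝ (V × ℝ × ℝ × ℝ) E)
      = ContinuousLinearMap.id ℝ E := by
    have h1 : HasFDerivAt f (fderiv ℝ f (0, 0)) (ContinuousLinearMap.inr ℝ (V × ℝ × ℝ × ℝ) E 0) := by
      have := (hf.differentiable (by norm_num) (0, 0)).hasFDerivAt
      simpa using this
    have h2 := h1.comp (0 : E) (ContinuousLinearMap.inr ℝ (V × ℝ × ℝ × ℝ) E).hasFDerivAt
    have h3 : f ∘ (ContinuousLinearMap.inr ℝ (V × ℝ × ℝ × ℝ) E) = id := by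
      funext W
      simp [f, source, cube]
    rw [h3] at h2
    exact h2.unique (hasFDerivAt_id 0)
  have hinv : ((fderiv ℝ f (0, 0)).comp
      (ContinuousLinearMap.inr ℝ (V × ℝ × ℝ × ℝ) E)).IsInvertible := by
    rw [hfd]
    exact ⟨ContinuousLinearEquiv.refl ℝ E, rfl⟩
  have hfa : ContDiffAt ℝ 1 f (0, 0) := hf.contDiffAt
  set ψ := hfa.implicitFunction one_ne_zero hinv
  have hψ1 : ∀ᶠ x in 𝓝 (0 : V × ℝ × ℝ × ℝ), f (x, ψ x) = 0 := by
    rw [← hf0]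
    exact hfa.eventually_apply_implicitFunction one_ne_zero hinv
  have hψ2 : ContDiffAt ℝ 1 ψ 0 := hfa.contDiffAt_implicitFunction one_ne_zero hinv
  have hψ3 : ψ 0 = 0 := hfa.implicitFunction_apply_self one_ne_zero hinv
  have hψ4 : ∀ᶠ x in 𝓝 (0 : V × ℝ × ℝ × ℝ), ‖ψ x‖ < 1 := by
    have := hψ2.continuousAt.norm
    rw [ContinuousAt, hψ3, norm_zero] at this
    exact this.eventually_lt_const one_pos
  obtain ⟨η, hη, hball⟩ := Metric.eventually_nhds_iff.1
    (hψ1.and (hψ4.and (hψ2.eventually (by simp))))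
  set t := min 1 (η / 5)
  have ht : 0 < t := by positivity
  have ht1 : t ≤ 1 := min_le_left _ _
  have ht2 : t ≤ η / 5 := min_le_right _ _
  have htsq : t ^ 2 ≤ t := by nlinarith
  let s : V × ℝ × ℝ × ℝ → V × ℝ × ℝ × ℝ := fun p =>
    (t • p.1, t ^ 2 * p.2.1, (t ^ 2)⁻¹ * p.2.2.1, t ^ 2 * p.2.2.2)
  have hs : ContDiff ℝ 1 s := by fun_prop
  refine ⟨t ^ 2 * η, by positivity, (t ^ 3)⁻¹, by positivity, fun p => (t ^ 3)⁻¹ • ψ (s p),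
    fun φ ε μ ω hφ hε hμ hω => ?_⟩
  have hd : dist (s (φ, ε, μ, ω)) 0 < η := by
    rw [dist_zero_right]
    simp only [s, Prod.norm_def, max_lt_iff, norm_smul, norm_mul, Real.norm_eq_abs, norm_inv,
      norm_pow, abs_of_pos ht]
    refine ⟨?_, ?_, ?_, ?_⟩
    · nlinarith [norm_nonneg φ]
    · nlinarith [abs_nonneg ε]
    · rw [inv_mul_lt_iff₀ (by positivity)]; exact hμ
    · nlinarith [abs_nonneg ω]
  obtain ⟨h1, h2, h3⟩ := hball hd
  refine ⟨solves_smul ht.ne' (sub_eq_zero.1 h1), ?_, ?_⟩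
  · rw [norm_smul, Real.norm_eq_abs, abs_of_pos (by positivity)]
    exact mul_le_of_le_one_right (by positivity) h2.le
  · exact contDiffAt_const.smul (ContDiffAt.comp _ h3 hs.contDiffAt)

/-- Maps between two range equations that respect all operations carry solutions to solutions. -/
theorem Solves.map {φ : V} {ε μ ω : ℝ} {W : E} (h : D.Solves φ ε μ ω W)
    (T : E →L[ℝ] E') (t : V → V') (hlift : T (D.lift φ) = D'.lift (t φ))
    (hinv : ∀ f, T (D.inv f) = D'.inv (T f))
    (hmul : ∀ f g, T (D.mul f g) = D'.mul (T f) (T g))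
    (hcoup : ε = 0 ∨ ∀ f, T (D.coupling f) = D'.coupling (T f)) :
    D'.Solves (t φ) ε μ ω (T W) := by
  unfold Solves source cube at *
  rw [← map_smul, h, hinv, map_sub, map_add, map_smul, map_smul, hmul, hmul, map_add, map_smul,
    hlift]
  rcases hcoup with rfl | hc
  · simp
  · rw [hc]

/-- `W` is a solution map of the scaled range equation, defined and smooth on a domain that is
uniform in `φ`, bounded by `R₀` there, and unique among the solutions bounded by `R`. -/
structure IsSolutionMap (D : RangeData V E) (μ₀ R₀ R : ℝ) (W : V × ℝ × ℝ × ℝ → E) : Prop where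
  pos : 0 < μ₀
  le_half : μ₀ ≤ 1 / 2
  le_radius : R₀ ≤ R
  solves : ∀ {φ : V} {ε μ ω : ℝ}, ‖φ‖ < 4 → |ε| < 1 → |μ| < μ₀ → |ω| < 1 →
    D.Solves φ ε μ ω (W (φ, ε, μ, ω))
  bound : ∀ {φ : V} {ε μ ω : ℝ}, ‖φ‖ < 4 → |ε| < 1 → |μ| < μ₀ → |ω| < 1 →
    ‖W (φ, ε, μ, ω)‖ ≤ R₀
  smooth : ∀ {φ : V} {ε μ ω : ℝ}, ‖φ‖ < 4 → |ε| < 1 → |μ| < μ₀ → |ω| < 1 →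
    ContDiffAt ℝ 1 W (φ, ε, μ, ω)
  unique : ∀ {φ : V} {ε μ ω : ℝ}, ‖φ‖ < 4 → |ε| < 1 → |μ| < μ₀ → |ω| < 1 →
    ∀ W' : E, ‖W'‖ ≤ R → D.Solves φ ε μ ω W' → W' = W (φ, ε, μ, ω)

theorem exists_isSolutionMap [CompleteSpace V] [CompleteSpace E] (D : RangeData V E) :
    ∃ R₀ > 0, ∀ R ≥ R₀, ∃ μ₀ W, D.IsSolutionMap μ₀ R₀ R W := by
  obtain ⟨μ₀, hμ₀, R₀, hR₀, W, hW⟩ := D.exists_solution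
  refine ⟨R₀, hR₀, fun R hR => ?_⟩
  obtain ⟨μ₁, hμ₁, hu⟩ := D.exists_unique_bound R
  have h0 : ∀ {μ : ℝ}, |μ| < min (1 / 2) (min μ₀ μ₁) → |μ| < μ₀ := fun h =>
    h.trans_le ((min_le_right _ _).trans (min_le_left _ _))
  have h1 : ∀ {μ : ℝ}, |μ| < min (1 / 2) (min μ₀ μ₁) → |μ| < μ₁ := fun h =>
    h.trans_le ((min_le_right _ _).trans (min_le_right _ _))
  exact ⟨min (1 / 2) (min μ₀ μ₁), W, by positivity, min_le_left _ _, hR,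
    fun a b c d => (hW _ _ _ _ a b (h0 c) d).1, fun a b c d => (hW _ _ _ _ a b (h0 c) d).2.1,
    fun a b c d => (hW _ _ _ _ a b (h0 c) d).2.2, fun a b c d W' hW' hs =>
      hu _ _ _ _ a b (h1 c) d _ _ hW' ((hW _ _ _ _ a b (h0 c) d).2.1.trans hR) hs
        (hW _ _ _ _ a b (h0 c) d).1⟩

/-- A bound for the right hand side of the range equation. -/
def sourceBound (D : RangeData V E) (R : ℝ) : ℝ :=
  R + ‖D.coupling‖ * R + ‖D.mul‖ ^ 2 * (‖D.lift‖ * 4 + R) ^ 3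

theorem norm_source_le {φ : V} {ε μ ω R : ℝ} {W : E} (hφ : ‖φ‖ < 4) (hε : |ε| < 1)
    (hμ : |μ| ≤ 1) (hω : |ω| < 1) (hW : ‖W‖ ≤ R) :
    ‖D.source φ ε μ ω W‖ ≤ D.sourceBound R := by
  have hR : 0 ≤ R := (norm_nonneg _).trans hW
  unfold source sourceBound
  refine (norm_sub_le _ _).trans (add_le_add ((norm_add_le _ _).trans (add_le_add ?_ ?_)) ?_)
  · rw [norm_smul, Real.norm_eq_abs, abs_mul]
    have : |μ| * |ω| ≤ 1 := mul_le_one₀ hμ (abs_nonneg _) hω.le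
    calc |μ| * |ω| * ‖W‖ ≤ 1 * R := by gcongr
      _ = R := one_mul R
  · rw [norm_smul, Real.norm_eq_abs, abs_mul]
    have h1 : |μ| * |ε| ≤ 1 := mul_le_one₀ hμ (abs_nonneg _) hε.le
    calc |μ| * |ε| * ‖D.coupling W‖ ≤ 1 * (‖D.coupling‖ * R) := by
          gcongr
          exact (D.coupling.le_opNorm W).trans (by gcongr)
      _ = _ := one_mul _
  · have h1 : ‖D.lift φ + μ • W‖ ≤ ‖D.lift‖ * 4 + R := by
      refine (norm_add_le _ _).trans (add_le_add ((D.lift.le_opNorm φ).trans (by gcongr)) ?_)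
      rw [norm_smul, Real.norm_eq_abs]
      calc |μ| * ‖W‖ ≤ 1 * R := by gcongr
        _ = R := one_mul R
    set U := D.lift φ + μ • W
    calc ‖D.cube U‖ ≤ ‖D.mul‖ * ‖U‖ * (‖D.mul‖ * ‖U‖ * ‖U‖) :=
          (D.mul.le_opNorm₂ _ _).trans (by gcongr; exact D.mul.le_opNorm₂ _ _)
      _ = ‖D.mul‖ ^ 2 * ‖U‖ ^ 3 := by ring
      _ ≤ _ := by gcongr

end RangeData

/-! ### The range equation of the chain and of a single site -/

/-- The range equation of the chain. -/
def chainData (k₂ k₃ : ℝ) : RangeData Chain (L2 CircFun) where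
  lift := constMap harm
  inv := constMap invW
  coupling := latticeL CircFun k₂ k₃
  mul := siteMul (ContinuousLinearMap.mul ℝ CircFun)

/-- The range equation of a single oscillator. -/
def siteData : RangeData ℂ CircFun where
  lift := harm
  inv := invW
  coupling := 0
  mul := ContinuousLinearMap.mul ℝ CircFun

variable {k₂ k₃ : ℝ}

theorem siteData_cube (f : CircFun) : siteData.cube f = f ^ 3 := by
  change f * (f * f) = f ^ 3
  ring

theorem chainData_cube_apply (u : L2 CircFun) (j : ℤ) :
    (chainData k₂ k₃).cube u j = u j ^ 3 := siteData_cube (u j)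

theorem chainData_source_apply (φ : Chain) (ε μ ω : ℝ) (W : L2 CircFun) (j : ℤ) :
    (chainData k₂ k₃).source φ ε μ ω W j = (μ * ω) • W j
      + (μ * ε) • latticeL CircFun k₂ k₃ W j - (harm (φ j) + μ • W j) ^ 3 := by
  exact congrArg (fun z => (μ * ω) • W j + (μ * ε) • latticeL CircFun k₂ k₃ W j - z)
    (chainData_cube_apply (k₂ := k₂) (k₃ := k₃) (constMap harm φ + μ • W) j)

theorem chainData_solves_iff (φ : Chain) (ε μ ω : ℝ) (W : L2 CircFun) :
    (chainData k₂ k₃).Solves φ ε μ ω W ↔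
      ∀ j, (1 + μ * ω) • W j = invW ((chainData k₂ k₃).source φ ε μ ω W j) :=
  ⟨fun h j => congrFun (congrArg Subtype.val h) j, fun h => site_ext h⟩

theorem coef_latticeL (W : L2 CircFun) (j k : ℤ) :
    coef k (latticeL CircFun k₂ k₃ W j) = latticeOp k₂ k₃ (fun i => coef k (W i)) j := by
  simp only [latticeL_apply, latticeOp, map_add, map_sub, map_smul, Complex.real_smul,
    Complex.ofReal_ofNat]

/-- The range equation in terms of Fourier coefficients, with `γ² = 1 + μω`. -/
theorem chainData_solves_iff_coef {φ : Chain} {ε μ ω γ : ℝ} {W : L2 CircFun}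
    (hγ : γ ^ 2 = 1 + μ * ω) (h0 : 1 + μ * ω ≠ 0) :
    (chainData k₂ k₃).Solves φ ε μ ω W ↔ (∀ j, ∀ k : ℤ, k.natAbs = 1 → coef k (W j) = 0) ∧
      ∀ j, ∀ k : ℤ, k.natAbs ≠ 1 → ((1 - γ ^ 2 * k ^ 2 : ℝ) : ℂ) * coef k (W j)
        - (μ * ε : ℝ) * latticeOp k₂ k₃ (fun i => coef k (W i)) j
        + coef k ((harm (φ j) + μ • W j) ^ 3) = 0 := by
  have h0' : ((1 + μ * ω : ℝ) : ℂ) ≠ 0 := by exact_mod_cast h0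
  have hγ' : ((γ : ℂ)) ^ 2 = 1 + μ * ω := by exact_mod_cast hγ
  rw [chainData_solves_iff]
  have key : ∀ j, ∀ k : ℤ, k.natAbs ≠ 1 →
      (coef k ((1 + μ * ω) • W j) = coef k (invW ((chainData k₂ k₃).source φ ε μ ω W j)) ↔
      ((1 - γ ^ 2 * k ^ 2 : ℝ) : ℂ) * coef k (W j)
        - (μ * ε : ℝ) * latticeOp k₂ k₃ (fun i => coef k (W i)) j
        + coef k ((harm (φ j) + μ • W j) ^ 3) = 0) := fun j k hk => by
    rw [← mul_right_inj' (one_sub_sq_ne_zero hk), coef_invW _ hk, chainData_source_apply,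
      map_sub, map_add, map_smul, map_smul, map_smul, coef_latticeL]
    simp only [Complex.real_smul]
    push_cast
    rw [hγ']
    constructor <;> intro h <;> linear_combination h
  constructor
  · intro h
    refine ⟨fun j k hk => ?_, fun j k hk => (key j k hk).1 (by rw [h j])⟩
    have h1 := congrArg (coef k) (h j)
    rw [coef_of_firstHarm (firstHarm_invW _) hk, map_smul, Complex.real_smul] at h1
    exact (mul_eq_zero.1 h1).resolve_left h0'
  · rintro ⟨h1, h2⟩ j
    rw [← sub_eq_zero]
    refine circ_eq_zero_of_coef fun k => ?_
    rw [map_sub, sub_eq_zero]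
    by_cases hk : k.natAbs = 1
    · rw [coef_of_firstHarm (firstHarm_invW _) hk, map_smul, h1 j k hk, smul_zero]
    · exact (key j k hk).2 (h2 j k hk)

/-- A sequence of functions on the circle as a function of site and time. -/
def toTime (w : L2 CircFun) (j : ℤ) (τ : ℝ) : ℝ := onLine (w j) τ

theorem sobolevTerm_nonneg (u : ℤ → ℝ → ℝ) (p : ℤ × ℤ) : 0 ≤ sobolevTerm u p := by
  unfold sobolevTerm
  positivity

/-- The range of `invW` consists of `H²` functions. -/
theorem memX2_invW (g : L2 CircFun) : MemX2 (toTime (constMap invW g)) ∧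
    normX2 (toTime (constMap invW g)) ≤ √(6 * Real.pi) * ‖g‖ := by
  have hle : ∀ p : ℤ × ℤ, sobolevTerm (toTime (constMap invW g)) p ≤
      6 * Real.pi * ‖coef p.2 (g p.1)‖ ^ 2 := fun p => sobolev_invW_le (g p.1) p.2
  have hs : Summable fun p : ℤ × ℤ => 6 * Real.pi * ‖coef p.2 (g p.1)‖ ^ 2 := by
    refine Summable.mul_left _ ?_
    rw [summable_prod_of_nonneg fun p => by positivity]
    refine ⟨fun j => (hasSum_coef_sq (g j)).summable, ?_⟩
    exact (hasSum_norm_sq g).summable.of_nonneg_of_le (fun j => tsum_nonneg fun k => by positivity)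
      fun j => tsum_coef_sq_le (g j)
  have hm : Summable (sobolevTerm (toTime (constMap invW g))) :=
    hs.of_nonneg_of_le (sobolevTerm_nonneg _) hle
  refine ⟨⟨fun j => onLine_continuous _, fun j => onLine_periodic _, hm⟩, ?_⟩
  have h1 : ∑' p, sobolevTerm (toTime (constMap invW g)) p ≤ 6 * Real.pi * ‖g‖ ^ 2 := by
    refine (hm.tsum_le_tsum hle hs).trans ?_
    rw [tsum_mul_left]
    gcongr
    have hs' : Summable fun p : ℤ × ℤ => ‖coef p.2 (g p.1)‖ ^ 2 := by
      have := hs.mul_left (6 * Real.pi)⁻¹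
      refine this.congr fun p => ?_
      rw [← mul_assoc, inv_mul_cancel₀ (by positivity), one_mul]
    rw [hs'.tsum_prod, ← (hasSum_norm_sq g).tsum_eq]
    exact ((summable_prod_of_nonneg fun p => by positivity).1 hs').2.tsum_le_tsum
      (fun j => tsum_coef_sq_le (g j)) (hasSum_norm_sq g).summable
  unfold normX2
  calc √(∑' p, sobolevTerm (toTime (constMap invW g)) p) ≤ √(6 * Real.pi * ‖g‖ ^ 2) :=
        Real.sqrt_le_sqrt h1
    _ = _ := by rw [Real.sqrt_mul (by positivity), Real.sqrt_sq (norm_nonneg _)]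

/-- An element of the space `X₂` as a square summable sequence of continuous functions. -/
theorem exists_toTime {u : ℤ → ℝ → ℝ} (hu : MemX2 u) : ∃ w : L2 CircFun, toTime w = u ∧
    ‖w‖ ≤ √sobolevConst * normX2 u := by
  let f : ℤ → CircFun := fun j => ofPeriodic (u j) (hu.cont j) (hu.periodic j)
  have hf : ∀ j, onLine (f j) = u j := fun j => onLine_ofPeriodic _ _ _
  have hterm : ∀ j k, sobolevTerm u (j, k) =
      2 * Real.pi * (1 + (k : ℝ) ^ 2 + (k : ℝ) ^ 4) * ‖coef k (f j)‖ ^ 2 := fun j k => by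
    rw [coef_apply, hf]; rfl
  have hp := (summable_prod_of_nonneg (sobolevTerm_nonneg u)).1 hu.summable
  have hb : ∀ j, ‖f j‖ ^ 2 ≤ sobolevConst * ∑' k, sobolevTerm u (j, k) := fun j => by
    have h1 := hp.1 j
    simp only [hterm] at h1 ⊢
    exact norm_sq_le_sobolev h1
  have hm : Memℓp f 2 := memlp_two_iff.2
    ((hp.2.mul_left sobolevConst).of_nonneg_of_le (fun j => by positivity) hb)
  refine ⟨⟨f, hm⟩, funext fun j => hf j, ?_⟩
  have hS : 0 ≤ sobolevConst := tsum_nonneg fun k => by positivity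
  rw [normX2, ← Real.sqrt_mul hS]
  refine Real.le_sqrt_of_sq_le ?_
  rw [← (hasSum_norm_sq (⟨f, hm⟩ : L2 CircFun)).tsum_eq, hu.summable.tsum_prod, ← tsum_mul_left]
  exact (memlp_two_iff.1 hm).tsum_le_tsum hb (hp.2.mul_left _)

/-- Solutions of the range equation in `X₂` are, up to the factor `ρ³`, solutions of the scaled
range equation. -/
theorem solvesRange_iff {ρ γ ω ε : ℝ} (hρ : ρ ≠ 0) (hγ : γ ^ 2 = 1 + ρ ^ 2 * ω)
    (h0 : 1 + ρ ^ 2 * ω ≠ 0) (φ : Chain) (W : L2 CircFun) :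
    SolvesRange k₂ k₃ γ (ρ ^ 2 * ε) (lift fun i => ρ * φ i) (toTime (ρ ^ 3 • W)) ↔
      MemX2 (toTime (ρ ^ 3 • W)) ∧ (chainData k₂ k₃).Solves φ ε (ρ ^ 2) ω W := by
  have hρ3 : ((ρ : ℂ)) ^ 3 ≠ 0 := by exact_mod_cast pow_ne_zero 3 hρ
  have hc : ∀ j k, fourierC (toTime (ρ ^ 3 • W) j) k = (ρ : ℂ) ^ 3 * coef k (W j) :=
    fun j k => by
      change coef k (ρ ^ 3 • W j) = _
      rw [map_smul, Complex.real_smul]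
      push_cast
      rfl
  have hcube : ∀ j k, fourierC (fun τ => (lift (fun i => ρ * φ i) j τ
      + toTime (ρ ^ 3 • W) j τ) ^ 3) k = (ρ : ℂ) ^ 3 * coef k ((harm (φ j) + ρ ^ 2 • W j) ^ 3) :=
    fun j k => by
      have : (ρ : ℂ) ^ 3 * coef k ((harm (φ j) + ρ ^ 2 • W j) ^ 3) =
          coef k (ρ ^ 3 • (harm (φ j) + ρ ^ 2 • W j) ^ 3) := by
        rw [map_smul, Complex.real_smul]; push_cast; rfl
      rw [this, coef_apply]
      congr 1
      funext τ
      simp only [lift, toTime, site_smul, onLine_smul, onLine_pow, onLine_add, onLine_harm,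
        Complex.re_ofReal_mul, Complex.im_ofReal_mul]
      ring
  have hlat : ∀ j k, latticeOp k₂ k₃ (fun i => fourierC (toTime (ρ ^ 3 • W) i) k) j =
      (ρ : ℂ) ^ 3 * latticeOp k₂ k₃ (fun i => coef k (W i)) j := fun j k => by
    simp only [hc, latticeOp]
    ring
  rw [chainData_solves_iff_coef hγ h0]
  constructor
  · intro h
    refine ⟨h.mem, fun j k hk => ?_, fun j k hk => ?_⟩
    · have := h.memW j k hk
      rw [hc] at this
      exact (mul_eq_zero.1 this).resolve_left hρ3
    · have := h.eqn j k hk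
      rw [hc, hcube, hlat] at this
      refine mul_left_cancel₀ hρ3 ?_
      push_cast at this ⊢
      linear_combination this
  · rintro ⟨h1, h2, h3⟩
    refine ⟨h1, fun j k hk => ?_, fun j k hk => ?_⟩
    · rw [hc, h2 j k hk, mul_zero]
    · rw [hc, hcube, hlat]
      have := h3 j k hk
      push_cast at this ⊢
      linear_combination (ρ : ℂ) ^ 3 * this

/-! ### Identification of the maps of the chain -/

variable {k₂ k₃ : ℝ}

/-- The solution map of the scaled range equation gives the small solution of the range equation:
a solution of smaller `H²` norm is bounded in the maximum norm, hence the same by uniqueness. -/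
theorem rangeSol_eq {μ₀ R₀ R ρ γ ω ε : ℝ} {W : Chain × ℝ × ℝ × ℝ → L2 CircFun}
    (hW : (chainData k₂ k₃).IsSolutionMap μ₀ R₀ R W)
    (hR : √sobolevConst * (√(6 * Real.pi) * (2 * (chainData k₂ k₃).sourceBound R₀)) ≤ R)
    (hρ : ρ ≠ 0) (hρ' : ρ ^ 2 < μ₀) (hω : |ω| < 1) (hγ : γ ^ 2 = 1 + ρ ^ 2 * ω)
    {φ : Chain} (hφ : ‖φ‖ < 4) (hε : |ε| < 1) :
    rangeSol k₂ k₃ γ (ρ ^ 2 * ε) (lift fun i => ρ * φ i) =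
      toTime (ρ ^ 3 • W (φ, ε, ρ ^ 2, ω)) := by
  have hμ : |ρ ^ 2| < μ₀ := by rwa [abs_of_nonneg (sq_nonneg ρ)]
  have hμ1 : |ρ ^ 2| ≤ 1 := by linarith [hW.le_half]
  have hhalf : 1 / 2 ≤ 1 + ρ ^ 2 * ω := by
    have h1 : |ρ ^ 2 * ω| ≤ 1 / 2 * 1 := by
      rw [abs_mul]
      have := hW.le_half
      gcongr
      linarith
    linarith [neg_abs_le (ρ ^ 2 * ω)]
  have h0 : 1 + ρ ^ 2 * ω ≠ 0 := by linarith
  set W₀ := W (φ, ε, ρ ^ 2, ω)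
  have hsol := hW.solves hφ hε hμ hω
  set g := (chainData k₂ k₃).source φ ε (ρ ^ 2) ω W₀
  have hg : ‖g‖ ≤ (chainData k₂ k₃).sourceBound R₀ :=
    RangeData.norm_source_le hφ hε hμ1 hω (hW.bound hφ hε hμ hω)
  have hW₀ : ρ ^ 3 • W₀ = constMap invW ((ρ ^ 3 * (1 + ρ ^ 2 * ω)⁻¹) • g) := by
    have h1 : (1 + ρ ^ 2 * ω) • W₀ = constMap invW g := hsol
    rw [map_smul, ← h1, smul_smul, mul_assoc, inv_mul_cancel₀ h0, mul_one]
  have hmem := memX2_invW ((ρ ^ 3 * (1 + ρ ^ 2 * ω)⁻¹) • g)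
  rw [← hW₀] at hmem
  have hnorm : normX2 (toTime (ρ ^ 3 • W₀)) ≤
      |ρ ^ 3| * (√(6 * Real.pi) * (2 * (chainData k₂ k₃).sourceBound R₀)) := by
    refine hmem.2.trans ?_
    have h2 : (1 + ρ ^ 2 * ω)⁻¹ ≤ 2 := by
      rw [inv_le_comm₀ (by linarith) two_pos]
      linarith
    have h3 : ‖(ρ ^ 3 * (1 + ρ ^ 2 * ω)⁻¹) • g‖ ≤
        |ρ ^ 3| * 2 * (chainData k₂ k₃).sourceBound R₀ := by
      rw [norm_smul, Real.norm_eq_abs, abs_mul, abs_inv, abs_of_pos (by linarith : 0 < 1 + ρ ^ 2 * ω)]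
      gcongr
    calc _ ≤ √(6 * Real.pi) * (|ρ ^ 3| * 2 * (chainData k₂ k₃).sourceBound R₀) := by gcongr
      _ = _ := by ring
  have hS := (solvesRange_iff (k₂ := k₂) (k₃ := k₃) (ε := ε) hρ hγ h0 φ W₀).2 ⟨hmem.1, hsol⟩
  have huniq : ∀ u, SolvesRange k₂ k₃ γ (ρ ^ 2 * ε) (lift fun i => ρ * φ i) u →
      normX2 u ≤ normX2 (toTime (ρ ^ 3 • W₀)) → u = toTime (ρ ^ 3 • W₀) := fun u hu hn => by
    obtain ⟨w, rfl, hw⟩ := exists_toTime hu.mem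
    have hρ3 : ρ ^ 3 ≠ 0 := pow_ne_zero 3 hρ
    have hw1 : w = ρ ^ 3 • ((ρ ^ 3)⁻¹ • w) := by
      rw [smul_smul, mul_inv_cancel₀ hρ3, one_smul]
    rw [hw1] at hu
    have hs := ((solvesRange_iff hρ hγ h0 φ _).1 hu).2
    have hb : ‖(ρ ^ 3)⁻¹ • w‖ ≤ R := by
      rw [norm_smul, norm_inv, Real.norm_eq_abs, inv_mul_le_iff₀ (abs_pos.2 hρ3)]
      calc ‖w‖ ≤ √sobolevConst * (|ρ ^ 3| *
            (√(6 * Real.pi) * (2 * (chainData k₂ k₃).sourceBound R₀))) := by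
            refine hw.trans ?_
            gcongr
            exact hn.trans hnorm
        _ = |ρ ^ 3| * (√sobolevConst *
            (√(6 * Real.pi) * (2 * (chainData k₂ k₃).sourceBound R₀))) := by ring
        _ ≤ _ := by gcongr
    rw [hw1, hW.unique hφ hε hμ hω _ hb hs]
  have hmin : ∀ u, SolvesRange k₂ k₃ γ (ρ ^ 2 * ε) (lift fun i => ρ * φ i) u →
      normX2 (toTime (ρ ^ 3 • W₀)) ≤ normX2 u := fun u hu => by
    by_contra hlt
    rw [huniq u hu (not_le.1 hlt).le] at hlt
    exact hlt le_rfl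
  have hspec := Classical.epsilon_spec (p := fun w =>
    SolvesRange k₂ k₃ γ (ρ ^ 2 * ε) (lift fun i => ρ * φ i) w ∧
      ∀ w', SolvesRange k₂ k₃ γ (ρ ^ 2 * ε) (lift fun i => ρ * φ i) w' → normX2 w ≤ normX2 w')
    ⟨_, hS, hmin⟩
  exact huniq _ hspec.1 (hspec.2 _ hS)

/-- The map `N(u, ε) = -ωu - εLu + Π_V (u + μ W(u, ε))³` of the kernel equation. -/
def kernelMap (k₂ k₃ : ℝ) (W : Chain × ℝ × ℝ × ℝ → L2 CircFun) (p : Chain × ℝ × ℝ × ℝ) : Chain :=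
  -p.2.2.2 • p.1 - p.2.1 • latticeL ℂ k₂ k₃ p.1
    + constMap firstHarm ((chainData k₂ k₃).cube (constMap harm p.1 + p.2.2.1 • W p))

theorem kernelMap_apply (W : Chain × ℝ × ℝ × ℝ → L2 CircFun) (φ : Chain) (ε μ ω : ℝ) (j : ℤ) :
    kernelMap k₂ k₃ W (φ, ε, μ, ω) j = -ω * φ j - ε * latticeOp k₂ k₃ φ j
      + firstHarm ((harm (φ j) + μ • W (φ, ε, μ, ω) j) ^ 3) := by
  have h : kernelMap k₂ k₃ W (φ, ε, μ, ω) j = -ω • φ j - ε • latticeL ℂ k₂ k₃ φ j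
      + firstHarm ((harm (φ j) + μ • W (φ, ε, μ, ω) j) ^ 3) :=
    congrArg (fun z => -ω • φ j - ε • latticeL ℂ k₂ k₃ φ j + firstHarm z)
      (chainData_cube_apply (k₂ := k₂) (k₃ := k₃) (constMap harm φ + μ • W (φ, ε, μ, ω)) j)
  rw [h, latticeL_complex]
  simp [Complex.real_smul]

theorem toChain_coe (u : Chain) : toChain (fun j => u j) = u := by
  have h : Memℓp (fun j => u j) 2 := lp.memℓp u
  rw [toChain, dif_pos h]

theorem mapDNLS_eq (W : Chain × ℝ × ℝ × ℝ → L2 CircFun) (θ : Fin 4 → ℝ) (w : Chain) (ε : ℝ) :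
    mapDNLS k₂ k₃ θ w ε = kernelMap k₂ k₃ W (vDNLS θ + w, ε, 0, 3 / 4)
      - kernelMap k₂ k₃ W (vDNLS θ, 0, 0, 3 / 4) := by
  rw [mapDNLS, ← toChain_coe (kernelMap k₂ k₃ W _ - _)]
  congr 1
  funext j
  rw [site_sub, kernelMap_apply, kernelMap_apply, zero_smul, zero_smul, add_zero, add_zero,
    firstHarm_harm_cube, firstHarm_harm_cube, dnlsPart]
  have h : latticeOp k₂ k₃ (vDNLS θ + w : Chain) j
      = latticeOp k₂ k₃ (fun i => vDNLS θ i + w i) j := rfl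
  rw [h, site_add]
  push_cast
  ring

theorem sq_mul_scaledRemainder {μ₀ R₀ R ρ γ ω ε : ℝ} {W : Chain × ℝ × ℝ × ℝ → L2 CircFun}
    (hW : (chainData k₂ k₃).IsSolutionMap μ₀ R₀ R W)
    (hR : √sobolevConst * (√(6 * Real.pi) * (2 * (chainData k₂ k₃).sourceBound R₀)) ≤ R)
    (hρ : ρ ≠ 0) (hρ' : ρ ^ 2 < μ₀) (hω : |ω| < 1) (hγ : γ ^ 2 = 1 + ρ ^ 2 * ω)
    {φ : Chain} (hφ : ‖φ‖ < 4) (hε : |ε| < 1) (j : ℤ) :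
    ((ρ ^ 2 : ℝ) : ℂ) * scaledRemainder k₂ k₃ γ ρ (ρ ^ 2 * ε) (fun i => φ i) j =
      firstHarm ((harm (φ j) + ρ ^ 2 • W (φ, ε, ρ ^ 2, ω) j) ^ 3) - cubic (φ j) := by
  rw [scaledRemainder, remainder, rangeSol_eq hW hR hρ hρ' hω hγ hφ hε]
  set W₀ := W (φ, ε, ρ ^ 2, ω)
  have h1 : (fun τ => (lift (fun i => ρ * φ i) j τ + toTime (ρ ^ 3 • W₀) j τ) ^ 3) =
      onLine (ρ ^ 3 • (harm (φ j) + ρ ^ 2 • W₀ j) ^ 3) := by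
    funext τ
    simp only [lift, toTime, site_smul, onLine_smul, onLine_pow, onLine_add, onLine_harm,
      Complex.re_ofReal_mul, Complex.im_ofReal_mul]
    ring
  have h2 : (fun τ => lift (fun i => ρ * φ i) j τ ^ 3) = onLine (ρ ^ 3 • harm (φ j) ^ 3) := by
    funext τ
    simp only [lift, onLine_smul, onLine_pow, onLine_harm,
      Complex.re_ofReal_mul, Complex.im_ofReal_mul]
    ring
  rw [h1, h2, ← firstHarm_apply, ← firstHarm_apply, map_smul, map_smul, firstHarm_harm_cube,
    Complex.real_smul, Complex.real_smul]
  have h3 : (ρ : ℂ) ≠ 0 := by exact_mod_cast hρ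
  push_cast
  field_simp

theorem mapKG_eq {μ₀ R₀ R ρ γ ω ε : ℝ} {W : Chain × ℝ × ℝ × ℝ → L2 CircFun}
    (hW : (chainData k₂ k₃).IsSolutionMap μ₀ R₀ R W)
    (hR : √sobolevConst * (√(6 * Real.pi) * (2 * (chainData k₂ k₃).sourceBound R₀)) ≤ R)
    (hρ : ρ ≠ 0) (hρ' : ρ ^ 2 < μ₀) (hω : |ω| < 1) (hγ : γ ^ 2 = 1 + ρ ^ 2 * ω)
    {x : ℝ → ℝ} {θ : Fin 4 → ℝ} {w : Chain}
    (hv : ‖vKG ρ x θ‖ < 4) (hw : ‖vKG ρ x θ + w‖ < 4) (hε : |ε| < 1) :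
    mapKG k₂ k₃ ρ γ x θ w ε = kernelMap k₂ k₃ W (vKG ρ x θ + w, ε, ρ ^ 2, ω)
      - kernelMap k₂ k₃ W (vKG ρ x θ, 0, ρ ^ 2, ω) := by
  rw [← toChain_coe (kernelMap k₂ k₃ W _ - _)]
  simp only [mapKG]
  congr 1
  funext j
  have hdet : detuning ρ γ = ω := by
    rw [detuning, hγ]
    field_simp
    ring
  have e1 := sq_mul_scaledRemainder hW hR hρ hρ' hω hγ hw hε j
  have e2 := sq_mul_scaledRemainder hW hR hρ hρ' hω hγ hv (by simp : |(0 : ℝ)| < 1) j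
  rw [mul_zero] at e2
  rw [site_sub, kernelMap_apply, kernelMap_apply, hdet, dnlsPart, mul_sub, e2]
  have h : latticeOp k₂ k₃ (vKG ρ x θ + w : Chain) j
      = latticeOp k₂ k₃ (fun i => vKG ρ x θ i + w i) j := rfl
  have e3 : scaledRemainder k₂ k₃ γ ρ (ρ ^ 2 * ε) (fun i => vKG ρ x θ i + w i) j =
    scaledRemainder k₂ k₃ γ ρ (ρ ^ 2 * ε) (fun i => (vKG ρ x θ + w : Chain) i) j := rfl
  rw [h, e3, e1, site_add]
  push_cast
  ring

/-! ### Exact identities for the kernel map -/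

variable {k₂ k₃ : ℝ}

/-- Multiplication by a complex number, as a real linear map. -/
def mulC (c : ℂ) : ℂ →L[ℝ] ℂ := c • ContinuousLinearMap.id ℝ ℂ

@[simp] theorem mulC_apply (c z : ℂ) : mulC c z = c * z := by simp [mulC]

/-- The total function `U = φ + μ W` of a solution of the range equation. -/
def total (W : Chain × ℝ × ℝ × ℝ → L2 CircFun) (p : Chain × ℝ × ℝ × ℝ) : L2 CircFun :=
  constMap harm p.1 + p.2.2.1 • W p

/-- The time derivative of `total`. -/
def totalDeriv (k₂ k₃ : ℝ) (W : Chain × ℝ × ℝ × ℝ → L2 CircFun) (p : Chain × ℝ × ℝ × ℝ) :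
    L2 CircFun :=
  constMap (harm.comp (mulC (-Complex.I))) p.1 + (p.2.2.1 * (1 + p.2.2.1 * p.2.2.2)⁻¹) •
    constMap invWDeriv ((chainData k₂ k₃).source p.1 p.2.1 p.2.2.1 p.2.2.2 (W p))

theorem total_apply (W : Chain × ℝ × ℝ × ℝ → L2 CircFun) (φ : Chain) (ε μ ω : ℝ) (j : ℤ) :
    total W (φ, ε, μ, ω) j = harm (φ j) + μ • W (φ, ε, μ, ω) j := rfl

theorem totalDeriv_apply (W : Chain × ℝ × ℝ × ℝ → L2 CircFun) (φ : Chain) (ε μ ω : ℝ) (j : ℤ) :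
    totalDeriv k₂ k₃ W (φ, ε, μ, ω) j = harm (-Complex.I * φ j) + (μ * (1 + μ * ω)⁻¹) •
      invWDeriv ((chainData k₂ k₃).source φ ε μ ω (W (φ, ε, μ, ω)) j) := by
  have h : totalDeriv k₂ k₃ W (φ, ε, μ, ω) j = harm (mulC (-Complex.I) (φ j)) +
    (μ * (1 + μ * ω)⁻¹) •
      invWDeriv ((chainData k₂ k₃).source φ ε μ ω (W (φ, ε, μ, ω)) j) := rfl
  rw [h, mulC_apply]

theorem hasD_of_solves {w g : CircFun} {c : ℝ} (hc : c ≠ 0) (h : c • w = invW g) :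
    HasD w (c⁻¹ • invWDeriv g) ∧ HasD (c⁻¹ • invWDeriv g) (c⁻¹ • projW g - w) ∧
      firstHarm w = 0 := by
  have hw : w = c⁻¹ • invW g := by rw [← h, smul_smul, inv_mul_cancel₀ hc, one_smul]
  refine ⟨?_, ?_, ?_⟩
  · nth_rw 1 [hw]
    exact (hasD_invW g).smul _
  · have h1 := (hasD_invWDeriv g).smul c⁻¹
    rwa [smul_sub, ← hw] at h1
  · rw [hw, map_smul, firstHarm_invW, smul_zero]

/-- The balance law at one site: the component of the residual `N` in the direction of the time
translations is produced by the coupling alone. It is the range equation tested with `∂W`,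
combined with `∫ U³ ∂U = 0`. -/
theorem site_balance {u l : ℂ} {w Lw : CircFun} {ε μ ω : ℝ} (hc : 1 + μ * ω ≠ 0)
    (hLw : firstHarm Lw = 0)
    (h : (1 + μ * ω) • w =
      invW ((μ * ω) • w + (μ * ε) • Lw - (harm u + μ • w) ^ 3)) :
    Real.pi * (starRingEnd ℂ (Complex.I * u) *
        (-ω * u - ε * l + firstHarm ((harm u + μ • w) ^ 3))).re =
      ε * pairing (harm l + μ • Lw) (harm (-Complex.I * u) + (μ * (1 + μ * ω)⁻¹) •
        invWDeriv ((μ * ω) • w + (μ * ε) • Lw - (harm u + μ • w) ^ 3)) := by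
  obtain ⟨h1, h2, h3⟩ := hasD_of_solves hc h
  set g := (μ * ω) • w + (μ * ε) • Lw - (harm u + μ • w) ^ 3 with hg
  set U := harm u + μ • w with hU
  rw [← smul_smul]
  set w' := (1 + μ * ω)⁻¹ • invWDeriv g
  have hw' : firstHarm w' = 0 := by rw [h1.firstHarm_eq, h3, mul_zero]
  have hUD : HasD U (harm (-Complex.I * u) + μ • w') := (hasD_harm u).add (h1.smul μ)
  -- the range equation tested with `∂w`
  have e1 : pairing g w' = 0 := by
    have a1 := h2.pairing_self
    rw [map_sub, map_smul, pairing_comm w' w, h1.pairing_self, sub_zero, projW_apply, map_sub,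
      pairing_comm w' (harm _), pairing_harm_of_firstHarm hw', sub_zero, smul_eq_mul,
      pairing_comm] at a1
    exact (mul_eq_zero.1 a1).resolve_left (inv_ne_zero hc)
  have e2 : pairing (U ^ 3) w' = μ * ε * pairing Lw w' := by
    rw [hg] at e1
    simp only [map_add, map_sub, map_smul, add_apply, sub_apply, smul_apply, h1.pairing_self,
      smul_eq_mul, mul_zero, zero_add] at e1
    linarith
  have e3 : pairing (U ^ 3) (harm (-Complex.I * u) + μ • w') = 0 := by
    have a1 := (hUD.mul hUD).pairing_self
    have a2 : U * U * ((harm (-Complex.I * u) + μ • w') * U + U * (harm (-Complex.I * u) + μ • w'))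
        = (2 : ℝ) • (U ^ 3 * (harm (-Complex.I * u) + μ • w')) := by
      rw [two_smul]
      ring
    rw [pairing_apply, a2, map_smul, smul_eq_mul] at a1
    exact (mul_eq_zero.1 a1).resolve_left two_ne_zero
  rw [map_add, map_smul, e2, smul_eq_mul] at e3
  have e4 : Real.pi * (starRingEnd ℂ (Complex.I * u) * firstHarm (U ^ 3)).re =
      μ * (μ * ε * pairing Lw w') := by
    rw [← pairing_harm, pairing_comm]
    have : harm (Complex.I * u) = -harm (-Complex.I * u) := by
      rw [← map_neg]
      congr 1
      ring
    rw [this, map_neg]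
    linarith
  have e5 : Real.pi * (starRingEnd ℂ (Complex.I * u) * l).re =
      -pairing (harm l) (harm (-Complex.I * u)) := by
    rw [pairing_comm, pairing_harm, firstHarm_harm]
    simp
    ring
  have e6 : (starRingEnd ℂ (Complex.I * u) * u).re = 0 := by
    simp
    ring
  have e7 : (starRingEnd ℂ (Complex.I * u) * (-ω * u - ε * l + firstHarm (U ^ 3))).re =
      -ω * (starRingEnd ℂ (Complex.I * u) * u).re - ε * (starRingEnd ℂ (Complex.I * u) * l).re
      + (starRingEnd ℂ (Complex.I * u) * firstHarm (U ^ 3)).re := by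
    have : starRingEnd ℂ (Complex.I * u) * (-ω * u - ε * l + firstHarm (U ^ 3)) =
        ((-ω : ℝ) : ℂ) * (starRingEnd ℂ (Complex.I * u) * u)
        - (ε : ℂ) * (starRingEnd ℂ (Complex.I * u) * l)
        + starRingEnd ℂ (Complex.I * u) * firstHarm (U ^ 3) := by
      push_cast
      ring
    rw [this, Complex.add_re, Complex.sub_re, Complex.re_ofReal_mul, Complex.re_ofReal_mul]
  have e8 : pairing (harm l + μ • Lw) (harm (-Complex.I * u) + μ • w') =
      pairing (harm l) (harm (-Complex.I * u)) + μ * (μ * pairing Lw w') := by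
    simp only [map_add, map_smul, add_apply, smul_apply, smul_eq_mul,
      pairing_harm_of_firstHarm hw', pairing_comm Lw (harm _), pairing_harm_of_firstHarm hLw]
    ring
  rw [e7, e6, e8]
  linear_combination e4 - ε * e5

section Chain

variable {μ₀ R₀ R : ℝ} {W : Chain × ℝ × ℝ × ℝ → L2 CircFun} {φ : Chain} {ε μ ω : ℝ}

theorem RangeData.IsSolutionMap.one_add_ne_zero {V E : Type*} [NormedAddCommGroup V]
    [NormedSpace ℝ V] [NormedAddCommGroup E] [NormedSpace ℝ E] {D : RangeData V E}
    {W : V × ℝ × ℝ × ℝ → E} (hW : D.IsSolutionMap μ₀ R₀ R W)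
    (hμ : |μ| < μ₀) (hω : |ω| < 1) : 1 + μ * ω ≠ 0 := by
  have h1 : |μ * ω| ≤ 1 / 2 * 1 := by
    rw [abs_mul]
    have := hW.le_half
    gcongr
    linarith
  linarith [neg_abs_le (μ * ω)]

variable (hW : (chainData k₂ k₃).IsSolutionMap μ₀ R₀ R W)
  (hφ : ‖φ‖ < 4) (hε : |ε| < 1) (hμ : |μ| < μ₀) (hω : |ω| < 1)

include hW hφ hε hμ hω

theorem site_solves (j : ℤ) : (1 + μ * ω) • W (φ, ε, μ, ω) j =
    invW ((chainData k₂ k₃).source φ ε μ ω (W (φ, ε, μ, ω)) j) :=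
  (chainData_solves_iff _ _ _ _ _).1 (hW.solves hφ hε hμ hω) j

theorem firstHarm_latticeL (j : ℤ) :
    firstHarm (latticeL CircFun k₂ k₃ (W (φ, ε, μ, ω)) j) = 0 := by
  have h : ∀ i, firstHarm (W (φ, ε, μ, ω) i) = 0 := fun i =>
    (hasD_of_solves (hW.one_add_ne_zero hμ hω) (site_solves hW hφ hε hμ hω i)).2.2
  simp only [latticeL_apply, map_add, map_sub, map_smul, h, smul_zero, sub_zero, add_zero]

theorem hasD_total (j : ℤ) :
    HasD (total W (φ, ε, μ, ω) j) (totalDeriv k₂ k₃ W (φ, ε, μ, ω) j) := by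
  have h := (hasD_of_solves (hW.one_add_ne_zero hμ hω) (site_solves hW hφ hε hμ hω j)).1
  rw [total_apply, totalDeriv_apply, ← smul_smul]
  exact (hasD_harm _).add (h.smul μ)

theorem kernelMap_balance (j : ℤ) :
    Real.pi * (starRingEnd ℂ (Complex.I * φ j) * kernelMap k₂ k₃ W (φ, ε, μ, ω) j).re =
      ε * pairing (latticeL CircFun k₂ k₃ (total W (φ, ε, μ, ω)) j)
        (totalDeriv k₂ k₃ W (φ, ε, μ, ω) j) := by
  have h1 := site_solves hW hφ hε hμ hω j
  rw [chainData_source_apply] at h1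
  have h2 := site_balance (l := latticeL ℂ k₂ k₃ φ j) (hW.one_add_ne_zero hμ hω)
    (firstHarm_latticeL hW hφ hε hμ hω j) h1
  have h3 : latticeL CircFun k₂ k₃ (total W (φ, ε, μ, ω)) j = harm (latticeL ℂ k₂ k₃ φ j)
      + μ • latticeL CircFun k₂ k₃ (W (φ, ε, μ, ω)) j := by
    rw [total, map_add, map_smul, latticeL_constMap]
    rfl
  rw [kernelMap_apply, totalDeriv_apply, chainData_source_apply, h3, ← latticeL_complex]
  exact h2

omit hW hφ hε hμ hω in
theorem summable_pairing (u v : L2 CircFun) (m : ℤ) :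
    Summable fun j => pairing (u (j + m)) (v j) := by
  have h1 : Summable fun j => ‖u (j + m)‖ ^ 2 :=
    ((Equiv.addRight m).summable_iff (f := fun j => ‖u j‖ ^ 2)).2 (hasSum_norm_sq u).summable
  have h2 := (hasSum_norm_sq v).summable
  refine Summable.of_norm_bounded ((h1.add h2).mul_left ‖integ‖) fun j => ?_
  rw [pairing_apply]
  refine (integ.le_opNorm _).trans ?_
  gcongr
  refine (norm_mul_le _ _).trans ?_
  nlinarith [sq_nonneg (‖u (j + m)‖ - ‖v j‖), sq_nonneg (‖u (j + m)‖), sq_nonneg ‖v j‖]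

omit hW hφ hε hμ hω in
/-- The coupling does no work on a time translation of the whole chain. -/
theorem hasSum_pairing_latticeL {u u' : L2 CircFun} (h : ∀ j, HasD (u j) (u' j)) :
    HasSum (fun j => pairing (latticeL CircFun k₂ k₃ u j) (u' j)) 0 := by
  set A : ℤ → ℝ := fun m => ∑' j, pairing (u (j + m)) (u' j)
  have hA : ∀ m, HasSum (fun j => pairing (u (j + m)) (u' j)) (A m) := fun m =>
    (summable_pairing u u' m).hasSum
  have hanti : ∀ m, A m + A (-m) = 0 := fun m => by
    have h1 : A m = ∑' j, -pairing (u (j + -m)) (u' j) := by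
      rw [← (Equiv.addRight m).tsum_eq]
      refine tsum_congr fun j => ?_
      simp only [Equiv.coe_addRight]
      rw [add_neg_cancel_right, pairing_comm (u j), (h (j + m)).pairing_deriv (h j), neg_neg]
    rw [h1, tsum_neg]
    exact neg_add_cancel _
  have h0 : A 0 = 0 := by linarith [hanti 0, congrArg A neg_zero]
  have key := (((hA (-1)).sub ((hA 0).mul_left 2)).add (hA 1)).add
    (((((hA (-2)).sub ((hA 0).mul_left 2)).add (hA 2)).mul_left k₂)) |>.add
    (((((hA (-3)).sub ((hA 0).mul_left 2)).add (hA 3)).mul_left k₃))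
  have hval : A (-1) - 2 * A 0 + A 1 + k₂ * (A (-2) - 2 * A 0 + A 2)
      + k₃ * (A (-3) - 2 * A 0 + A 3) = 0 := by
    have h1 := hanti 1
    have h2 := hanti 2
    have h3 := hanti 3
    rw [h0]
    linear_combination h1 + k₂ * h2 + k₃ * h3
  rw [hval] at key
  refine (congrArg (HasSum · 0) (funext fun j => ?_)).mp key
  simp only [latticeL_apply, map_add, map_neg, map_smul, add_apply, neg_apply, smul_apply,
    smul_eq_mul, sub_eq_add_neg, add_zero]

/-- Conservation of the total action. -/
theorem hasSum_kernelMap : HasSum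
    (fun j => (starRingEnd ℂ (Complex.I * φ j) * kernelMap k₂ k₃ W (φ, ε, μ, ω) j).re) 0 := by
  have h := (hasSum_pairing_latticeL (k₂ := k₂) (k₃ := k₃)
    (hasD_total hW hφ hε hμ hω)).mul_left (Real.pi⁻¹ * ε)
  rw [mul_zero] at h
  refine (congrArg (HasSum · 0) (funext fun j => ?_)).mp h
  rw [mul_assoc, ← kernelMap_balance hW hφ hε hμ hω, ← mul_assoc,
    inv_mul_cancel₀ Real.pi_ne_zero, one_mul]

theorem contDiffAt_total : ContDiffAt ℝ 1 (total W) (φ, ε, μ, ω) := by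
  have h := hW.smooth hφ hε hμ hω
  unfold total
  fun_prop

theorem contDiffAt_totalDeriv : ContDiffAt ℝ 1 (totalDeriv k₂ k₃ W) (φ, ε, μ, ω) := by
  have h := hW.smooth hφ hε hμ hω
  have h0 := hW.one_add_ne_zero hμ hω
  unfold totalDeriv RangeData.source RangeData.cube
  fun_prop (disch := assumption)

theorem contDiffAt_kernelMap : ContDiffAt ℝ 1 (kernelMap k₂ k₃ W) (φ, ε, μ, ω) := by
  have h := hW.smooth hφ hε hμ hω
  unfold kernelMap RangeData.cube
  fun_prop

end Chain

/-! ### Symmetries of the range equation and the uncoupled chain -/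

variable {k₂ k₃ μ₀ R₀ R : ℝ}

theorem RangeData.IsSolutionMap.mono {V E : Type*} [NormedAddCommGroup V] [NormedSpace ℝ V]
    [NormedAddCommGroup E] [NormedSpace ℝ E] {D : RangeData V E} {W : V × ℝ × ℝ × ℝ → E}
    (hW : D.IsSolutionMap μ₀ R₀ R W) {μ₁ : ℝ} (h0 : 0 < μ₁) (h1 : μ₁ ≤ μ₀) :
    D.IsSolutionMap μ₁ R₀ R W :=
  ⟨h0, h1.trans hW.le_half, hW.le_radius, fun a b c d => hW.solves a b (c.trans_le h1) d,
    fun a b c d => hW.bound a b (c.trans_le h1) d, fun a b c d => hW.smooth a b (c.trans_le h1) d,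
    fun a b c d => hW.unique a b (c.trans_le h1) d⟩

theorem norm_constMap_le {X Y : Type*} [NormedAddCommGroup X] [NormedSpace ℝ X]
    [NormedAddCommGroup Y] [NormedSpace ℝ Y] (A : X →L[ℝ] Y) (hA : ∀ x, ‖A x‖ ≤ ‖x‖) (u : L2 X) :
    ‖constMap A u‖ ≤ ‖u‖ := by
  have h := norm_le_of_le (v := constMap A u) u (Equiv.refl ℤ) zero_le_one
    fun j => by rw [one_mul]; exact hA _
  rwa [one_mul] at h

/-- The gauge action `φ ↦ e^{-iα} φ`, which is the time shift by `α` on `V`. -/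
def rot (α : ℝ) : Chain →L[ℝ] Chain := constMap (mulC (Complex.exp (-α * Complex.I)))

@[simp] theorem rot_apply (α : ℝ) (φ : Chain) (j : ℤ) :
    rot α φ j = Complex.exp (-α * Complex.I) * φ j := by
  rw [rot, constMap_apply, mulC_apply]

theorem norm_exp_phase (α : ℝ) : ‖Complex.exp (-α * Complex.I)‖ = 1 := by
  rw [← Complex.ofReal_neg, Complex.norm_exp_ofReal_mul_I]

theorem norm_rot_le (α : ℝ) (φ : Chain) : ‖rot α φ‖ ≤ ‖φ‖ :=
  norm_constMap_le _ (fun x => by rw [mulC_apply, norm_mul, norm_exp_phase, one_mul]) φ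

section Chain

variable {W : Chain × ℝ × ℝ × ℝ → L2 CircFun} {φ : Chain} {ε μ ω : ℝ}
  (hW : (chainData k₂ k₃).IsSolutionMap μ₀ R₀ R W)
  (hφ : ‖φ‖ < 4) (hε : |ε| < 1) (hμ : |μ| < μ₀) (hω : |ω| < 1)

include hW hφ hε hμ hω

theorem solutionMap_rot (α : ℝ) :
    W (rot α φ, ε, μ, ω) = constMap (timeShift α) (W (φ, ε, μ, ω)) := by
  refine (hW.unique ((norm_rot_le α φ).trans_lt hφ) hε hμ hω _ ?_ ?_).symm
  · exact (norm_constMap_le _ (norm_pullBack_le _) _).trans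
      ((hW.bound hφ hε hμ hω).trans hW.le_radius)
  · refine (hW.solves hφ hε hμ hω).map (constMap (timeShift α)) (rot α) ?_ ?_ ?_ (Or.inr ?_)
    · refine site_ext fun j => ?_
      change timeShift α (harm (φ j)) = harm (rot α φ j)
      rw [timeShift_harm, rot_apply]
    · exact fun f => site_ext fun j => timeShift_invW α (f j)
    · exact fun f g => site_ext fun j => rfl
    · exact fun f => (latticeL_constMap k₂ k₃ (timeShift α) f).symm

theorem total_rot (α : ℝ) :
    total W (rot α φ, ε, μ, ω) = constMap (timeShift α) (total W (φ, ε, μ, ω)) := by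
  refine site_ext fun j => ?_
  rw [constMap_apply, total_apply, total_apply, solutionMap_rot hW hφ hε hμ hω, constMap_apply,
    map_add, map_smul, timeShift_harm, rot_apply]

theorem totalDeriv_rot (α : ℝ) : totalDeriv k₂ k₃ W (rot α φ, ε, μ, ω) =
    constMap (timeShift α) (totalDeriv k₂ k₃ W (φ, ε, μ, ω)) := by
  refine site_ext fun j => circ_ext fun τ => ?_
  have h1 := hasD_total hW ((norm_rot_le α φ).trans_lt hφ) hε hμ hω j
  rw [total_rot hW hφ hε hμ hω] at h1
  exact (h1 τ).unique (((hasD_total hW hφ hε hμ hω j).timeShift α) τ)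

theorem kernelMap_rot (α : ℝ) :
    kernelMap k₂ k₃ W (rot α φ, ε, μ, ω) = rot α (kernelMap k₂ k₃ W (φ, ε, μ, ω)) := by
  refine site_ext fun j => ?_
  have h1 := congrArg (fun u : L2 CircFun => u j) (total_rot hW hφ hε hμ hω α)
  simp only [constMap_apply, total_apply] at h1
  rw [rot_apply, kernelMap_apply, kernelMap_apply, h1]
  have h2 : timeShift α (harm (φ j) + μ • W (φ, ε, μ, ω) j) ^ 3 =
      timeShift α ((harm (φ j) + μ • W (φ, ε, μ, ω) j) ^ 3) := rfl
  rw [h2, firstHarm_timeShift]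
  simp only [latticeOp, rot_apply]
  ring

/-- The work done by the coupling at one site is gauge invariant. -/
theorem pairing_rot (α : ℝ) (j : ℤ) :
    pairing (latticeL CircFun k₂ k₃ (total W (rot α φ, ε, μ, ω)) j)
      (totalDeriv k₂ k₃ W (rot α φ, ε, μ, ω) j) =
    pairing (latticeL CircFun k₂ k₃ (total W (φ, ε, μ, ω)) j)
      (totalDeriv k₂ k₃ W (φ, ε, μ, ω) j) := by
  rw [total_rot hW hφ hε hμ hω, totalDeriv_rot hW hφ hε hμ hω, latticeL_constMap, constMap_apply,
    constMap_apply, pairing_apply, pairing_apply]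
  exact integ_timeShift α (latticeL CircFun k₂ k₃ (total W (φ, ε, μ, ω)) j *
    totalDeriv k₂ k₃ W (φ, ε, μ, ω) j)

end Chain

section Site

variable {S : ℂ × ℝ × ℝ × ℝ → CircFun} {z : ℂ} {μ ω : ℝ}

/-- Without coupling the sites of the chain are independent. -/
theorem solutionMap_uncoupled {R₀' R' : ℝ} {W : Chain × ℝ × ℝ × ℝ → L2 CircFun} {φ : Chain}
    (hW : (chainData k₂ k₃).IsSolutionMap μ₀ R₀ R W) (hS : siteData.IsSolutionMap μ₀ R₀' R' S)
    (hR : R₀ ≤ R') (hφ : ‖φ‖ < 4) (hμ : |μ| < μ₀) (hω : |ω| < 1) (j : ℤ) :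
    W (φ, 0, μ, ω) j = S (φ j, 0, μ, ω) := by
  have h0 : |(0 : ℝ)| < 1 := by simp
  refine hS.unique ((norm_site_le φ j).trans_lt hφ) h0 hμ hω _
    ((norm_site_le _ j).trans ((hW.bound hφ h0 hμ hω).trans hR)) ?_
  exact (hW.solves hφ h0 hμ hω).map (D' := siteData) (evalSite CircFun j) (fun φ => φ j) rfl
    (fun f => rfl) (fun f g => rfl) (Or.inl rfl)

/-- The residual of the kernel equation of a single oscillator. -/
def siteResidual (S : ℂ × ℝ × ℝ × ℝ → CircFun) (z : ℂ) (μ ω : ℝ) : ℂ :=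
  -ω * z + firstHarm ((harm z + μ • S (z, 0, μ, ω)) ^ 3)

theorem kernelMap_uncoupled {R₀' R' : ℝ} {W : Chain × ℝ × ℝ × ℝ → L2 CircFun} {φ : Chain}
    (hW : (chainData k₂ k₃).IsSolutionMap μ₀ R₀ R W) (hS : siteData.IsSolutionMap μ₀ R₀' R' S)
    (hR : R₀ ≤ R') (hφ : ‖φ‖ < 4) (hμ : |μ| < μ₀) (hω : |ω| < 1) (j : ℤ) :
    kernelMap k₂ k₃ W (φ, 0, μ, ω) j = siteResidual S (φ j) μ ω := by
  rw [kernelMap_apply, solutionMap_uncoupled hW hS hR hφ hμ hω, siteResidual]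
  push_cast
  ring

variable (hS : siteData.IsSolutionMap μ₀ R₀ R S)
  (hz : ‖z‖ < 4) (hμ : |μ| < μ₀) (hω : |ω| < 1)

include hS hz hμ hω

theorem siteMap_rot (α : ℝ) :
    S (Complex.exp (-α * Complex.I) * z, 0, μ, ω) = timeShift α (S (z, 0, μ, ω)) := by
  have h0 : |(0 : ℝ)| < 1 := by simp
  refine (hS.unique (by rwa [norm_mul, norm_exp_phase, one_mul]) h0 hμ hω _ ?_ ?_).symm
  · exact (norm_pullBack_le _ _).trans ((hS.bound hz h0 hμ hω).trans hS.le_radius)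
  · exact (hS.solves hz h0 hμ hω).map (timeShift α) (fun z => Complex.exp (-α * Complex.I) * z)
      (timeShift_harm α z) (timeShift_invW α) (fun f g => rfl) (Or.inl rfl)

theorem siteMap_conj : S (starRingEnd ℂ z, 0, μ, ω) = timeRev (S (z, 0, μ, ω)) := by
  have h0 : |(0 : ℝ)| < 1 := by simp
  refine (hS.unique (by rwa [RCLike.norm_conj]) h0 hμ hω _ ?_ ?_).symm
  · exact (norm_pullBack_le _ _).trans ((hS.bound hz h0 hμ hω).trans hS.le_radius)
  · exact (hS.solves hz h0 hμ hω).map timeRev (starRingEnd ℂ) (timeRev_harm z) timeRev_invW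
      (fun f g => rfl) (Or.inl rfl)

theorem siteMap_neg : S (-z, 0, μ, ω) = -S (z, 0, μ, ω) := by
  have h0 : |(0 : ℝ)| < 1 := by simp
  refine (hS.unique (by rwa [norm_neg]) h0 hμ hω _ ?_ ?_).symm
  · rw [norm_neg]
    exact (hS.bound hz h0 hμ hω).trans hS.le_radius
  · have h := hS.solves hz h0 hμ hω
    have e : siteData.source (-z) 0 μ ω (-S (z, 0, μ, ω)) =
        -siteData.source z 0 μ ω (S (z, 0, μ, ω)) := by
      simp only [RangeData.source, siteData_cube, map_neg, smul_neg]
      rw [← neg_add _ (μ • S (z, 0, μ, ω)),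
        Odd.neg_pow (by decide : Odd 3) (siteData.lift z + μ • S (z, 0, μ, ω))]
      abel
    unfold RangeData.Solves at h ⊢
    rw [e, map_neg, ← h, smul_neg]

theorem siteResidual_rot (α : ℝ) : siteResidual S (Complex.exp (-α * Complex.I) * z) μ ω =
    Complex.exp (-α * Complex.I) * siteResidual S z μ ω := by
  rw [siteResidual, siteMap_rot hS hz hμ hω, ← timeShift_harm, ← map_smul, ← map_add]
  have h2 : timeShift α (harm z + μ • S (z, 0, μ, ω)) ^ 3 =
      timeShift α ((harm z + μ • S (z, 0, μ, ω)) ^ 3) := rfl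
  rw [h2, firstHarm_timeShift, siteResidual]
  ring

theorem siteResidual_conj :
    siteResidual S (starRingEnd ℂ z) μ ω = starRingEnd ℂ (siteResidual S z μ ω) := by
  rw [siteResidual, siteMap_conj hS hz hμ hω, ← timeRev_harm, ← map_smul, ← map_add]
  have h2 : timeRev (harm z + μ • S (z, 0, μ, ω)) ^ 3 =
      timeRev ((harm z + μ • S (z, 0, μ, ω)) ^ 3) := rfl
  rw [h2, firstHarm_timeRev, siteResidual]
  simp

/-- A zero of the residual gives a solution of `(1 + μω) y'' + y + μ y³ = 0`. -/
theorem exists_hasD_site (h : siteResidual S z μ ω = 0) :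
    ∃ y', HasD (harm z + μ • S (z, 0, μ, ω)) y' ∧
      HasD y' (-(1 + μ * ω)⁻¹ • (harm z + μ • S (z, 0, μ, ω)
        + μ • (harm z + μ • S (z, 0, μ, ω)) ^ 3)) := by
  have h0 : |(0 : ℝ)| < 1 := by simp
  have hc := hS.one_add_ne_zero hμ hω
  have h1 := hS.solves hz h0 hμ hω
  set w := S (z, 0, μ, ω)
  unfold RangeData.Solves at h1
  have e : siteData.source z 0 μ ω w = (μ * ω) • w - (harm z + μ • w) ^ 3 := by
    rw [RangeData.source, siteData_cube, mul_zero, zero_smul, add_zero]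
    rfl
  rw [e] at h1
  obtain ⟨a1, a2, a3⟩ := hasD_of_solves hc h1
  refine ⟨_, (hasD_harm z).add (a1.smul μ), ((hasD_harm _).add (a2.smul μ)).congr ?_⟩
  have e2 : firstHarm ((harm z + μ • w) ^ 3) = (ω : ℂ) * z := by
    rw [siteResidual] at h
    linear_combination h
  have e3 : harm (-Complex.I * (-Complex.I * z)) = -harm z := by
    rw [← map_neg]
    congr 1
    linear_combination z * Complex.I_sq
  rw [projW_apply, map_sub, map_smul, a3, e2, e3, smul_zero, zero_sub, map_neg,
    ← Complex.real_smul, map_smul]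
  set c := 1 + μ * ω
  have hμω : μ * ω = c - 1 := by simp [c]
  have e4 : ∀ f : CircFun, f = c⁻¹ • c • f := fun f => by rw [smul_smul, inv_mul_cancel₀ hc, one_smul]
  rw [e4 (-harm z + _), neg_smul]
  nth_rw 2 [← smul_neg]
  congr 1
  rw [smul_add, smul_comm c μ, smul_sub, smul_smul c c⁻¹, mul_inv_cancel₀ hc, one_smul, hμω]
  have e5 : μ • ω • harm z = (c - 1) • harm z := by rw [smul_smul, hμω]
  simp only [smul_sub, smul_neg, smul_add, e5, sub_neg_eq_add]
  module

end Site

/-! ### The family of periodic orbits of a single oscillator -/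

/-- The implicit function theorem for `f (x, y) = 0`, in the form used below. -/
theorem exists_implicit {X Y Z : Type*} [NormedAddCommGroup X] [NormedSpace ℝ X] [CompleteSpace X]
    [NormedAddCommGroup Y] [NormedSpace ℝ Y] [CompleteSpace Y]
    [NormedAddCommGroup Z] [NormedSpace ℝ Z] [CompleteSpace Z] {f : X × Y → Z} {x₀ : X} {y₀ : Y}
    (hf : ContDiffAt ℝ 1 f (x₀, y₀)) (h0 : f (x₀, y₀) = 0) {A : Y →L[ℝ] Z}
    (hA : HasFDerivAt (fun y => f (x₀, y)) A y₀) (hinv : A.IsInvertible) :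
    ∃ g : X → Y, g x₀ = y₀ ∧ ContDiffAt ℝ 1 g x₀ ∧ (∀ᶠ x in 𝓝 x₀, f (x, g x) = 0) ∧
      ∀ᶠ p in 𝓝 (x₀, y₀), f p = 0 → p.2 = g p.1 := by
  have hfd : (fderiv ℝ f (x₀, y₀)).comp (ContinuousLinearMap.inr ℝ X Y) = A := by
    have h1 := (hf.differentiableAt one_ne_zero).hasFDerivAt
    exact (h1.comp y₀ (hasFDerivAt_prodMk_right x₀ y₀)).unique hA
  rw [← hfd] at hinv
  have h1 := hf.eventually_apply_implicitFunction one_ne_zero hinv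
  have h2 := hf.eventually_apply_eq_iff_implicitFunction one_ne_zero hinv
  rw [h0] at h1 h2
  exact ⟨hf.implicitFunction one_ne_zero hinv, hf.implicitFunction_apply_self one_ne_zero hinv,
    hf.contDiffAt_implicitFunction one_ne_zero hinv, h1,
    h2.mono fun p hp h => (hp.1 h).symm⟩

theorem eventually_abs_lt {p : ℝ → Prop} (h : ∀ᶠ μ in 𝓝 0, p μ) :
    ∃ μ₁ > 0, ∀ μ : ℝ, |μ| < μ₁ → p μ := by
  obtain ⟨a, ha, h⟩ := Metric.eventually_nhds_iff.1 h
  exact ⟨a, ha, fun μ hμ => h (by rwa [Real.dist_eq, sub_zero])⟩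

/-- The family of periodic orbits of the scaled oscillator `(1 + μω) y'' + y + μ y³ = 0`, `y(0) = 1`:
amplitude `r` of the first harmonic and detuning `ω` as functions of `μ`. -/
structure OrbitFamily (S : ℂ × ℝ × ℝ × ℝ → CircFun) (μ₁ : ℝ) (r ω : ℝ → ℝ) : Prop where
  r_zero : r 0 = 1
  ω_zero : ω 0 = 3 / 4
  smooth_r : ∀ {μ : ℝ}, |μ| < μ₁ → ContDiffAt ℝ 1 r μ
  smooth_ω : ∀ {μ : ℝ}, |μ| < μ₁ → ContDiffAt ℝ 1 ω μ
  r_mem : ∀ {μ : ℝ}, |μ| < μ₁ → |r μ - 1| < 1 / 4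
  ω_mem : ∀ {μ : ℝ}, |μ| < μ₁ → |ω μ| < 1
  residual : ∀ {μ : ℝ}, |μ| < μ₁ → siteResidual S (r μ) μ (ω μ) = 0
  init : ∀ {μ : ℝ}, |μ| < μ₁ →
    onLine (harm (r μ) + μ • S ((r μ : ℂ), 0, μ, ω μ)) 0 = 1

/-- Evaluation at time zero. -/
def evalZero : CircFun →L[ℝ] ℝ :=
  LinearMap.mkContinuous
    { toFun := fun f => onLine f 0
      map_add' := fun _ _ => rfl
      map_smul' := fun _ _ => rfl } 1 fun f => by
    rw [one_mul]
    exact abs_onLine_le f 0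

theorem evalZero_apply (f : CircFun) : evalZero f = onLine f 0 := rfl

theorem exists_orbitFamily {μ₀ R₀ R : ℝ} {S : ℂ × ℝ × ℝ × ℝ → CircFun}
    (hS : siteData.IsSolutionMap μ₀ R₀ R S) :
    ∃ μ₁ > 0, μ₁ ≤ μ₀ ∧ ∃ r ω : ℝ → ℝ, OrbitFamily S μ₁ r ω := by
  let f : ℝ × ℝ × ℝ → ℝ × ℝ := fun p =>
    ((siteResidual S p.2.1 p.1 p.2.2).re,
      evalZero (harm p.2.1 + p.1 • S ((p.2.1 : ℂ), 0, p.1, p.2.2)) - 1)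
  have h1 : ContDiffAt ℝ 1 S (((1 : ℝ) : ℂ), 0, 0, 3 / 4) := by
    refine hS.smooth (by simp) (by simp) (by simpa using hS.pos) ?_
    rw [abs_of_pos] <;> norm_num
  have hf : ContDiffAt ℝ 1 f (0, 1, 3 / 4) := by
    have hS' : ContDiffAt ℝ 1 (fun p : ℝ × ℝ × ℝ => S ((p.2.1 : ℂ), 0, p.1, p.2.2))
        (0, 1, 3 / 4) := by
      refine ContDiffAt.comp (0, 1, 3 / 4) h1 (f := fun p : ℝ × ℝ × ℝ =>
        ((p.2.1 : ℂ), (0 : ℝ), p.1, p.2.2)) ?_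
      exact (Complex.ofRealCLM.contDiff.comp contDiff_snd.fst).contDiffAt.prodMk (by fun_prop)
    have hc : ContDiff ℝ 1 fun p : ℝ × ℝ × ℝ => (p.2.1 : ℂ) :=
      Complex.ofRealCLM.contDiff.comp contDiff_snd.fst
    have hc' : ContDiff ℝ 1 fun p : ℝ × ℝ × ℝ => (p.2.2 : ℂ) :=
      Complex.ofRealCLM.contDiff.comp contDiff_snd.snd
    have hy : ContDiffAt ℝ 1 (fun p : ℝ × ℝ × ℝ =>
        harm p.2.1 + p.1 • S ((p.2.1 : ℂ), 0, p.1, p.2.2)) (0, 1, 3 / 4) :=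
      (harm.contDiff.comp hc).contDiffAt.add (contDiffAt_fst.smul hS')
    refine ContDiffAt.prodMk ?_ ?_
    · refine Complex.reCLM.contDiff.contDiffAt.comp (0, 1, 3 / 4) (f := fun p : ℝ × ℝ × ℝ =>
        siteResidual S p.2.1 p.1 p.2.2) ?_
      exact (hc'.neg.mul hc).contDiffAt.add (firstHarm.contDiff.contDiffAt.comp _ (hy.pow 3))
    · exact (evalZero.contDiff.contDiffAt.comp _ hy).sub contDiffAt_const
  have hf0 : ∀ q : ℝ × ℝ, f (0, q) = (-q.2 * q.1 + 3 / 4 * q.1 ^ 3, q.1 - 1) := fun q => by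
    simp only [f, siteResidual, zero_smul, add_zero, firstHarm_harm_cube, cubic, evalZero_apply,
      onLine_harm]
    refine Prod.ext ?_ (by simp)
    have : (-(q.2 : ℂ) * q.1 + 3 / 4 * q.1 * ((‖(q.1 : ℂ)‖ ^ 2 : ℝ) : ℂ)) =
        ((-q.2 * q.1 + 3 / 4 * q.1 ^ 3 : ℝ) : ℂ) := by
      rw [Complex.norm_real, Real.norm_eq_abs, sq_abs]
      push_cast
      ring
    simp only [this, Complex.ofReal_re]
  have hd : HasFDerivAt (fun q => f (0, q))
      ((((3 / 2 : ℝ) • ContinuousLinearMap.fst ℝ ℝ ℝ - ContinuousLinearMap.snd ℝ ℝ ℝ)).prod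
        (ContinuousLinearMap.fst ℝ ℝ ℝ)) ((1 : ℝ), (3 / 4 : ℝ)) := by
    simp only [hf0]
    have a1 : HasFDerivAt (fun q : ℝ × ℝ => q.1) (ContinuousLinearMap.fst ℝ ℝ ℝ) (1, 3 / 4) :=
      hasFDerivAt_fst
    have a2 : HasFDerivAt (fun q : ℝ × ℝ => q.2) (ContinuousLinearMap.snd ℝ ℝ ℝ) (1, 3 / 4) :=
      hasFDerivAt_snd
    refine HasFDerivAt.prodMk ?_ (a1.sub_const 1)
    refine ((a2.neg.mul a1).add ((a1.pow 3).const_mul (3 / 4))).congr_fderiv ?_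
    ext <;> norm_num
  obtain ⟨g, hg0, hg1, hg2, -⟩ := exists_implicit hf (by rw [hf0]; norm_num) hd (by
    refine ContinuousLinearMap.IsInvertible.of_inverse
      (g := (ContinuousLinearMap.snd ℝ ℝ ℝ).prod
        ((3 / 2 : ℝ) • ContinuousLinearMap.snd ℝ ℝ ℝ - ContinuousLinearMap.fst ℝ ℝ ℝ)) ?_ ?_
    · ext <;> simp
    · ext <;> simp)
  have hr : ∀ᶠ μ in 𝓝 (0 : ℝ), |(g μ).1 - 1| < 1 / 4 := by
    have : ContinuousAt (fun μ => |(g μ).1 - 1|) 0 := by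
      have := hg1.continuousAt
      fun_prop
    refine this.eventually_lt_const ?_
    simp [hg0]
  have hw : ∀ᶠ μ in 𝓝 (0 : ℝ), |(g μ).2| < 1 := by
    have : ContinuousAt (fun μ => |(g μ).2|) 0 := by
      have := hg1.continuousAt
      fun_prop
    refine this.eventually_lt_const ?_
    simp only [hg0]
    rw [abs_of_pos] <;> norm_num
  obtain ⟨μ₁, hμ₁, h⟩ := eventually_abs_lt
    ((hg1.eventually (by simp)).and (hg2.and (hr.and hw)))
  have hle : ∀ {μ : ℝ}, |μ| < min μ₁ μ₀ → |μ| < μ₁ := fun h => h.trans_le (min_le_left _ _)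
  refine ⟨min μ₁ μ₀, lt_min hμ₁ hS.pos, min_le_right _ _, fun μ => (g μ).1, fun μ => (g μ).2,
    ⟨by rw [hg0], by rw [hg0], fun hμ => contDiff_fst.contDiffAt.comp _ (h _ (hle hμ)).1,
      fun hμ => contDiff_snd.contDiffAt.comp _ (h _ (hle hμ)).1,
      fun hμ => (h _ (hle hμ)).2.2.1, fun hμ => (h _ (hle hμ)).2.2.2, fun {μ} hμ => ?_,
      fun {μ} hμ => ?_⟩⟩
  · -- the residual is real at real points, by time reversal
    have h2 := (h _ (hle hμ)).2.2
    have h3 : ‖(((g μ).1 : ℝ) : ℂ)‖ < 4 := by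
      rw [Complex.norm_real, Real.norm_eq_abs]
      have := abs_lt.1 h2.1
      rw [abs_lt]
      constructor <;> linarith
    have h4 := siteResidual_conj hS h3 (hμ.trans_le (min_le_right _ _)) h2.2
    rw [Complex.conj_ofReal] at h4
    refine Complex.ext (congrArg Prod.fst (h _ (hle hμ)).2.1) ?_
    exact Complex.conj_eq_iff_im.1 h4.symm
  · have := congrArg Prod.snd (h _ (hle hμ)).2.1
    exact sub_eq_zero.1 this

/-! ### Identification of the nonlinear oscillation -/

/-- Uniqueness of bounded solutions of `X'' + X + X³ = 0`. -/
theorem duffing_unique {X X' Y Y' : ℝ → ℝ} {M : ℝ} (hX : ∀ t, HasDerivAt X (X' t) t)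
    (hX' : ∀ t, HasDerivAt X' (-X t - X t ^ 3) t) (hY : ∀ t, HasDerivAt Y (Y' t) t)
    (hY' : ∀ t, HasDerivAt Y' (-Y t - Y t ^ 3) t) (hXM : ∀ t, |X t| ≤ M) (hYM : ∀ t, |Y t| ≤ M)
    (h0 : X 0 = Y 0) (h0' : X' 0 = Y' 0) : X = Y := by
  have hM : 0 ≤ M := (abs_nonneg _).trans (hXM 0)
  let s : Set (ℝ × ℝ) := {p | |p.1| ≤ M}
  let v : ℝ → ℝ × ℝ → ℝ × ℝ := fun _ p => (p.2, -p.1 - p.1 ^ 3)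
  have hv : ∀ t, LipschitzOnWith (Real.toNNReal (1 + 3 * M ^ 2)) (v t) s := fun t => by
    refine LipschitzOnWith.of_dist_le_mul fun p hp q hq => ?_
    rw [Real.coe_toNNReal _ (by positivity)]
    have hp' : |p.1| ≤ M := hp
    have hq' : |q.1| ≤ M := hq
    rw [Prod.dist_eq, max_le_iff]
    have e1 : dist p.1 q.1 ≤ dist p q := le_max_left _ _
    have e2 : dist p.2 q.2 ≤ dist p q := le_max_right _ _
    refine ⟨?_, ?_⟩
    · change dist p.2 q.2 ≤ _
      nlinarith [sq_nonneg M, dist_nonneg (x := p) (y := q)]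
    · change dist (-p.1 - p.1 ^ 3) (-q.1 - q.1 ^ 3) ≤ _
      have e3 : (-p.1 - p.1 ^ 3) - (-q.1 - q.1 ^ 3) =
          -((p.1 - q.1) * (1 + (p.1 ^ 2 + p.1 * q.1 + q.1 ^ 2))) := by ring
      rw [Real.dist_eq, e3, abs_neg, abs_mul, ← Real.dist_eq, mul_comm]
      have e4 : |1 + (p.1 ^ 2 + p.1 * q.1 + q.1 ^ 2)| ≤ 1 + 3 * M ^ 2 := by
        have a1 : p.1 ^ 2 ≤ M ^ 2 := sq_le_sq' (by linarith [neg_abs_le p.1]) (by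
          linarith [le_abs_self p.1])
        have a2 : q.1 ^ 2 ≤ M ^ 2 := sq_le_sq' (by linarith [neg_abs_le q.1]) (by
          linarith [le_abs_self q.1])
        rw [abs_of_nonneg (by nlinarith [sq_nonneg (p.1 + q.1), sq_nonneg p.1, sq_nonneg q.1])]
        nlinarith [sq_nonneg (p.1 - q.1)]
      gcongr
  have h := ODE_solution_unique_univ (v := v) (s := fun _ => s) (t₀ := 0)
    (f := fun t => (X t, X' t)) (g := fun t => (Y t, Y' t)) hv
    (fun t => ⟨(hX t).prodMk (hX' t), hXM t⟩) (fun t => ⟨(hY t).prodMk (hY' t), hYM t⟩)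
    (by simp only [h0, h0'])
  exact funext fun t => congrArg Prod.fst (congrFun h t)

/-- The periodic orbit of the family with parameter `μ`. -/
def orbit (S : ℂ × ℝ × ℝ × ℝ → CircFun) (r ω : ℝ → ℝ) (μ : ℝ) : CircFun :=
  harm (r μ) + μ • S ((r μ : ℂ), 0, μ, ω μ)

section Orbit

variable {μ₀ μ₁ R₀ R : ℝ} {S : ℂ × ℝ × ℝ × ℝ → CircFun} {r ω : ℝ → ℝ} {μ : ℝ}
  (hS : siteData.IsSolutionMap μ₀ R₀ R S) (hO : OrbitFamily S μ₁ r ω) (hle : μ₁ ≤ μ₀)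
  (hμ : |μ| < μ₁)

include hO hμ

theorem OrbitFamily.norm_r_lt : ‖((r μ : ℝ) : ℂ)‖ < 4 := by
  rw [Complex.norm_real, Real.norm_eq_abs]
  have := abs_lt.1 (hO.r_mem hμ)
  rw [abs_lt]
  constructor <;> linarith

theorem OrbitFamily.r_pos : 0 < r μ := by
  have := abs_lt.1 (hO.r_mem hμ)
  linarith

include hS hle

theorem timeRev_orbit : timeRev (orbit S r ω μ) = orbit S r ω μ := by
  have h := siteMap_conj hS (hO.norm_r_lt hμ) (hμ.trans_le hle) (hO.ω_mem hμ)
  rw [Complex.conj_ofReal] at h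
  rw [orbit, map_add, map_smul, timeRev_harm, Complex.conj_ofReal, ← h]

theorem timeShift_pi_orbit : timeShift Real.pi (orbit S r ω μ) = -orbit S r ω μ := by
  have h1 := siteMap_rot hS (hO.norm_r_lt hμ) (hμ.trans_le hle) (hO.ω_mem hμ) Real.pi
  have h2 := siteMap_neg hS (hO.norm_r_lt hμ) (hμ.trans_le hle) (hO.ω_mem hμ)
  have h3 : Complex.exp (-Real.pi * Complex.I) = -1 := by
    rw [neg_mul, Complex.exp_neg, Complex.exp_pi_mul_I]
    norm_num
  rw [h3, neg_one_mul] at h1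
  rw [orbit, map_add, map_smul, timeShift_harm, h3, ← h1, h2, neg_one_mul, map_neg, smul_neg,
    neg_add]

theorem firstHarm_orbit : firstHarm (orbit S r ω μ) = r μ := by
  have h1 := hS.solves (hO.norm_r_lt hμ) (by simp : |(0 : ℝ)| < 1) (hμ.trans_le hle) (hO.ω_mem hμ)
  have h2 := (hasD_of_solves (hS.one_add_ne_zero (hμ.trans_le hle) (hO.ω_mem hμ)) h1).2.2
  rw [orbit, map_add, map_smul, h2, smul_zero, add_zero, firstHarm_harm]

theorem exists_hasD_orbit : ∃ y', HasD (orbit S r ω μ) y' ∧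
    HasD y' (-(1 + μ * ω μ)⁻¹ • (orbit S r ω μ + μ • orbit S r ω μ ^ 3)) :=
  exists_hasD_site hS (hO.norm_r_lt hμ) (hμ.trans_le hle) (hO.ω_mem hμ) (hO.residual hμ)

omit hO hμ in
theorem one_add_mul_pos (hO : OrbitFamily S μ₁ r ω) (hμ : |μ| < μ₁) : 0 < 1 + μ * ω μ := by
  have h1 : |μ * ω μ| ≤ 1 / 2 * 1 := by
    rw [abs_mul]
    have h2 := hS.le_half
    have h3 := hO.ω_mem hμ
    gcongr
    linarith
  linarith [neg_abs_le (μ * ω μ)]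

end Orbit

/-- The oscillation of small amplitude `ρ` is the orbit of the family with `μ = ρ²`, scaled by `ρ`;
its frequency is given by `γ² = 1 + ρ² ω(ρ²)`. -/
theorem oscillation_eq {μ₀ μ₁ R₀ R : ℝ} {S : ℂ × ℝ × ℝ × ℝ → CircFun} {r ω : ℝ → ℝ}
    (hS : siteData.IsSolutionMap μ₀ R₀ R S) (hO : OrbitFamily S μ₁ r ω) (hle : μ₁ ≤ μ₀)
    {ρ γ : ℝ} {x : ℝ → ℝ} (hρ : ρ ≠ 0) (hρ' : ρ ^ 2 < μ₁) (hx : IsOscillation ρ γ x) :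
    γ ^ 2 = 1 + ρ ^ 2 * ω (ρ ^ 2) ∧ x = onLine (ρ • orbit S r ω (ρ ^ 2)) := by
  have hμ : |ρ ^ 2| < μ₁ := by rwa [abs_of_nonneg (sq_nonneg ρ)]
  have hc := one_add_mul_pos hS hle hO hμ
  set c := 1 + ρ ^ 2 * ω (ρ ^ 2)
  set y := orbit S r ω (ρ ^ 2)
  obtain ⟨y', hy, hy'⟩ : ∃ y', HasD y y' ∧ HasD y' (-c⁻¹ • (y + ρ ^ 2 • y ^ 3)) :=
    exists_hasD_orbit hS hO hle hμ
  set a := √c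
  have ha : 0 < a := Real.sqrt_pos.2 hc
  have ha2 : a ^ 2 = c := Real.sq_sqrt hc.le
  have hγ := hx.freq_pos
  have hrev : timeRev y = y := timeRev_orbit hS hO hle hμ
  have hy0 : onLine y 0 = 1 := hO.init hμ
  have hy0' : onLine y' 0 = 0 := by
    have h1 := hy.timeRev 0
    rw [hrev] at h1
    have h2 := h1.unique (hy 0)
    rw [onLine_neg, onLine_timeRev, neg_zero] at h2
    linarith
  have hxd : Differentiable ℝ x := hx.smooth.differentiable (by norm_num)
  have hxd' : Differentiable ℝ (deriv x) :=
    (hx.smooth.deriv' (n := 1)).differentiable one_ne_zero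
  have hlin : ∀ b t : ℝ, HasDerivAt (fun t : ℝ => b * t) b t := fun b t => by
    simpa using (hasDerivAt_id t).const_mul b
  set xf := ofPeriodic x hxd.continuous hx.periodic
  have hxf : onLine xf = x := onLine_ofPeriodic _ _ _
  have key : (fun t => x (γ * t)) = fun t => ρ * onLine y (a * t) := by
    refine duffing_unique (M := max ‖xf‖ ‖ρ • y‖) (X' := fun t => γ * deriv x (γ * t))
      (Y' := fun t => ρ * (a * onLine y' (a * t))) ?_ ?_ ?_ ?_ ?_ ?_ ?_ ?_
    · intro t
      exact ((hxd _).hasDerivAt.comp t (hlin γ t)).congr_deriv (mul_comm _ _)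
    · intro t
      refine (((hxd' _).hasDerivAt.comp t (hlin γ t)).const_mul γ).congr_deriv ?_
      linear_combination hx.ode (γ * t)
    · intro t
      exact (((hy _).comp t (hlin a t)).const_mul ρ).congr_deriv (by ring)
    · intro t
      refine ((((hy' _).comp t (hlin a t)).const_mul a).const_mul ρ).congr_deriv ?_
      have hc' : c ≠ 0 := hc.ne'
      simp only [onLine_smul, onLine_add, onLine_pow]
      field_simp
      rw [ha2]
      ring
    · intro t
      rw [← hxf]
      exact (abs_onLine_le xf _).trans (le_max_left _ _)
    · intro t
      exact (abs_onLine_le (ρ • y) (a * t)).trans (le_max_right _ _)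
    · simp only [mul_zero, hx.init, hy0, mul_one]
    · simp only [mul_zero, hx.init_deriv, hy0']
  have hxy : ∀ τ, x τ = ρ * onLine y (a / γ * τ) := fun τ => by
    have h : x (γ * (τ / γ)) = ρ * onLine y (a * (τ / γ)) := congrFun key (τ / γ)
    rw [mul_div_cancel₀ _ hγ.ne'] at h
    rw [h]
    congr 2
    ring
  have hag : a ≤ γ := by
    by_contra! hlt
    refine hx.least_period (γ / a * (2 * Real.pi)) (by positivity) ?_ fun τ => ?_
    · have : γ / a < 1 := (div_lt_one ha).2 hlt
      nlinarith [Real.pi_pos]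
    · rw [hxy, hxy, show a / γ * (τ + γ / a * (2 * Real.pi)) = a / γ * τ + 2 * Real.pi by
        field_simp]
      rw [onLine_periodic y]
  have hper : timeShift (a / γ * (2 * Real.pi)) y = y := circ_ext fun s => by
    have h1 := hxy (γ / a * s + 2 * Real.pi)
    rw [hx.periodic, hxy] at h1
    have h2 := mul_left_cancel₀ hρ h1
    rw [show a / γ * (γ / a * s + 2 * Real.pi) = s + a / γ * (2 * Real.pi) by field_simp,
      show a / γ * (γ / a * s) = s by field_simp] at h2
    rw [onLine_timeShift, h2]
  have hfh := firstHarm_timeShift (a / γ * (2 * Real.pi)) y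
  rw [hper, firstHarm_orbit hS hO hle hμ] at hfh
  have hr : ((r (ρ ^ 2) : ℝ) : ℂ) ≠ 0 := by exact_mod_cast (hO.r_pos hμ).ne'
  have hexp : Complex.exp (-(a / γ * (2 * Real.pi) : ℝ) * Complex.I) = 1 := by
    refine mul_right_cancel₀ hr ?_
    rw [← hfh, one_mul]
  obtain ⟨n, hn⟩ := Complex.exp_eq_one_iff.1 hexp
  have hn' : a / γ = -n := by
    have h1 := congrArg Complex.im hn
    simp at h1
    have h2 := Real.pi_pos
    have h3 : (a / γ + n) * (2 * Real.pi) = 0 := by linarith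
    have := (mul_eq_zero.1 h3).resolve_right (by positivity)
    linarith
  have h1 : 0 < a / γ := by positivity
  have h2 : a / γ ≤ 1 := (div_le_one hγ).2 hag
  have hn1 : n = -1 := by
    rw [hn'] at h1 h2
    have h3 : (-1 : ℝ) ≤ n := by linarith
    have h4 : (n : ℝ) < 0 := by linarith
    have h5 : -1 ≤ n := by exact_mod_cast h3
    have h6 : n < 0 := by exact_mod_cast h4
    lia
  have h3 : a / γ = 1 := by rw [hn', hn1]; norm_num
  refine ⟨?_, funext fun τ => ?_⟩
  · rw [← ha2, (div_eq_one_iff_eq hγ.ne').1 h3]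
  · rw [hxy, h3, one_mul, onLine_smul]

/-! ### The persistence conditions and the correlation of the orbit with its derivative -/

theorem coef_integrand_periodic (f : CircFun) (k : ℤ) :
    Function.Periodic (fun τ : ℝ => Complex.exp (-(k * Complex.I * τ)) * onLine f τ)
      (2 * Real.pi) := fun τ => by
  have h : Complex.exp (-(k * Complex.I * ((τ + 2 * Real.pi : ℝ) : ℂ))) =
      Complex.exp (-(k * Complex.I * τ)) := by
    rw [Complex.exp_eq_exp_iff_exists_int]
    refine ⟨-k, ?_⟩
    push_cast
    ring
  simp only [onLine_periodic f τ, h]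

theorem coef_timeShift (k : ℤ) (α : ℝ) (f : CircFun) :
    coef k (timeShift α f) = Complex.exp (k * α * Complex.I) * coef k f := by
  rw [coef_eq_integral, coef_eq_integral]
  have h1 : ∀ τ : ℝ, Complex.exp (-(k * Complex.I * τ)) * onLine (timeShift α f) τ =
      Complex.exp (k * α * Complex.I) *
        (Complex.exp (-(k * Complex.I * ((τ + α : ℝ) : ℂ))) * onLine f (τ + α)) := fun τ => by
    rw [onLine_timeShift, ← mul_assoc, ← Complex.exp_add]
    congr 2
    push_cast
    ring
  simp only [h1]
  rw [intervalIntegral.integral_const_mul, intervalIntegral.integral_comp_add_right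
    (fun τ : ℝ => Complex.exp (-(k * Complex.I * (τ : ℂ))) * onLine f τ), zero_add,
    add_comm (2 * Real.pi), (coef_integrand_periodic f k).intervalIntegral_add_eq α 0, zero_add]
  ring

theorem coef_timeRev (k : ℤ) (f : CircFun) : coef k (timeRev f) = coef (-k) f := by
  rw [coef_eq_integral, coef_eq_integral]
  have h1 : ∀ τ : ℝ, Complex.exp (-(k * Complex.I * τ)) * onLine (timeRev f) τ =
        (fun τ : ℝ => Complex.exp (-((-k : ℤ) * Complex.I * (τ : ℂ))) * onLine f τ) (-τ) :=
    fun τ => by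
      simp only [onLine_timeRev]
      congr 2
      push_cast
      ring
  have h2 := (coef_integrand_periodic f (-k)).intervalIntegral_add_eq (-(2 * Real.pi)) 0
  rw [neg_add_cancel, zero_add] at h2
  simp only [h1]
  rw [intervalIntegral.integral_comp_neg (fun τ : ℝ => Complex.exp (-((-k : ℤ) * Complex.I *
    (τ : ℂ))) * onLine f τ), neg_zero, h2]

/-- The polarised Parseval identity. -/
theorem hasSum_pairing (f g : CircFun) :
    HasSum (fun k => (coef k f * starRingEnd ℂ (coef k g)).re)
      ((2 * Real.pi)⁻¹ * pairing f g) := by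
  have h := ((hasSum_coef_sq (f + g)).sub (hasSum_coef_sq (f - g))).mul_left (1 / 4)
  have e1 : 1 / 4 * ((2 * Real.pi)⁻¹ * pairing (f + g) (f + g)
      - (2 * Real.pi)⁻¹ * pairing (f - g) (f - g)) = (2 * Real.pi)⁻¹ * pairing f g := by
    simp only [map_add, map_sub, add_apply, sub_apply, pairing_comm g f]
    ring
  rw [e1] at h
  refine (congrArg (HasSum · _) (funext fun k => ?_)).mp h
  rw [map_add, map_sub, Complex.sq_norm, Complex.sq_norm, Complex.normSq_apply,
    Complex.normSq_apply]
  simp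
  ring

theorem cosCoeff_onLine (f : CircFun) (n : ℕ) : cosCoeff (onLine f) n = 2 * (coef n f).re := by
  rw [coef_eq_integral, cosCoeff]
  have h1 : ((1 / (2 * Real.pi) : ℂ)) = ((1 / (2 * Real.pi) : ℝ) : ℂ) := by push_cast; ring
  have h2 := Complex.reCLM.intervalIntegral_comp_comm
    ((fourier_integrand_continuous f n).intervalIntegrable
      (μ := MeasureTheory.volume) 0 (2 * Real.pi))
  rw [h1, Complex.re_ofReal_mul]
  simp only [Complex.reCLM_apply] at h2
  rw [← h2]
  have h3 : ∀ τ : ℝ, (Complex.exp (-((n : ℤ) * Complex.I * τ)) * onLine f τ).re =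
      onLine f τ * Real.cos (n * τ) := fun τ => by
    rw [show (-((n : ℤ) * Complex.I * τ) : ℂ) = ((-(n * τ) : ℝ) : ℂ) * Complex.I by
      push_cast; ring, Complex.re_mul_ofReal, Complex.exp_ofReal_mul_I_re, Real.cos_neg, mul_comm]
  simp only [h3]
  field_simp

/-- For an even `y` with `y(τ + π) = -y(τ)`, the correlation of `y` with `y'` is the function `M`
of the persistence conditions. -/
theorem pairing_timeShift_deriv {y y' : CircFun} (hy : HasD y y') (heven : timeRev y = y)
    (hodd : timeShift Real.pi y = -y) (φ : ℝ) :
    pairing (timeShift φ y) y' = Real.pi * persistenceM (onLine y) φ := by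
  have hreal : ∀ k, (coef k y).im = 0 := fun k => by
    have h1 := coef_timeRev k y
    rw [heven, coef_neg] at h1
    exact Complex.conj_eq_iff_im.1 h1.symm
  have hneg : ∀ k, coef (-k) y = coef k y := fun k => by rw [← coef_timeRev, heven]
  have hz : ∀ m : ℤ, coef (2 * m) y = 0 := fun m => by
    have h1 := coef_timeShift (2 * m) Real.pi y
    have h2 : Complex.exp ((2 * m : ℤ) * Real.pi * Complex.I) = 1 :=
      Complex.exp_eq_one_iff.2 ⟨m, by push_cast; ring⟩
    rw [hodd, map_neg, h2, one_mul] at h1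
    exact self_eq_neg.1 h1.symm
  have h := (hasSum_pairing (timeShift φ y) y').nat_add_neg
  have e1 : ∀ k : ℤ, (coef k (timeShift φ y) * starRingEnd ℂ (coef k y')).re =
      k * (coef k y).re ^ 2 * Real.sin (k * φ) := fun k => by
    rw [coef_timeShift, hy.coef_eq, show (k * φ * Complex.I : ℂ) = ((k * φ : ℝ) : ℂ) * Complex.I by
      push_cast; ring]
    simp only [map_mul, Complex.conj_I, Complex.mul_re, Complex.mul_im, Complex.conj_re,
      Complex.conj_im, Complex.exp_ofReal_mul_I_re, Complex.exp_ofReal_mul_I_im, hreal k,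
      Complex.neg_re, Complex.neg_im, Complex.I_re, Complex.I_im, map_intCast, Complex.intCast_re,
      Complex.intCast_im]
    ring
  simp only [e1, hneg, Int.cast_neg, Int.cast_natCast, Int.cast_zero, zero_mul, add_zero,
    neg_mul, Real.sin_neg, mul_neg, neg_neg] at h
  have hinj : Function.Injective fun m : ℕ => 2 * m + 1 := fun a b hab => by
    simp only at hab
    lia
  rw [← hinj.hasSum_iff] at h
  · have h4 := (h.mul_left 2).tsum_eq
    have hpi := Real.pi_ne_zero
    rw [show Real.pi * persistenceM (onLine y) φ = Real.pi * (2 * ((2 * Real.pi)⁻¹ *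
      pairing (timeShift φ y) y')) by
        rw [← h4, persistenceM]
        congr 1
        refine tsum_congr fun m => ?_
        rw [cosCoeff_onLine]
        simp only [Function.comp_apply]
        push_cast
        ring]
    field_simp
  · intro n hn
    obtain ⟨m, hm⟩ : Even n := by
      by_contra hcon
      obtain ⟨m, hm⟩ := Nat.not_even_iff_odd.1 hcon
      exact hn ⟨m, hm.symm⟩
    have h5 : ((n : ℕ) : ℤ) = 2 * (m : ℤ) := by rw [hm]; push_cast; ring
    rw [h5, hz]
    simp

theorem cosCoeff_smul (ρ : ℝ) (f : CircFun) (n : ℕ) :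
    cosCoeff (onLine (ρ • f)) n = ρ * cosCoeff (onLine f) n := by
  rw [cosCoeff_onLine, cosCoeff_onLine, map_smul, Complex.real_smul, Complex.re_ofReal_mul]
  ring

theorem cosCoeff_one (f : CircFun) : cosCoeff (onLine f) 1 = (firstHarm f).re := by
  have h : coef 1 f = starRingEnd ℂ (coef (-1) f) := by rw [← coef_neg, neg_neg]
  rw [cosCoeff_onLine, Nat.cast_one, h, Complex.conj_re, coef_neg_one]
  simp
  ring

theorem persistenceM_smul (ρ : ℝ) (f : CircFun) (φ : ℝ) :
    persistenceM (onLine (ρ • f)) φ = ρ ^ 2 * persistenceM (onLine f) φ := by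
  rw [persistenceM, persistenceM, ← tsum_mul_left]
  refine tsum_congr fun m => ?_
  rw [cosCoeff_smul]
  ring

theorem persistenceM_neg (x : ℝ → ℝ) (φ : ℝ) : persistenceM x (-φ) = -persistenceM x φ := by
  rw [persistenceM, persistenceM, ← tsum_neg]
  refine tsum_congr fun m => ?_
  rw [mul_neg, Real.sin_neg, mul_neg]

/-! ### Sequences supported on the four central sites -/

theorem site_injective : Function.Injective site := fun a b h => by
  unfold site at h
  exact Fin.ext (by lia)

/-- The embedding of `ℂ⁴` in `ℓ²` as the sequences supported on the central sites. -/
def embS : (Fin 4 → ℂ) →L[ℝ] Chain :=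
  LinearMap.toContinuousLinearMap
    { toFun := fun f => ∑ j, lp.single 2 (site j) (f j)
      map_add' := fun f g => by
        simp only [Pi.add_apply, lp.single_add, Finset.sum_add_distrib]
      map_smul' := fun c f => by
        simp only [Pi.smul_apply, lp.single_smul, Finset.smul_sum, RingHom.id_apply] }

theorem embS_apply (f : Fin 4 → ℂ) : embS f = ∑ j, lp.single 2 (site j) (f j) := rfl

theorem embS_eval (f : Fin 4 → ℂ) (i : ℤ) :
    embS f i = ∑ j, (if i = site j then f j else 0) := by
  rw [← evalSite_apply i (embS f), embS_apply, map_sum]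
  refine Finset.sum_congr rfl fun j _ => ?_
  rw [evalSite_apply, lp.single_apply, Pi.single_apply]

@[simp] theorem embS_site (f : Fin 4 → ℂ) (j : Fin 4) : embS f (site j) = f j := by
  rw [embS_eval]
  simp [site_injective.eq_iff]

theorem embS_off (f : Fin 4 → ℂ) {i : ℤ} (hi : ∀ j, i ≠ site j) : embS f i = 0 := by
  rw [embS_eval]
  simp [hi]

theorem embS_ext {f : Fin 4 → ℂ} {u : Chain} (h1 : ∀ j, u (site j) = f j)
    (h2 : ∀ i, (∀ j, i ≠ site j) → u i = 0) : u = embS f := by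
  refine site_ext fun i => ?_
  by_cases hi : ∀ j, i ≠ site j
  · rw [embS_off f hi, h2 i hi]
  · push Not at hi
    obtain ⟨j, rfl⟩ := hi
    rw [embS_site, h1]

theorem norm_sq_embS (f : Fin 4 → ℂ) : ‖embS f‖ ^ 2 = ∑ j, ‖f j‖ ^ 2 := by
  have h1 := hasSum_norm_sq (embS f)
  rw [← site_injective.hasSum_iff (fun i hi => by
    rw [embS_off f fun j hj => hi ⟨j, hj.symm⟩]
    simp)] at h1
  rw [h1.unique (hasSum_fintype _)]
  simp

theorem torusPoint_eq (r : ℝ) (θ : Fin 4 → ℝ) :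
    torusPoint r θ = embS fun j => (r : ℂ) * Complex.exp (-(θ j : ℂ) * Complex.I) := rfl

theorem kerVec_eq (θ : Fin 4 → ℝ) (κ : R4) :
    kerVec θ κ = embS fun j => (κ j : ℂ) * kerDir θ j := rfl

theorem norm_torusPoint (r : ℝ) (θ : Fin 4 → ℝ) : ‖torusPoint r θ‖ = 2 * |r| := by
  have h : ‖torusPoint r θ‖ ^ 2 = (2 * |r|) ^ 2 := by
    rw [torusPoint_eq, norm_sq_embS]
    simp only [norm_mul, norm_exp_phase, Complex.norm_real, Real.norm_eq_abs, mul_one,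
      Finset.sum_const, Finset.card_univ, Fintype.card_fin, sq_abs]
    rw [mul_pow, sq_abs]
    norm_num
  exact (sq_eq_sq₀ (norm_nonneg _) (by positivity)).1 h

theorem norm_kerDir (θ : Fin 4 → ℝ) (j : Fin 4) : ‖kerDir θ j‖ = 1 := by
  rw [kerDir, norm_mul, norm_exp_phase, Complex.norm_I, one_mul]

theorem norm_kerVec (θ : Fin 4 → ℝ) (κ : R4) : ‖kerVec θ κ‖ = ‖κ‖ := by
  have h : ‖kerVec θ κ‖ ^ 2 = ‖κ‖ ^ 2 := by
    rw [kerVec_eq, norm_sq_embS, EuclideanSpace.norm_sq_eq]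
    simp only [norm_mul, norm_kerDir, Complex.norm_real, mul_one]
  exact (sq_eq_sq₀ (norm_nonneg _) (norm_nonneg _)).1 h

/-! ### The family of kernel maps -/

/-- What the second Lyapunov-Schmidt decomposition uses of the kernel equation: a family `N(u, ε)`
of maps with parameter `μ` (where `μ = ρ²` for KG and `μ = 0` for dNLS), which vanishes on a torus
for `ε = 0`, is equivariant under the gauge action, and has the balance law that its component
along the time translation of the site `j` is `ε B_j`. -/
structure KernelFamily where
  N : Chain × ℝ × ℝ → Chain
  B : Fin 4 → Chain × ℝ × ℝ → ℝ
  r : ℝ → ℝ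
  bound : ℝ
  pos : 0 < bound
  smooth_N : ∀ {u : Chain} {ε μ : ℝ}, ‖u‖ < 4 → |ε| < 1 → |μ| < bound →
    ContDiffAt ℝ 1 N (u, ε, μ)
  smooth_B : ∀ {u : Chain} {ε μ : ℝ} (j : Fin 4), ‖u‖ < 4 → |ε| < 1 → |μ| < bound →
    ContDiffAt ℝ 1 (B j) (u, ε, μ)
  smooth_r : ∀ {μ : ℝ}, |μ| < bound → ContDiffAt ℝ 1 r μ
  r_zero : r 0 = 1
  r_mem : ∀ {μ : ℝ}, |μ| < bound → |r μ - 1| < 1 / 4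
  torus : ∀ {μ : ℝ}, |μ| < bound → ∀ ψ, N (torusPoint (r μ) ψ, 0, μ) = 0
  balance : ∀ {u : Chain} {ε μ : ℝ}, ‖u‖ < 4 → |ε| < 1 → |μ| < bound → ∀ j,
    (starRingEnd ℂ (Complex.I * u (site j)) * N (u, ε, μ) (site j)).re = ε * B j (u, ε, μ)
  conserved : ∀ {u : Chain} {ε μ : ℝ}, ‖u‖ < 4 → |ε| < 1 → |μ| < bound →
    HasSum (fun j => (starRingEnd ℂ (Complex.I * u j) * N (u, ε, μ) j).re) 0
  N_rot : ∀ {u : Chain} {ε μ : ℝ}, ‖u‖ < 4 → |ε| < 1 → |μ| < bound → ∀ α,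
    N (rot α u, ε, μ) = rot α (N (u, ε, μ))
  B_rot : ∀ {u : Chain} {ε μ : ℝ}, ‖u‖ < 4 → |ε| < 1 → |μ| < bound → ∀ α j,
    B j (rot α u, ε, μ) = B j (u, ε, μ)
  base : ∀ (u : Chain) (j : ℤ), N (u, 0, 0) j = -(3 / 4 : ℂ) * u j + cubic (u j)

variable {k₂ k₃ : ℝ}

/-- The work done by the coupling at the site `j` on the time translation, divided by `π`. -/
def work (k₂ k₃ : ℝ) (W : Chain × ℝ × ℝ × ℝ → L2 CircFun) (j : ℤ) (p : Chain × ℝ × ℝ × ℝ) : ℝ :=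
  Real.pi⁻¹ * pairing (latticeL CircFun k₂ k₃ (total W p) j) (totalDeriv k₂ k₃ W p j)

section Work

variable {μ₀ R₀ R : ℝ} {W : Chain × ℝ × ℝ × ℝ → L2 CircFun} {φ : Chain} {ε μ ω : ℝ}
  (hW : (chainData k₂ k₃).IsSolutionMap μ₀ R₀ R W)
  (hφ : ‖φ‖ < 4) (hε : |ε| < 1) (hμ : |μ| < μ₀) (hω : |ω| < 1)

include hW hφ hε hμ hω

theorem contDiffAt_work (j : ℤ) : ContDiffAt ℝ 1 (work k₂ k₃ W j) (φ, ε, μ, ω) := by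
  have h1 : ContDiffAt ℝ 1 (fun p => latticeL CircFun k₂ k₃ (total W p) j) (φ, ε, μ, ω) :=
    ContDiffAt.comp (g := (evalSite CircFun j).comp (latticeL CircFun k₂ k₃)) (φ, ε, μ, ω)
      (ContinuousLinearMap.contDiff _).contDiffAt (contDiffAt_total hW hφ hε hμ hω)
  have h2 : ContDiffAt ℝ 1 (fun p => totalDeriv k₂ k₃ W p j) (φ, ε, μ, ω) :=
    ContDiffAt.comp (g := evalSite CircFun j) (φ, ε, μ, ω)
      (ContinuousLinearMap.contDiff _).contDiffAt (contDiffAt_totalDeriv hW hφ hε hμ hω)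
  have h3 : ContDiffAt ℝ 1 (fun p => pairing (latticeL CircFun k₂ k₃ (total W p) j))
      (φ, ε, μ, ω) := ContDiffAt.comp (g := pairing) (φ, ε, μ, ω)
      (ContinuousLinearMap.contDiff _).contDiffAt h1
  exact contDiffAt_const.mul (h3.clm_apply h2)

theorem kernelMap_eq_work (j : ℤ) :
    (starRingEnd ℂ (Complex.I * φ j) * kernelMap k₂ k₃ W (φ, ε, μ, ω) j).re =
      ε * work k₂ k₃ W j (φ, ε, μ, ω) := by
  have h := kernelMap_balance hW hφ hε hμ hω j
  have := Real.pi_ne_zero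
  rw [work]
  field_simp
  linarith

theorem work_rot (α : ℝ) (j : ℤ) :
    work k₂ k₃ W j (rot α φ, ε, μ, ω) = work k₂ k₃ W j (φ, ε, μ, ω) := by
  rw [work, work, pairing_rot hW hφ hε hμ hω]

end Work

/-- On the torus of uncoupled solutions every central site runs through a time shift of the same
orbit. -/
theorem total_torusPoint {μ₀ μ₁ R₀ R R₀' R' : ℝ} {W : Chain × ℝ × ℝ × ℝ → L2 CircFun}
    {S : ℂ × ℝ × ℝ × ℝ → CircFun} {r ω : ℝ → ℝ}
    (hW : (chainData k₂ k₃).IsSolutionMap μ₀ R₀ R W) (hS : siteData.IsSolutionMap μ₀ R₀' R' S)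
    (hR : R₀ ≤ R') (hO : OrbitFamily S μ₁ r ω) (hle : μ₁ ≤ μ₀) {μ : ℝ} (hμ : |μ| < μ₁)
    (ψ : Fin 4 → ℝ) :
    (∀ j, total W (torusPoint (r μ) ψ, 0, μ, ω μ) (site j) =
      timeShift (ψ j) (orbit S r ω μ)) ∧
    (∀ i, (∀ j, i ≠ site j) → total W (torusPoint (r μ) ψ, 0, μ, ω μ) i = 0) := by
  have hn : ‖torusPoint (r μ) ψ‖ < 4 := by
    rw [norm_torusPoint]
    have := hO.r_mem hμ
    have h2 := abs_sub_abs_le_abs_sub (r μ) 1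
    rw [abs_one] at h2
    linarith
  constructor
  · intro j
    rw [total_apply, solutionMap_uncoupled hW hS hR hn (hμ.trans_le hle) (hO.ω_mem hμ),
      torusPoint_eq, embS_site, mul_comm ((r μ : ℝ) : ℂ),
      siteMap_rot hS (hO.norm_r_lt hμ) (hμ.trans_le hle) (hO.ω_mem hμ), ← timeShift_harm, orbit,
      map_add, map_smul]
  · intro i hi
    have h0 := siteMap_neg hS (z := 0) (by simp) (hμ.trans_le hle) (hO.ω_mem hμ)
    rw [neg_zero] at h0
    replace h0 : S (0, 0, μ, ω μ) = 0 := circ_ext fun τ => by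
      have h1 := congrArg (fun f => onLine f τ) h0
      simp only [onLine_neg] at h1
      have h2 : onLine (0 : CircFun) τ = 0 := rfl
      linarith
    rw [total_apply, solutionMap_uncoupled hW hS hR hn (hμ.trans_le hle) (hO.ω_mem hμ),
      torusPoint_eq, embS_off _ hi, h0, map_zero, smul_zero, add_zero]

/-- On the torus of uncoupled orbits the coupling does no work at the phases that satisfy the
persistence conditions. -/
theorem pairing_eq_zero_of_persistence {U U' : L2 CircFun} {y y' : CircFun} {ψ : Fin 4 → ℝ}
    {ρ : ℝ} (hρ : ρ ≠ 0) (hy : HasD y y') (heven : timeRev y = y)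
    (hodd : timeShift Real.pi y = -y) (hU : ∀ j, U (site j) = timeShift (ψ j) y)
    (hU0 : ∀ i, (∀ j, i ≠ site j) → U i = 0) (hUU' : ∀ j, HasD (U j) (U' j))
    (hP : Persistence k₂ k₃ (onLine (ρ • y)) ψ) (j : Fin 4) :
    pairing (latticeL CircFun k₂ k₃ U (site j)) (U' (site j)) = 0 := by
  set M := persistenceM (onLine y)
  have hM : ∀ φ, persistenceM (onLine (ρ • y)) φ = ρ ^ 2 * M φ := persistenceM_smul ρ y
  have hU' : ∀ j, U' (site j) = timeShift (ψ j) y' := fun j => circ_ext fun τ => by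
    have h1 := hUU' (site j) τ
    rw [hU] at h1
    exact h1.unique ((hy.timeShift (ψ j)) τ)
  have hpair : ∀ i j, pairing (U (site i)) (U' (site j)) = Real.pi * M (ψ i - ψ j) := fun i j => by
    rw [hU, hU', ← pairing_timeShift_deriv hy heven hodd, pairing_apply, pairing_apply,
      ← integ_timeShift (ψ j) (timeShift (ψ i - ψ j) y * y')]
    congr 1
    refine circ_ext fun τ => ?_
    simp only [onLine_mul, onLine_timeShift]
    congr 2
    ring
  have hMneg : ∀ i j, M (ψ i - ψ j) = -M (ψ j - ψ i) := fun i j => by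
    rw [← persistenceM_neg, neg_sub]
  have hMself : M 0 = 0 := by
    have := persistenceM_neg (onLine y) 0
    rw [neg_zero] at this
    change M 0 = -M 0 at this
    linarith
  obtain ⟨c1, c2, c3⟩ := hP
  have hρ2 : ρ ^ 2 ≠ 0 := pow_ne_zero 2 hρ
  simp only [hM] at c1 c2 c3
  replace c1 : M (ψ 1 - ψ 0) + k₂ * M (ψ 2 - ψ 0) + k₃ * M (ψ 3 - ψ 0) = 0 := by
    refine (mul_eq_zero.1 ?_).resolve_left hρ2
    rw [← c1, show ψ 1 - ψ 0 + (ψ 2 - ψ 1) = ψ 2 - ψ 0 by ring,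
      show ψ 2 - ψ 0 + (ψ 3 - ψ 2) = ψ 3 - ψ 0 by ring]
    ring
  replace c2 : M (ψ 2 - ψ 1) + k₂ * M (ψ 2 - ψ 0) + k₂ * M (ψ 3 - ψ 1) + k₃ * M (ψ 3 - ψ 0)
      = 0 := by
    refine (mul_eq_zero.1 ?_).resolve_left hρ2
    rw [← c2, show ψ 1 - ψ 0 + (ψ 2 - ψ 1) = ψ 2 - ψ 0 by ring,
      show ψ 2 - ψ 0 + (ψ 3 - ψ 2) = ψ 3 - ψ 0 by ring,
      show ψ 2 - ψ 1 + (ψ 3 - ψ 2) = ψ 3 - ψ 1 by ring]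
    ring
  replace c3 : M (ψ 3 - ψ 2) + k₂ * M (ψ 3 - ψ 1) + k₃ * M (ψ 3 - ψ 0) = 0 := by
    refine (mul_eq_zero.1 ?_).resolve_left hρ2
    rw [← c3, show ψ 1 - ψ 0 + (ψ 2 - ψ 1) + (ψ 3 - ψ 2) = ψ 3 - ψ 0 by ring,
      show ψ 2 - ψ 1 + (ψ 3 - ψ 2) = ψ 3 - ψ 1 by ring]
    ring
  have hoff : ∀ i : ℤ, i ≤ 0 ∨ 5 ≤ i → U i = 0 := fun i hi => hU0 i fun j hj => by
    have := j.isLt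
    unfold site at hj
    omega
  rw [latticeL_apply]
  simp only [map_add, map_sub, map_smul, add_apply, sub_apply, smul_apply, smul_eq_mul]
  fin_cases j <;> simp only [Fin.zero_eta, Fin.mk_one, Fin.reduceFinMk]
  · rw [show site 0 - 1 = 0 from rfl, show site 0 + 1 = site 1 from rfl,
      show site 0 - 2 = -1 from rfl, show site 0 + 2 = site 2 from rfl,
      show site 0 - 3 = -2 from rfl, show site 0 + 3 = site 3 from rfl,
      hoff 0 (by simp), hoff (-1) (by simp), hoff (-2) (by simp)]
    simp only [hpair, sub_self, hMself, map_zero, zero_apply]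
    linear_combination Real.pi * c1
  · rw [show site 1 - 1 = site 0 from rfl, show site 1 + 1 = site 2 from rfl,
      show site 1 - 2 = 0 from rfl, show site 1 + 2 = site 3 from rfl,
      show site 1 - 3 = -1 from rfl, show site 1 + 3 = 5 from rfl,
      hoff 0 (by simp), hoff (-1) (by simp), hoff 5 (by simp)]
    simp only [hpair, sub_self, hMself, map_zero, zero_apply, hMneg 0 1]
    linear_combination Real.pi * (c2 - c1)
  · rw [show site 2 - 1 = site 1 from rfl, show site 2 + 1 = site 3 from rfl,
      show site 2 - 2 = site 0 from rfl, show site 2 + 2 = 5 from rfl,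
      show site 2 - 3 = 0 from rfl, show site 2 + 3 = 6 from rfl,
      hoff 0 (by simp), hoff 6 (by simp), hoff 5 (by simp)]
    simp only [hpair, sub_self, hMself, map_zero, zero_apply, hMneg 0 2, hMneg 1 2]
    linear_combination Real.pi * (c3 - c2)
  · rw [show site 3 - 1 = site 2 from rfl, show site 3 + 1 = 5 from rfl,
      show site 3 - 2 = site 1 from rfl, show site 3 + 2 = 6 from rfl,
      show site 3 - 3 = site 0 from rfl, show site 3 + 3 = 7 from rfl,
      hoff 5 (by simp), hoff 6 (by simp), hoff 7 (by simp)]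
    simp only [hpair, sub_self, hMself, map_zero, zero_apply, hMneg 0 3, hMneg 1 3, hMneg 2 3]
    linear_combination -Real.pi * c3

section Family

variable {μ₀ μ₁ R₀ R R₀' R' : ℝ} {W : Chain × ℝ × ℝ × ℝ → L2 CircFun}
  {S : ℂ × ℝ × ℝ × ℝ → CircFun} {r ω : ℝ → ℝ}
  (hW : (chainData k₂ k₃).IsSolutionMap μ₀ R₀ R W) (hS : siteData.IsSolutionMap μ₀ R₀' R' S)
  (hR : R₀ ≤ R') (hO : OrbitFamily S μ₁ r ω) (hle : μ₁ ≤ μ₀)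

include hO in
theorem OrbitFamily.norm_torusPoint_lt {μ : ℝ} (hμ : |μ| < μ₁) (ψ : Fin 4 → ℝ) :
    ‖torusPoint (r μ) ψ‖ < 4 := by
  rw [norm_torusPoint]
  have := hO.r_mem hμ
  have h2 := abs_sub_abs_le_abs_sub (r μ) 1
  rw [abs_one] at h2
  linarith

include hW hS hR hO hle in
theorem kernelMap_torusPoint {μ : ℝ} (hμ : |μ| < μ₁) (ψ : Fin 4 → ℝ) :
    kernelMap k₂ k₃ W (torusPoint (r μ) ψ, 0, μ, ω μ) = 0 := by
  refine site_ext fun i => ?_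
  rw [kernelMap_uncoupled hW hS hR (hO.norm_torusPoint_lt hμ ψ) (hμ.trans_le hle) (hO.ω_mem hμ),
    site_zero]
  by_cases hi : ∀ j, i ≠ site j
  · rw [torusPoint_eq, embS_off _ hi]
    have h := siteResidual_rot hS (z := 0) (by simp) (hμ.trans_le hle) (hO.ω_mem hμ) Real.pi
    rw [mul_zero, neg_mul, Complex.exp_neg, Complex.exp_pi_mul_I, inv_neg, inv_one, neg_one_mul]
      at h
    exact self_eq_neg.1 h
  · push Not at hi
    obtain ⟨j, rfl⟩ := hi
    rw [torusPoint_eq, embS_site, mul_comm,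
      siteResidual_rot hS (hO.norm_r_lt hμ) (hμ.trans_le hle) (hO.ω_mem hμ), hO.residual hμ,
      mul_zero]

/-- The kernel map along the family of periodic orbits. -/
def familyMap (k₂ k₃ : ℝ) (W : Chain × ℝ × ℝ × ℝ → L2 CircFun) (ω : ℝ → ℝ)
    (p : Chain × ℝ × ℝ) : Chain := kernelMap k₂ k₃ W (p.1, p.2.1, p.2.2, ω p.2.2)

/-- The work of the coupling at a central site, along the family of periodic orbits. -/
def familyWork (k₂ k₃ : ℝ) (W : Chain × ℝ × ℝ × ℝ → L2 CircFun) (ω : ℝ → ℝ) (j : Fin 4)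
    (p : Chain × ℝ × ℝ) : ℝ := work k₂ k₃ W (site j) (p.1, p.2.1, p.2.2, ω p.2.2)

include hO in
theorem OrbitFamily.contDiffAt_param {u : Chain} {ε μ : ℝ} (hμ : |μ| < μ₁) : ContDiffAt ℝ 1
    (fun p : Chain × ℝ × ℝ => (p.1, p.2.1, p.2.2, ω p.2.2)) (u, ε, μ) :=
  contDiffAt_fst.prodMk (contDiffAt_snd.fst.prodMk (contDiffAt_snd.snd.prodMk
    (ContDiffAt.comp (g := ω) _ (hO.smooth_ω hμ) contDiffAt_snd.snd)))

include hW hO hle in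
theorem contDiffAt_familyMap {u : Chain} {ε μ : ℝ} (hu : ‖u‖ < 4) (hε : |ε| < 1)
    (hμ : |μ| < μ₁) : ContDiffAt ℝ 1 (familyMap k₂ k₃ W ω) (u, ε, μ) :=
  ContDiffAt.comp (g := kernelMap k₂ k₃ W) (u, ε, μ)
    (contDiffAt_kernelMap hW hu hε (hμ.trans_le hle) (hO.ω_mem hμ)) (hO.contDiffAt_param hμ)

include hW hO hle in
theorem contDiffAt_familyWork {u : Chain} {ε μ : ℝ} (j : Fin 4) (hu : ‖u‖ < 4) (hε : |ε| < 1)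
    (hμ : |μ| < μ₁) : ContDiffAt ℝ 1 (familyWork k₂ k₃ W ω j) (u, ε, μ) :=
  ContDiffAt.comp (g := work k₂ k₃ W (site j)) (u, ε, μ)
    (contDiffAt_work hW hu hε (hμ.trans_le hle) (hO.ω_mem hμ) _) (hO.contDiffAt_param hμ)

/-- The kernel maps along the family of periodic orbits. -/
def kernelFamily (hμ₁ : 0 < μ₁) : KernelFamily where
  N := familyMap k₂ k₃ W ω
  B := familyWork k₂ k₃ W ω
  r := r
  bound := μ₁
  pos := hμ₁
  smooth_N := contDiffAt_familyMap hW hO hle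
  smooth_B := contDiffAt_familyWork hW hO hle
  smooth_r := hO.smooth_r
  r_zero := hO.r_zero
  r_mem := hO.r_mem
  torus hμ ψ := by
    rw [familyMap]
    exact kernelMap_torusPoint hW hS hR hO hle hμ ψ
  balance hu hε hμ j := by
    rw [familyMap, familyWork]
    exact kernelMap_eq_work hW hu hε (hμ.trans_le hle) (hO.ω_mem hμ) (site j)
  conserved hu hε hμ := by
    simp only [familyMap]
    exact hasSum_kernelMap hW hu hε (hμ.trans_le hle) (hO.ω_mem hμ)
  N_rot hu hε hμ := by
    simp only [familyMap]
    exact kernelMap_rot hW hu hε (hμ.trans_le hle) (hO.ω_mem hμ)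
  B_rot hu hε hμ α j := by
    simp only [familyWork]
    exact work_rot hW hu hε (hμ.trans_le hle) (hO.ω_mem hμ) α (site j)
  base u j := by
    rw [familyMap, kernelMap_apply, hO.ω_zero, zero_smul, add_zero, firstHarm_harm_cube]
    push_cast
    ring

include hW hS hR hO hle in
theorem mapDNLS_eq_familyMap (hμ₁ : 0 < μ₁) (θ : Fin 4 → ℝ) (w : Chain) (ε : ℝ) :
    mapDNLS k₂ k₃ θ w ε = familyMap k₂ k₃ W ω (torusPoint (r 0) θ + w, ε, 0) := by
  have h0 := kernelMap_torusPoint hW hS hR hO hle (μ := 0) (by simpa using hμ₁) θ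
  rw [hO.r_zero, hO.ω_zero] at h0
  rw [mapDNLS_eq W, vDNLS, h0, sub_zero, familyMap, hO.r_zero, hO.ω_zero]

include hS hO hle in
theorem vKG_eq_torusPoint {ρ γ : ℝ} {x : ℝ → ℝ} (hρ : ρ ≠ 0) (hρ' : ρ ^ 2 < μ₁)
    (hx : IsOscillation ρ γ x) (θ : Fin 4 → ℝ) : vKG ρ x θ = torusPoint (r (ρ ^ 2)) θ := by
  have hμ : |ρ ^ 2| < μ₁ := by rwa [abs_of_nonneg (sq_nonneg ρ)]
  obtain ⟨-, hxy⟩ := oscillation_eq hS hO hle hρ hρ' hx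
  rw [vKG, hxy, cosCoeff_smul, cosCoeff_one, firstHarm_orbit hS hO hle hμ, Complex.ofReal_re,
    mul_div_cancel_left₀ _ hρ]

include hW hS hR hO hle in
theorem familyWork_eq_zero {ρ γ : ℝ} {x : ℝ → ℝ} (hρ : ρ ≠ 0) (hρ' : ρ ^ 2 < μ₁)
    (hx : IsOscillation ρ γ x) {θ : Fin 4 → ℝ} (hP : Persistence k₂ k₃ x θ) (j : Fin 4) :
    familyWork k₂ k₃ W ω j (torusPoint (r (ρ ^ 2)) θ, 0, ρ ^ 2) = 0 := by
  have hμ : |ρ ^ 2| < μ₁ := by rwa [abs_of_nonneg (sq_nonneg ρ)]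
  obtain ⟨-, hxy⟩ := oscillation_eq hS hO hle hρ hρ' hx
  obtain ⟨y', hy', -⟩ := exists_hasD_orbit hS hO hle hμ
  obtain ⟨h1, h2⟩ := total_torusPoint hW hS hR hO hle hμ θ
  rw [hxy] at hP
  rw [familyWork, work, pairing_eq_zero_of_persistence hρ hy'
    (timeRev_orbit hS hO hle hμ) (timeShift_pi_orbit hS hO hle hμ) h1 h2
    (hasD_total hW (hO.norm_torusPoint_lt hμ θ) (by simp) (hμ.trans_le hle) (hO.ω_mem hμ)) hP j,
    mul_zero]

include hW hS hR hO hle in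
theorem mapKG_eq_familyMap
    (hR' : √sobolevConst * (√(6 * Real.pi) * (2 * (chainData k₂ k₃).sourceBound R₀)) ≤ R)
    {ρ γ : ℝ} {x : ℝ → ℝ} (hρ : ρ ≠ 0) (hρ' : ρ ^ 2 < μ₁)
    (hx : IsOscillation ρ γ x) {θ : Fin 4 → ℝ} {w : Chain} {ε : ℝ}
    (hw : ‖torusPoint (r (ρ ^ 2)) θ + w‖ < 4) (hε : |ε| < 1) :
    mapKG k₂ k₃ ρ γ x θ w ε =
      familyMap k₂ k₃ W ω (torusPoint (r (ρ ^ 2)) θ + w, ε, ρ ^ 2) := by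
  have hμ : |ρ ^ 2| < μ₁ := by rwa [abs_of_nonneg (sq_nonneg ρ)]
  obtain ⟨hγ, -⟩ := oscillation_eq hS hO hle hρ hρ' hx
  have hv := vKG_eq_torusPoint hS hO hle hρ hρ' hx θ
  have h0 := kernelMap_torusPoint hW hS hR hO hle hμ θ
  rw [mapKG_eq hW hR' hρ (hρ'.trans_le hle) (hO.ω_mem hμ) hγ
    (by rw [hv]; exact hO.norm_torusPoint_lt hμ θ) (by rw [hv]; exact hw) hε, hv, h0, sub_zero,
    familyMap]

end Family

/-- The KG maps for small `ρ` and the dNLS map belong to one family. -/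
theorem exists_kernelFamily (k₂ k₃ : ℝ) : ∃ K : KernelFamily,
    (∀ (θ : Fin 4 → ℝ) (w : Chain) (ε : ℝ),
      mapDNLS k₂ k₃ θ w ε = K.N (torusPoint (K.r 0) θ + w, ε, 0)) ∧
    ∀ (ρ γ : ℝ) (x : ℝ → ℝ), ρ ≠ 0 → ρ ^ 2 < K.bound → IsOscillation ρ γ x →
      ∀ θ : Fin 4 → ℝ, vKG ρ x θ = torusPoint (K.r (ρ ^ 2)) θ ∧
        (Persistence k₂ k₃ x θ → ∀ j, K.B j (torusPoint (K.r (ρ ^ 2)) θ, 0, ρ ^ 2) = 0) ∧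
        ∀ (w : Chain) (ε : ℝ), ‖torusPoint (K.r (ρ ^ 2)) θ + w‖ < 4 → |ε| < 1 →
          mapKG k₂ k₃ ρ γ x θ w ε = K.N (torusPoint (K.r (ρ ^ 2)) θ + w, ε, ρ ^ 2) := by
  obtain ⟨R₀, -, hR₀⟩ := (chainData k₂ k₃).exists_isSolutionMap
  obtain ⟨μc, W, hWc⟩ := hR₀ _ (le_max_left R₀
    (√sobolevConst * (√(6 * Real.pi) * (2 * (chainData k₂ k₃).sourceBound R₀))))
  obtain ⟨R₁, -, hR₁⟩ := siteData.exists_isSolutionMap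
  obtain ⟨μs, S, hSs⟩ := hR₁ (max R₁ R₀) (le_max_left _ _)
  have hR : R₀ ≤ max R₁ R₀ := le_max_right _ _
  have hW := hWc.mono (lt_min hWc.pos hSs.pos) (min_le_left _ _)
  have hS := hSs.mono (lt_min hWc.pos hSs.pos) (min_le_right _ _)
  obtain ⟨μ₁, hμ₁, hle, r, ω, hO⟩ := exists_orbitFamily hS
  refine ⟨kernelFamily hW hS hR hO hle hμ₁, ?_, ?_⟩
  · intro θ w ε
    exact mapDNLS_eq_familyMap hW hS hR hO hle hμ₁ θ w ε
  · intro ρ γ x hρ hρ' hx θ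
    have hρ'' : ρ ^ 2 < μ₁ := hρ'
    refine ⟨vKG_eq_torusPoint hS hO hle hρ hρ'' hx θ, ?_, ?_⟩
    · intro hP j
      exact familyWork_eq_zero hW hS hR hO hle hρ hρ'' hx hP j
    · intro w ε hw hε
      exact mapKG_eq_familyMap hW hS hR hO hle (le_max_right _ _) hρ hρ'' hx hw hε

/-! ### The range equation of the second decomposition -/

/-- The unit vector `e^{-iψ_j}`. -/
def phase (ψ : Fin 4 → ℝ) (j : Fin 4) : ℂ := Complex.exp (-(ψ j : ℂ) * Complex.I)

theorem kerDir_eq (ψ : Fin 4 → ℝ) (j : Fin 4) : kerDir ψ j = Complex.I * phase ψ j := rfl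

theorem torusPoint_eq_phase (r : ℝ) (ψ : Fin 4 → ℝ) :
    torusPoint r ψ = embS fun j => (r : ℂ) * phase ψ j := rfl

theorem phase_mul_conj (ψ : Fin 4 → ℝ) (j : Fin 4) :
    phase ψ j * starRingEnd ℂ (phase ψ j) = 1 := by
  rw [Complex.mul_conj, Complex.normSq_eq_norm_sq, phase, norm_exp_phase]
  norm_num

theorem contDiff_coord (j : Fin 4) : ContDiff ℝ 1 fun ψ : R4 => ((ψ j : ℝ) : ℂ) :=
  Complex.ofRealCLM.contDiff.comp (EuclideanSpace.proj (𝕜 := ℝ) j).contDiff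

theorem contDiff_phase (j : Fin 4) : ContDiff ℝ 1 fun ψ : R4 => phase ψ j :=
  ((contDiff_coord j).neg.mul contDiff_const).cexp

/-- The coordinates of the orthogonal projection on the kernel. -/
def kerCoord (ψ : Fin 4 → ℝ) (h : Chain) : R4 :=
  WithLp.toLp 2 fun j => (starRingEnd ℂ (kerDir ψ j) * h (site j)).re

theorem kerCoord_apply (ψ : Fin 4 → ℝ) (h : Chain) (j : Fin 4) :
    kerCoord ψ h j = (starRingEnd ℂ (kerDir ψ j) * h (site j)).re := rfl

theorem kerCoord_mul_kerDir (ψ : Fin 4 → ℝ) (h : Chain) (j : Fin 4) :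
    (kerCoord ψ h j : ℂ) * kerDir ψ j =
      1 / 2 * (h (site j) - phase ψ j ^ 2 * starRingEnd ℂ (h (site j))) := by
  rw [kerCoord_apply, Complex.re_eq_add_conj, kerDir_eq]
  simp only [map_mul, Complex.conj_I, Complex.conj_conj, map_neg, neg_neg]
  linear_combination (1 / 2 * h (site j) * (-Complex.I ^ 2)) * phase_mul_conj ψ j +
    (1 / 2 * phase ψ j ^ 2 * starRingEnd ℂ (h (site j)) - 1 / 2 * h (site j)) * Complex.I_sq

/-- The orthogonal projection on the kernel. -/
def kerProj (ψ : Fin 4 → ℝ) : Chain →L[ℝ] Chain :=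
  embS.comp (ContinuousLinearMap.pi fun j =>
    (1 / 2 : ℝ) • (evalSite ℂ (site j) - (mulC (phase ψ j ^ 2)).comp
      ((Complex.conjCLE : ℂ →L[ℝ] ℂ).comp (evalSite ℂ (site j)))))

theorem kerProj_apply (ψ : Fin 4 → ℝ) (h : Chain) : kerProj ψ h = embS fun j =>
    1 / 2 * (h (site j) - phase ψ j ^ 2 * starRingEnd ℂ (h (site j))) := by
  rw [kerProj, ContinuousLinearMap.comp_apply]
  congr 1
  funext j
  simp

theorem kerProj_eq_kerVec (ψ : Fin 4 → ℝ) (h : Chain) :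
    kerProj ψ h = kerVec ψ (kerCoord ψ h) := by
  rw [kerProj_apply, kerVec_eq]
  simp only [kerCoord_mul_kerDir]

theorem kerCoord_kerVec (ψ : Fin 4 → ℝ) (κ : R4) : kerCoord ψ (kerVec ψ κ) = κ := by
  ext j
  rw [kerCoord_apply, kerVec_eq, embS_site]
  have h : starRingEnd ℂ (kerDir ψ j) * (κ j * kerDir ψ j) = κ j := by
    rw [kerDir_eq, map_mul, Complex.conj_I]
    linear_combination -(κ j : ℂ) * Complex.I ^ 2 * phase_mul_conj ψ j - (κ j : ℂ) * Complex.I_sq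
  rw [h, Complex.ofReal_re]

theorem kerProj_kerVec (ψ : Fin 4 → ℝ) (κ : R4) : kerProj ψ (kerVec ψ κ) = kerVec ψ κ := by
  rw [kerProj_eq_kerVec, kerCoord_kerVec]

theorem kerProj_kerProj (ψ : Fin 4 → ℝ) (h : Chain) :
    kerProj ψ (kerProj ψ h) = kerProj ψ h := by
  rw [kerProj_eq_kerVec ψ h, kerProj_kerVec]

theorem kerProj_eq_zero_iff (ψ : Fin 4 → ℝ) (h : Chain) :
    kerProj ψ h = 0 ↔ ∀ j, kerCoord ψ h j = 0 := by
  constructor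
  · intro h0 j
    rw [kerProj_eq_kerVec] at h0
    have h1 := kerCoord_kerVec ψ (kerCoord ψ h)
    rw [h0] at h1
    rw [← h1, kerCoord_apply, site_zero, mul_zero, Complex.zero_re]
  · intro h0
    rw [kerProj_eq_kerVec, ← norm_eq_zero, norm_kerVec, norm_eq_zero]
    ext j
    exact h0 j

theorem contDiff_kerProj : ContDiff ℝ 1 fun p : R4 × Chain => kerProj p.1 p.2 := by
  simp only [kerProj_apply]
  refine embS.contDiff.comp (contDiff_pi.2 fun j => ?_)
  have h1 : ContDiff ℝ 1 fun p : R4 × Chain => p.2 (site j) :=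
    (evalSite ℂ (site j)).contDiff.comp contDiff_snd
  have h2 : ContDiff ℝ 1 fun p : R4 × Chain => starRingEnd ℂ (p.2 (site j)) :=
    Complex.conjCLE.contDiff.comp h1
  have h3 : ContDiff ℝ 1 fun p : R4 × Chain => phase p.1 j :=
    (contDiff_phase j).comp contDiff_fst
  exact contDiff_const.mul (h1.sub ((h3.pow 2).mul h2))

theorem _root_.ContDiffAt.kerProj {X : Type*} [NormedAddCommGroup X] [NormedSpace ℝ X]
    {f : X → R4} {g : X → Chain} {x : X} (hf : ContDiffAt ℝ 1 f x) (hg : ContDiffAt ℝ 1 g x) :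
    ContDiffAt ℝ 1 (fun x => kerProj (f x) (g x)) x := by
  have h1 : ContDiffAt ℝ 1 (fun x => (f x, g x)) x := hf.prodMk hg
  have h2 : ContDiffAt ℝ 1 (fun q : R4 × Chain => KGChain.kerProj q.1 q.2) (f x, g x) :=
    contDiff_kerProj.contDiffAt
  exact h2.comp x h1

theorem contDiff_kerVec : ContDiff ℝ 1 fun p : R4 × R4 => kerVec p.1 p.2 := by
  simp only [kerVec_eq, kerDir_eq]
  refine embS.contDiff.comp (contDiff_pi.2 fun j => ?_)
  exact ((contDiff_coord j).comp contDiff_snd).mul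
    (contDiff_const.mul ((contDiff_phase j).comp contDiff_fst))

theorem contDiff_torusPoint : ContDiff ℝ 1 fun p : ℝ × R4 => torusPoint p.1 p.2 := by
  simp only [torusPoint_eq_phase]
  refine embS.contDiff.comp (contDiff_pi.2 fun j => ?_)
  exact (Complex.ofRealCLM.contDiff.comp contDiff_fst).mul ((contDiff_phase j).comp contDiff_snd)

/-- The parameters `(κ, ε, ψ, μ)`. -/
abbrev Param := R4 × ℝ × R4 × ℝ

namespace KernelFamily

variable (K : KernelFamily)

/-- The point `v + k + h` of `ℓ²`. -/
def point (p : Param × Chain) : Chain :=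
  torusPoint (K.r p.1.2.2.2) p.1.2.2.1 + kerVec p.1.2.2.1 p.1.1 + p.2

/-- The value of the family at `point`. -/
def value (p : Param × Chain) : Chain := K.N (K.point p, p.1.2.1, p.1.2.2.2)

/-- The map whose zeros `h` are the solutions in the range of `Λ` of the range equation: the
condition that `h` has no component in the kernel is added to the range equation. -/
def rangeEq (p : Param × Chain) : Chain :=
  kerProj p.1.2.2.1 p.2 + (K.value p - kerProj p.1.2.2.1 (K.value p))

variable {K}

theorem rangeEq_eq_zero_iff {p : Param × Chain} : K.rangeEq p = 0 ↔
    kerProj p.1.2.2.1 p.2 = 0 ∧ kerProj p.1.2.2.1 (K.value p) = K.value p := by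
  constructor
  · intro h
    have h1 := congrArg (kerProj p.1.2.2.1) h
    rw [rangeEq, map_add, map_sub, kerProj_kerProj, kerProj_kerProj, sub_self, add_zero,
      map_zero] at h1
    rw [rangeEq, h1, zero_add, sub_eq_zero] at h
    exact ⟨h1, h.symm⟩
  · rintro ⟨h1, h2⟩
    rw [rangeEq, h1, h2, sub_self, add_zero]

/-- The part of the parameter space on which the family is used. -/
structure Admissible (K : KernelFamily) (p : Param × Chain) : Prop where
  point : ‖K.point p‖ < 4
  eps : |p.1.2.1| < 1
  mu : |p.1.2.2.2| < K.bound

theorem norm_torusPoint_lt {μ : ℝ} (hμ : |μ| < K.bound) (ψ : Fin 4 → ℝ) :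
    ‖torusPoint (K.r μ) ψ‖ < 3 := by
  rw [norm_torusPoint]
  have := K.r_mem hμ
  have h2 := abs_sub_abs_le_abs_sub (K.r μ) 1
  rw [abs_one] at h2
  linarith

theorem admissible_of_lt {p : Param × Chain} (h1 : ‖p.1.1‖ < 1 / 2) (h2 : |p.1.2.1| < 1)
    (h3 : |p.1.2.2.2| < K.bound) (h4 : ‖p.2‖ < 1 / 2) : K.Admissible p := by
  refine ⟨?_, h2, h3⟩
  have a1 := K.norm_torusPoint_lt h3 p.1.2.2.1
  have a2 := norm_kerVec p.1.2.2.1 p.1.1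
  have a3 := norm_add₃_le (a := torusPoint (K.r p.1.2.2.2) p.1.2.2.1)
    (b := kerVec p.1.2.2.1 p.1.1) (c := p.2)
  rw [point]
  linarith

theorem contDiffAt_point {p : Param × Chain} (hp : |p.1.2.2.2| < K.bound) :
    ContDiffAt ℝ 1 K.point p := by
  have h1 : ContDiffAt ℝ 1 (fun p : Param × Chain => (K.r p.1.2.2.2, p.1.2.2.1)) p :=
    (ContDiffAt.comp (g := K.r) p (K.smooth_r hp)
      (f := fun p : Param × Chain => p.1.2.2.2) (by fun_prop)).prodMk (by fun_prop)
  have h2 : ContDiff ℝ 1 (fun p : Param × Chain => (p.1.2.2.1, p.1.1)) := by fun_prop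
  exact ((contDiff_torusPoint.contDiffAt.comp p h1).add
    (contDiff_kerVec.comp h2).contDiffAt).add contDiffAt_snd

theorem contDiffAt_value {p : Param × Chain} (hp : K.Admissible p) :
    ContDiffAt ℝ 1 K.value p :=
  ContDiffAt.comp (g := K.N) p (K.smooth_N hp.point hp.eps hp.mu)
    ((contDiffAt_point hp.mu).prodMk (by fun_prop))

theorem contDiffAt_rangeEq {p : Param × Chain} (hp : K.Admissible p) :
    ContDiffAt ℝ 1 K.rangeEq p := by
  have h1 := contDiffAt_value hp
  have h2 : ContDiffAt ℝ 1 (fun p : Param × Chain => p.1.2.2.1) p :=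
    contDiff_fst.snd.snd.fst.contDiffAt
  have h3 : ContDiffAt ℝ 1 (fun p : Param × Chain => p.2) p := contDiffAt_snd
  have h4 := h2.kerProj h3
  have h5 := h2.kerProj h1
  unfold rangeEq
  exact h4.add (h1.sub h5)

theorem admissible_base {ψ : R4} {μ : ℝ} (hμ : |μ| < K.bound) :
    K.Admissible ((0, 0, ψ, μ), 0) :=
  admissible_of_lt (by simp) (by simp) hμ (by simp)

theorem kerVec_zero (ψ : Fin 4 → ℝ) : kerVec ψ 0 = 0 := by
  rw [← norm_eq_zero, norm_kerVec, norm_zero]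

theorem point_base (ψ : R4) (μ : ℝ) (h : Chain) :
    K.point ((0, 0, ψ, μ), h) = torusPoint (K.r μ) ψ + h := by
  rw [point, kerVec_zero, add_zero]

theorem value_base {μ : ℝ} (hμ : |μ| < K.bound) (ψ : R4) : K.value ((0, 0, ψ, μ), 0) = 0 := by
  rw [value, point_base, add_zero]
  exact K.torus hμ ψ

theorem rangeEq_base {μ : ℝ} (hμ : |μ| < K.bound) (ψ : R4) :
    K.rangeEq ((0, 0, ψ, μ), 0) = 0 := by
  rw [rangeEq, value_base hμ, map_zero, sub_zero, add_zero]

variable (K)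

/-- The operator `Λ` at the torus. -/
def lin (ψ : Fin 4 → ℝ) (μ : ℝ) : Chain →L[ℝ] Chain :=
  fderiv ℝ (fun u => K.N (u, 0, μ)) (torusPoint (K.r μ) ψ)

variable {K}

theorem hasFDerivAt_lin {μ : ℝ} (hμ : |μ| < K.bound) (ψ : Fin 4 → ℝ) :
    HasFDerivAt (fun u => K.N (u, 0, μ)) (K.lin ψ μ) (torusPoint (K.r μ) ψ) := by
  have h1 := (K.smooth_N ((K.norm_torusPoint_lt hμ ψ).trans (by norm_num))
    (by simp : |(0 : ℝ)| < 1) hμ).differentiableAt one_ne_zero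
  have h2 : DifferentiableAt ℝ (fun u : Chain => (u, (0 : ℝ), μ)) (torusPoint (K.r μ) ψ) := by
    fun_prop
  exact (DifferentiableAt.comp (g := K.N) (torusPoint (K.r μ) ψ) h1 h2).hasFDerivAt

theorem hasFDerivAt_lin' {μ : ℝ} (hμ : |μ| < K.bound) (ψ : Fin 4 → ℝ) :
    HasFDerivAt (fun w => K.N (torusPoint (K.r μ) ψ + w, 0, μ)) (K.lin ψ μ) 0 := by
  have h := hasFDerivAt_lin hμ ψ
  rw [← add_zero (torusPoint (K.r μ) ψ)] at h
  exact ((hasFDerivAt_comp_add_left _).2 h :)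

theorem hasFDerivAt_rangeEq {μ : ℝ} (hμ : |μ| < K.bound) (ψ : R4) :
    HasFDerivAt (fun h => K.rangeEq ((0, 0, ψ, μ), h))
      (kerProj ψ + (K.lin ψ μ - (kerProj ψ).comp (K.lin ψ μ))) 0 := by
  have h1 := hasFDerivAt_lin' hμ ψ
  simp only [rangeEq, value, point_base]
  exact (kerProj ψ).hasFDerivAt.add (h1.sub ((kerProj ψ).hasFDerivAt.comp 0 h1))

/-- The derivative of the residual of a single site at `μ = 0`. -/
theorem lin_apply_zero (ψ : Fin 4 → ℝ) (h : Chain) (i : ℤ) :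
    K.lin ψ 0 h i = -(3 / 4 : ℂ) * h i + 3 / 4 * (2 * (torusPoint 1 ψ i *
      starRingEnd ℂ (torusPoint 1 ψ i)) * h i + torusPoint 1 ψ i ^ 2 * starRingEnd ℂ (h i)) := by
  have h0 : |(0 : ℝ)| < K.bound := by simpa using K.pos
  have h1 := hasFDerivAt_lin h0 ψ
  rw [K.r_zero] at h1
  set v := torusPoint 1 ψ
  have h2 := (evalSite ℂ i).hasFDerivAt.comp v h1
  have h3 : (evalSite ℂ i) ∘ (fun u => K.N (u, 0, 0)) = fun u : Chain => -(3 / 4 : ℂ) * evalSite ℂ i u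
      + 3 / 4 * (evalSite ℂ i u * evalSite ℂ i u * Complex.conjCLE (evalSite ℂ i u)) := by
    funext u
    simp only [Function.comp_apply, evalSite_apply, K.base, cubic, Complex.conjCLE_apply]
    rw [mul_assoc (u i), Complex.mul_conj, Complex.normSq_eq_norm_sq]
    ring
  rw [h3] at h2
  have h4 := (evalSite ℂ i).hasFDerivAt (x := v)
  have h5 := (h4.const_mul (-(3 / 4 : ℂ))).add (((h4.mul h4).mul
    ((Complex.conjCLE : ℂ →L[ℝ] ℂ).hasFDerivAt.comp v h4)).const_mul (3 / 4 : ℂ))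
  have h6 := congrArg (fun A : Chain →L[ℝ] ℂ => A h) (h2.unique h5)
  simp at h6
  rw [h6]
  ring

end KernelFamily

/-! ### The linearization at the torus -/

/-- The operator `h ↦ a h + b e² h̄` at the central sites, `e` being the phase of the site, and
`h ↦ c h` elsewhere. -/
def siteOp (ψ : Fin 4 → ℝ) (a b c : ℝ) : Chain →L[ℝ] Chain :=
  c • ContinuousLinearMap.id ℝ Chain + embS.comp (ContinuousLinearMap.pi fun j =>
    (a - c) • evalSite ℂ (site j) + b • (mulC (phase ψ j ^ 2)).comp
      ((Complex.conjCLE : ℂ →L[ℝ] ℂ).comp (evalSite ℂ (site j))))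

theorem siteOp_apply (ψ : Fin 4 → ℝ) (a b c : ℝ) (h : Chain) : siteOp ψ a b c h =
    c • h + embS fun j => (a - c) * h (site j) +
      b * (phase ψ j ^ 2 * starRingEnd ℂ (h (site j))) := by
  rw [siteOp, add_apply, ContinuousLinearMap.comp_apply]
  congr 2
  funext j
  simp

theorem siteOp_site (ψ : Fin 4 → ℝ) (a b c : ℝ) (h : Chain) (j : Fin 4) :
    siteOp ψ a b c h (site j) =
      a * h (site j) + b * (phase ψ j ^ 2 * starRingEnd ℂ (h (site j))) := by
  rw [siteOp_apply, site_add, site_smul, embS_site, Complex.real_smul]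
  ring

theorem siteOp_off (ψ : Fin 4 → ℝ) (a b c : ℝ) (h : Chain) {i : ℤ} (hi : ∀ j, i ≠ site j) :
    siteOp ψ a b c h i = c * h i := by
  rw [siteOp_apply, site_add, site_smul, embS_off _ hi, Complex.real_smul, add_zero]

theorem chain_ext {u v : Chain} (h1 : ∀ j, u (site j) = v (site j))
    (h2 : ∀ i, (∀ j, i ≠ site j) → u i = v i) : u = v := by
  refine site_ext fun i => ?_
  by_cases hi : ∀ j, i ≠ site j
  · exact h2 i hi
  · push Not at hi
    obtain ⟨j, rfl⟩ := hi
    exact h1 j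

theorem siteOp_siteOp (ψ : Fin 4 → ℝ) (a b c a' b' c' : ℝ) (h : Chain) :
    siteOp ψ a b c (siteOp ψ a' b' c' h) = siteOp ψ (a * a' + b * b') (a * b' + b * a') (c * c') h := by
  refine chain_ext (fun j => ?_) fun i hi => ?_
  · rw [siteOp_site, siteOp_site, siteOp_site]
    simp only [map_add, map_mul, Complex.conj_ofReal, map_pow, Complex.conj_conj]
    push_cast
    linear_combination (b * b' * h (site j)) * (phase ψ j * starRingEnd ℂ (phase ψ j) + 1) *
      phase_mul_conj ψ j
  · rw [siteOp_off _ _ _ _ _ hi, siteOp_off _ _ _ _ _ hi, siteOp_off _ _ _ _ _ hi]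
    push_cast
    ring

theorem siteOp_one (ψ : Fin 4 → ℝ) (h : Chain) : siteOp ψ 1 0 1 h = h := by
  refine chain_ext (fun j => ?_) fun i hi => ?_
  · rw [siteOp_site]
    simp
  · rw [siteOp_off _ _ _ _ _ hi]
    simp

theorem kerProj_eq_siteOp (ψ : Fin 4 → ℝ) (h : Chain) :
    kerProj ψ h = siteOp ψ (1 / 2) (-1 / 2) 0 h := by
  refine chain_ext (fun j => ?_) fun i hi => ?_
  · rw [siteOp_site, kerProj_apply, embS_site]
    push_cast
    ring
  · rw [siteOp_off _ _ _ _ _ hi, kerProj_apply, embS_off _ hi]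
    simp

namespace KernelFamily

variable {K : KernelFamily}

theorem lin_zero_eq_siteOp (ψ : Fin 4 → ℝ) (h : Chain) :
    K.lin ψ 0 h = siteOp ψ (3 / 4) (3 / 4) (-3 / 4) h := by
  refine chain_ext (fun j => ?_) fun i hi => ?_
  · rw [siteOp_site, lin_apply_zero, torusPoint_eq_phase, embS_site, Complex.ofReal_one, one_mul,
      phase_mul_conj]
    push_cast
    ring
  · rw [siteOp_off _ _ _ _ _ hi, lin_apply_zero, torusPoint_eq_phase, embS_off _ hi]
    push_cast
    ring

variable (K)

/-- The derivative of `rangeEq` in `h` at the torus. -/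
def rangeLin (ψ : R4) (μ : ℝ) : Chain →L[ℝ] Chain :=
  kerProj ψ + (K.lin ψ μ - (kerProj ψ).comp (K.lin ψ μ))

variable {K}

theorem rangeLin_apply (ψ : R4) (μ : ℝ) (h : Chain) :
    K.rangeLin ψ μ h = kerProj ψ h + (K.lin ψ μ h - kerProj ψ (K.lin ψ μ h)) := rfl

theorem rangeLin_zero (ψ : R4) (h : Chain) :
    K.rangeLin ψ 0 h = siteOp ψ (5 / 4) (1 / 4) (-3 / 4) h := by
  rw [rangeLin_apply, lin_zero_eq_siteOp, kerProj_eq_siteOp, kerProj_eq_siteOp, siteOp_siteOp]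
  refine chain_ext (fun j => ?_) fun i hi => ?_
  · rw [site_add, site_sub, siteOp_site, siteOp_site, siteOp_site, siteOp_site]
    push_cast
    ring
  · rw [site_add, site_sub, siteOp_off _ _ _ _ _ hi, siteOp_off _ _ _ _ _ hi,
      siteOp_off _ _ _ _ _ hi, siteOp_off _ _ _ _ _ hi]
    push_cast
    ring

theorem rangeLin_zero_invertible (ψ : R4) : (K.rangeLin ψ 0).IsInvertible := by
  have h1 : K.rangeLin ψ 0 = siteOp ψ (5 / 4) (1 / 4) (-3 / 4) :=
    ContinuousLinearMap.ext (rangeLin_zero ψ)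
  rw [h1]
  refine ContinuousLinearMap.IsInvertible.of_inverse
    (g := siteOp ψ (5 / 6) (-1 / 6) (-4 / 3)) ?_ ?_
  · refine ContinuousLinearMap.ext fun h => ?_
    rw [ContinuousLinearMap.comp_apply, siteOp_siteOp]
    norm_num
    exact siteOp_one ψ h
  · refine ContinuousLinearMap.ext fun h => ?_
    rw [ContinuousLinearMap.comp_apply, siteOp_siteOp]
    norm_num
    exact siteOp_one ψ h

theorem hasDerivAt_torusPoint (r : ℝ) (ψ η : R4) :
    HasDerivAt (fun t : ℝ => torusPoint r (ψ + t • η : R4)) (-r • kerVec ψ η) 0 := by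
  simp only [torusPoint_eq_phase, kerVec_eq]
  rw [← map_smul]
  refine embS.hasFDerivAt.comp_hasDerivAt (0 : ℝ) (hasDerivAt_pi.2 fun j => ?_)
  have h1 : HasDerivAt (fun t : ℝ => (((ψ + t • η : R4) j : ℝ) : ℂ)) ((η j : ℝ) : ℂ) 0 := by
    have : HasDerivAt (fun t : ℝ => ψ j + t * η j) (η j) 0 := by
      simpa using ((hasDerivAt_id (0 : ℝ)).mul_const (η j)).const_add (ψ j)
    exact this.ofReal_comp
  have h2 := ((h1.neg.mul_const Complex.I).cexp).const_mul (r : ℂ)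
  refine h2.congr_deriv ?_
  simp only [Pi.neg_apply, kerDir_eq, phase, zero_smul, add_zero, Complex.real_smul,
    Complex.ofReal_neg, Pi.smul_apply]
  ring

theorem lin_kerVec {μ : ℝ} (hμ : |μ| < K.bound) (ψ κ : R4) : K.lin ψ μ (kerVec ψ κ) = 0 := by
  have h1 := hasDerivAt_torusPoint (K.r μ) ψ κ
  have h2 := hasFDerivAt_lin hμ ψ
  have h3 : HasDerivAt (fun t : ℝ => K.N (torusPoint (K.r μ) (ψ + t • κ : R4), 0, μ))
      (K.lin ψ μ (-K.r μ • kerVec ψ κ)) 0 := by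
    refine HasFDerivAt.comp_hasDerivAt (0 : ℝ) (l := fun u => K.N (u, 0, μ)) ?_ h1
    simpa using h2
  have h4 : (fun t : ℝ => K.N (torusPoint (K.r μ) (ψ + t • κ : R4), 0, μ)) = fun _ => 0 :=
    funext fun t => K.torus hμ _
  rw [h4] at h3
  have h5 := h3.unique (hasDerivAt_const (0 : ℝ) (0 : Chain))
  rw [map_smul] at h5
  have h6 := abs_lt.1 (K.r_mem hμ)
  exact (smul_eq_zero.1 h5).resolve_left (by linarith)

theorem kerProj_lin {μ : ℝ} (hμ : |μ| < K.bound) (ψ : R4) (h : Chain) :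
    kerProj ψ (K.lin ψ μ h) = 0 := by
  rw [kerProj_eq_zero_iff]
  intro j
  set v := torusPoint (K.r μ) ψ
  have h1 : HasDerivAt (fun t : ℝ => v + t • h) h 0 := by
    simpa using ((hasDerivAt_id (0 : ℝ)).smul_const h).const_add v
  have h2 : HasDerivAt (fun t : ℝ => K.N (v + t • h, 0, μ)) (K.lin ψ μ h) 0 := by
    refine HasFDerivAt.comp_hasDerivAt (0 : ℝ) (l := fun u => K.N (u, 0, μ)) ?_ h1
    simpa using hasFDerivAt_lin hμ ψ
  have h3 := (evalSite ℂ (site j)).hasFDerivAt.comp_hasDerivAt (0 : ℝ) h1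
  have h4 := (evalSite ℂ (site j)).hasFDerivAt.comp_hasDerivAt (0 : ℝ) h2
  have h5 := Complex.reCLM.hasFDerivAt.comp_hasDerivAt (0 : ℝ)
    (((Complex.conjCLE : ℂ →L[ℝ] ℂ).hasFDerivAt.comp_hasDerivAt (0 : ℝ)
      (h3.const_mul Complex.I)).mul h4)
  have h6 : ∀ᶠ t in 𝓝 (0 : ℝ), ‖v + t • h‖ < 4 := by
    refine h1.continuousAt.norm.eventually_lt_const ?_
    simp only [zero_smul, add_zero]
    exact (K.norm_torusPoint_lt hμ ψ).trans (by norm_num)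
  have h6' : (fun _ => (0 : ℝ)) =ᶠ[𝓝 (0 : ℝ)] fun t : ℝ =>
      (starRingEnd ℂ (Complex.I * (v + t • h : Chain) (site j)) *
        K.N (v + t • h, 0, μ) (site j)).re := h6.mono fun t ht => by
    have := K.balance ht (by simp : |(0 : ℝ)| < 1) hμ j
    rw [zero_mul] at this
    exact this.symm
  have h7 := (h5.congr_of_eventuallyEq h6').unique (hasDerivAt_const (0 : ℝ) (0 : ℝ))
  have h8 : K.N (v, 0, μ) = 0 := K.torus hμ ψ
  simp only [Function.comp_apply, zero_smul, add_zero, h8, map_zero, mul_zero, zero_add] at h7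
  have h9 : starRingEnd ℂ (Complex.I * v (site j)) * K.lin ψ μ h (site j) =
      (K.r μ : ℂ) * (starRingEnd ℂ (kerDir ψ j) * K.lin ψ μ h (site j)) := by
    have hv : v (site j) = (K.r μ : ℂ) * phase ψ j := by
      rw [show v = _ from torusPoint_eq_phase _ _, embS_site]
    rw [hv, kerDir_eq]
    simp only [map_mul, Complex.conj_ofReal]
    ring
  have h10 : K.r μ * kerCoord ψ (K.lin ψ μ h) j = 0 := by
    rw [kerCoord_apply, ← Complex.re_ofReal_mul, ← h9]
    exact h7
  have h11 := abs_lt.1 (K.r_mem hμ)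
  exact (mul_eq_zero.1 h10).resolve_left (by linarith)

/-- Where `rangeLin` is invertible, the range of `Λ` is the orthogonal complement of the tangent
space of the torus, and its kernel is that tangent space. -/
theorem lin_range_ker {μ : ℝ} (hμ : |μ| < K.bound) {ψ : R4}
    (hinv : (K.rangeLin ψ μ).IsInvertible) (y : Chain) :
    (y ∈ Set.range (K.lin ψ μ) ↔ kerProj ψ y = 0) ∧
      (K.lin ψ μ y = 0 ↔ kerProj ψ y = y) := by
  obtain ⟨e, he⟩ := hinv
  have h1 : ∀ h, e h = kerProj ψ h + K.lin ψ μ h := fun h => by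
    have : e h = K.rangeLin ψ μ h := by rw [← he]; rfl
    rw [this, rangeLin_apply, kerProj_lin hμ, sub_zero]
  refine ⟨⟨?_, fun hy => ?_⟩, fun hy => ?_, fun hy => ?_⟩
  · rintro ⟨h, rfl⟩
    exact kerProj_lin hμ ψ h
  · have h2 := h1 (e.symm y)
    rw [e.apply_symm_apply] at h2
    have h3 := congrArg (kerProj ψ) h2
    rw [hy, map_add, kerProj_lin hμ, kerProj_kerProj, add_zero] at h3
    rw [← h3, zero_add] at h2
    exact ⟨_, h2.symm⟩
  · refine e.injective ?_
    rw [h1, h1, hy, kerProj_kerProj, add_zero, kerProj_eq_kerVec ψ y, lin_kerVec hμ, add_zero]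
  · rw [← hy, kerProj_eq_kerVec, lin_kerVec hμ]

theorem eventually_rangeLin_invertible (θ₀ : R4) :
    ∀ᶠ q in 𝓝 ((0, 0, θ₀, 0) : Param), (K.rangeLin q.2.2.1 q.2.2.2).IsInvertible := by
  have h0 : |(0 : ℝ)| < K.bound := by simpa using K.pos
  have h1 : ContinuousAt (fderiv ℝ K.rangeEq) ((0, 0, θ₀, 0), 0) :=
    ((contDiffAt_rangeEq (admissible_base h0)).fderiv_right (m := 0) (by norm_num)).continuousAt
  have h2 : ContinuousAt (fun q : Param => (((0, 0, q.2.2.1, q.2.2.2), 0) : Param × Chain))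
      (0, 0, θ₀, 0) := by fun_prop
  have h3 : ContinuousAt (fun q : Param =>
      (fderiv ℝ K.rangeEq ((0, 0, q.2.2.1, q.2.2.2), 0)).comp
        (ContinuousLinearMap.inr ℝ Param Chain)) (0, 0, θ₀, 0) :=
    (ContinuousAt.comp (f := fun q : Param => (((0, 0, q.2.2.1, q.2.2.2), 0) : Param × Chain))
      h1 h2).clm_comp continuousAt_const
  have h4 : ∀ᶠ q in 𝓝 ((0, 0, θ₀, 0) : Param), |q.2.2.2| < K.bound := by
    have : ContinuousAt (fun q : Param => |q.2.2.2|) (0, 0, θ₀, 0) := by fun_prop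
    exact this.eventually_lt_const h0
  have h5 : ∀ q : Param, |q.2.2.2| < K.bound →
      (fderiv ℝ K.rangeEq ((0, 0, q.2.2.1, q.2.2.2), 0)).comp
        (ContinuousLinearMap.inr ℝ Param Chain) = K.rangeLin q.2.2.1 q.2.2.2 := fun q hq => by
    have a1 := ((contDiffAt_rangeEq (admissible_base (ψ := q.2.2.1) hq)).differentiableAt
      one_ne_zero).hasFDerivAt
    exact (a1.comp (0 : Chain) (hasFDerivAt_prodMk_right _ _)).unique (hasFDerivAt_rangeEq hq _)
  obtain ⟨e, he⟩ := rangeLin_zero_invertible (K := K) θ₀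
  have h6 : ∀ᶠ q in 𝓝 ((0, 0, θ₀, 0) : Param),
      ((fderiv ℝ K.rangeEq ((0, 0, q.2.2.1, q.2.2.2), 0)).comp
        (ContinuousLinearMap.inr ℝ Param Chain)).IsInvertible := by
    refine h3.eventually (p := fun A : Chain →L[ℝ] Chain => A.IsInvertible) ?_
    have h7 := e.nhds
    rw [he, ← h5 (0, 0, θ₀, 0) h0] at h7
    exact h7
  filter_upwards [h4, h6] with q hq1 hq2
  rw [h5 q hq1] at hq2
  exact hq2

/-- The solution `h` of the range equation, as a function of all parameters. -/
theorem exists_rangeSol (K : KernelFamily) (θ₀ : R4) : ∃ h : Param → Chain, h (0, 0, θ₀, 0) = 0 ∧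
    ContDiffAt ℝ 1 h (0, 0, θ₀, 0) ∧
    (∀ᶠ q in 𝓝 ((0, 0, θ₀, 0) : Param), K.rangeEq (q, h q) = 0) ∧
    ∀ᶠ p in 𝓝 (((0, 0, θ₀, 0), 0) : Param × Chain), K.rangeEq p = 0 → p.2 = h p.1 := by
  have h0 : |(0 : ℝ)| < K.bound := by simpa using K.pos
  exact exists_implicit (contDiffAt_rangeEq (admissible_base h0)) (rangeEq_base h0 θ₀)
    (hasFDerivAt_rangeEq h0 θ₀) (rangeLin_zero_invertible θ₀)

end KernelFamily

/-! ### The bifurcation function as a function of all parameters -/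

/-- `h` is the solution of the range equation near the torus point with phases `θ₀` at `μ = 0`. -/
structure IsRangeSol (K : KernelFamily) (θ₀ : R4) (h : Param → Chain) : Prop where
  base : h (0, 0, θ₀, 0) = 0
  smooth : ContDiffAt ℝ 1 h (0, 0, θ₀, 0)
  solves : ∀ᶠ q in 𝓝 ((0, 0, θ₀, 0) : Param), K.rangeEq (q, h q) = 0
  unique : ∀ᶠ p in 𝓝 (((0, 0, θ₀, 0), 0) : Param × Chain), K.rangeEq p = 0 → p.2 = h p.1

namespace KernelFamily

variable (K : KernelFamily) (h : Param → Chain)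

/-- The point `v + k + h(k, ε)`. -/
def solPoint (q : Param) : Chain := K.point (q, h q)

/-- The component of `solPoint` along the radial direction at the site `j`. -/
def radial (j : Fin 4) (q : Param) : ℝ :=
  (starRingEnd ℂ (K.solPoint h q (site j)) * phase q.2.2.1 j).re

/-- The quantity `B_j` at `solPoint`. -/
def torque (j : Fin 4) (q : Param) : ℝ := K.B j (K.solPoint h q, q.2.1, q.2.2.2)

/-- The function `P`. -/
def redBif (q : Param) : R4 :=
  WithLp.toLp 2 fun j => K.torque h j q / K.radial h j q

variable {K h} {θ₀ : R4}

theorem redBif_apply (q : Param) (j : Fin 4) :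
    K.redBif h q j = K.torque h j q / K.radial h j q := rfl

theorem solPoint_base (hh : IsRangeSol K θ₀ h) : K.solPoint h (0, 0, θ₀, 0) = torusPoint 1 θ₀ := by
  rw [solPoint, hh.base, point_base, add_zero, K.r_zero]

theorem radial_torus {q : Param} {r : ℝ} (hq : K.solPoint h q = torusPoint r q.2.2.1) (j : Fin 4) :
    K.radial h j q = r := by
  rw [radial, hq, torusPoint_eq_phase, embS_site, map_mul, Complex.conj_ofReal, mul_assoc,
    mul_comm (starRingEnd ℂ _), phase_mul_conj, mul_one, Complex.ofReal_re]

theorem contDiffAt_solPoint (hh : IsRangeSol K θ₀ h) :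
    ContDiffAt ℝ 1 (K.solPoint h) (0, 0, θ₀, 0) := by
  have h1 : ContDiffAt ℝ 1 (fun q : Param => (q, h q)) (0, 0, θ₀, 0) :=
    contDiffAt_id.prodMk hh.smooth
  have h2 : ContDiffAt ℝ 1 K.point ((0, 0, θ₀, 0), h (0, 0, θ₀, 0)) :=
    contDiffAt_point (by simpa using K.pos)
  exact ContDiffAt.comp (g := K.point) (f := fun q : Param => (q, h q)) (0, 0, θ₀, 0) h2 h1

theorem contDiffAt_radial (hh : IsRangeSol K θ₀ h) (j : Fin 4) :
    ContDiffAt ℝ 1 (K.radial h j) (0, 0, θ₀, 0) := by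
  have h1 : ContDiffAt ℝ 1 (fun q => K.solPoint h q (site j)) (0, 0, θ₀, 0) :=
    ContDiffAt.comp (g := evalSite ℂ (site j)) (0, 0, θ₀, 0)
      (evalSite ℂ (site j)).contDiff.contDiffAt (contDiffAt_solPoint hh)
  have h2 : ContDiffAt ℝ 1 (fun q => starRingEnd ℂ (K.solPoint h q (site j))) (0, 0, θ₀, 0) :=
    ContDiffAt.comp (g := (Complex.conjCLE : ℂ → ℂ)) (0, 0, θ₀, 0)
      Complex.conjCLE.contDiff.contDiffAt h1
  have h3 : ContDiffAt ℝ 1 (fun q : Param => phase q.2.2.1 j) (0, 0, θ₀, 0) :=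
    ContDiffAt.comp (g := fun ψ : R4 => phase ψ j) (f := fun q : Param => q.2.2.1) (0, 0, θ₀, 0)
      (contDiff_phase j).contDiffAt (by fun_prop)
  exact ContDiffAt.comp (g := (Complex.reCLM : ℂ → ℝ)) (0, 0, θ₀, 0)
    Complex.reCLM.contDiff.contDiffAt (h2.mul h3)

theorem contDiffAt_torque (hh : IsRangeSol K θ₀ h) (j : Fin 4) :
    ContDiffAt ℝ 1 (K.torque h j) (0, 0, θ₀, 0) := by
  have h0 : |(0 : ℝ)| < K.bound := by simpa using K.pos
  have h1 : ContDiffAt ℝ 1 (K.B j) (K.solPoint h (0, 0, θ₀, 0), 0, 0) := by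
    refine K.smooth_B j ?_ (by simp) h0
    rw [solPoint_base hh, ← K.r_zero]
    exact (K.norm_torusPoint_lt h0 θ₀).trans (by norm_num)
  have h2 : ContDiffAt ℝ 1 (fun q : Param => (K.solPoint h q, q.2.1, q.2.2.2)) (0, 0, θ₀, 0) :=
    (contDiffAt_solPoint hh).prodMk (by fun_prop)
  exact ContDiffAt.comp (g := K.B j) (f := fun q : Param => (K.solPoint h q, q.2.1, q.2.2.2))
    (0, 0, θ₀, 0) h1 h2

theorem radial_base (hh : IsRangeSol K θ₀ h) (j : Fin 4) : K.radial h j (0, 0, θ₀, 0) = 1 :=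
  radial_torus (solPoint_base hh) j

theorem contDiffAt_redBif (hh : IsRangeSol K θ₀ h) :
    ContDiffAt ℝ 1 (K.redBif h) (0, 0, θ₀, 0) := by
  rw [contDiffAt_euclidean]
  intro j
  have h1 : K.radial h j (0, 0, θ₀, 0) ≠ 0 := by
    rw [radial_base hh]
    exact one_ne_zero
  exact (contDiffAt_torque hh j).div (contDiffAt_radial hh j) h1

/-- Near the base point the family is defined at the solution, the range equation holds, the
radial components are positive, and the solution of the range equation is unique in a ball. -/
theorem eventually_good (hh : IsRangeSol K θ₀ h) : ∃ η > 0, η ≤ 1 / 2 ∧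
    ∀ᶠ q in 𝓝 ((0, 0, θ₀, 0) : Param), ‖q.1‖ < 1 / 2 ∧ |q.2.1| < 1 ∧ |q.2.2.2| < K.bound ∧
      ‖h q‖ < η ∧ K.rangeEq (q, h q) = 0 ∧ (∀ j, 0 < K.radial h j q) ∧
      ∀ h', ‖h'‖ < η → K.rangeEq (q, h') = 0 → h' = h q := by
  have h1 := hh.unique
  rw [nhds_prod_eq, eventually_prod_iff] at h1
  obtain ⟨pa, ha, pb, hb, hab⟩ := h1
  obtain ⟨η, hη, hηb⟩ := Metric.eventually_nhds_iff.1 hb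
  have c1 : ContinuousAt (fun q : Param => ‖q.1‖) (0, 0, θ₀, 0) := by fun_prop
  have c2 : ContinuousAt (fun q : Param => |q.2.1|) (0, 0, θ₀, 0) := by fun_prop
  have c3 : ContinuousAt (fun q : Param => |q.2.2.2|) (0, 0, θ₀, 0) := by fun_prop
  have c4 := hh.smooth.continuousAt.norm
  have hη' : 0 < min η (1 / 2) := by positivity
  have e5 : ∀ᶠ q in 𝓝 ((0, 0, θ₀, 0) : Param), ∀ j, 0 < K.radial h j q := by
    rw [eventually_all]
    intro j
    refine (contDiffAt_radial hh j).continuousAt.eventually_const_lt ?_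
    rw [radial_base hh]
    exact one_pos
  refine ⟨min η (1 / 2), hη', min_le_right _ _, ?_⟩
  filter_upwards [ha, c1.eventually_lt_const (u := 1 / 2) (by simp),
    c2.eventually_lt_const (u := 1) (by simp),
    c3.eventually_lt_const (u := K.bound) (by simpa using K.pos),
    c4.eventually_lt_const (u := min η (1 / 2)) (by simpa only [hh.base, norm_zero] using hη'),
    hh.solves, e5] with q q1 q2 q3 q4 q5 q6 q7
  refine ⟨q2, q3, q4, q5, q6, q7, fun h' h1 h2 => hab q1 (hηb ?_) h2⟩
  rw [dist_zero_right]
  exact h1.trans_le (min_le_left _ _)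

/-- The map `F` is the member of the family at the torus point with amplitude `r μ` and
phases `ψ`. -/
def Represents (K : KernelFamily) (F : Chain → ℝ → Chain) (ψ : R4) (μ : ℝ) : Prop :=
  ∀ w ε, ‖torusPoint (K.r μ) ψ + w‖ < 4 → |ε| < 1 →
    F w ε = K.N (torusPoint (K.r μ) ψ + w, ε, μ)

theorem Represents.Lam_eq {F : Chain → ℝ → Chain} {ψ : R4} {μ : ℝ} (hF : K.Represents F ψ μ)
    (hμ : |μ| < K.bound) : Lam F = K.lin ψ μ := by
  have h1 : ∀ᶠ w : Chain in 𝓝 0, ‖torusPoint (K.r μ) ψ + w‖ < 4 := by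
    have : ContinuousAt (fun w : Chain => ‖torusPoint (K.r μ) ψ + w‖) 0 := by fun_prop
    refine this.eventually_lt_const ?_
    simp only [add_zero]
    exact (K.norm_torusPoint_lt hμ ψ).trans (by norm_num)
  have h2 : (fun w => F w 0) =ᶠ[𝓝 0] fun w => K.N (torusPoint (K.r μ) ψ + w, 0, μ) :=
    h1.mono fun w hw => hF w 0 hw (by simp)
  rw [Lam, h2.fderiv_eq]
  exact (hasFDerivAt_lin' hμ ψ).fderiv

theorem Represents.eq_value {F : Chain → ℝ → Chain} {q : Param}
    (hF : K.Represents F q.2.2.1 q.2.2.2) {h' : Chain} (hq : K.Admissible (q, h')) :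
    F (kerVec q.2.2.1 q.1 + h') q.2.1 = K.value (q, h') := by
  have h1 := hq.point
  rw [point, add_assoc] at h1
  rw [hF _ _ h1 hq.eps, value, point, add_assoc]

theorem Represents.solvesRange2_iff {F : Chain → ℝ → Chain} {q : Param}
    (hF : K.Represents F q.2.2.1 q.2.2.2) {h' : Chain} (hq : K.Admissible (q, h'))
    (hinv : (K.rangeLin q.2.2.1 q.2.2.2).IsInvertible) :
    SolvesRange2 F q.2.2.1 q.1 q.2.1 h' ↔ K.rangeEq (q, h') = 0 := by
  rw [SolvesRange2, hF.Lam_eq hq.mu, hF.eq_value hq, (lin_range_ker hq.mu hinv _).1,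
    (lin_range_ker hq.mu hinv _).2, rangeEq_eq_zero_iff]

theorem eventually_rangeSol2_eq (hh : IsRangeSol K θ₀ h) :
    ∀ᶠ q in 𝓝 ((0, 0, θ₀, 0) : Param), ∀ F, K.Represents F q.2.2.1 q.2.2.2 →
      rangeSol2 F q.2.2.1 q.1 q.2.1 = h q := by
  obtain ⟨η, hη, hη2, hgood⟩ := eventually_good hh
  filter_upwards [hgood, eventually_rangeLin_invertible θ₀]
    with q ⟨q1, q2, q3, q4, q5, _, q7⟩ hinv F hF
  have adm : ∀ h', ‖h'‖ < η → K.Admissible (q, h') := fun h' h1 =>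
    admissible_of_lt q1 q2 q3 (h1.trans_le hη2)
  have hsol : SolvesRange2 F q.2.2.1 q.1 q.2.1 (h q) :=
    (hF.solvesRange2_iff (adm _ q4) hinv).2 q5
  have huniq : ∀ h', ‖h'‖ < η → SolvesRange2 F q.2.2.1 q.1 q.2.1 h' → h' = h q :=
    fun h' h1 h2 => q7 h' h1 ((hF.solvesRange2_iff (adm _ h1) hinv).1 h2)
  have hmin : ∀ h', SolvesRange2 F q.2.2.1 q.1 q.2.1 h' → ‖h q‖ ≤ ‖h'‖ := fun h' h1 => by
    by_contra! h2
    rw [huniq h' (h2.trans q4) h1] at h2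
    exact lt_irrefl _ h2
  have hex : ∃ w, SolvesRange2 F q.2.2.1 q.1 q.2.1 w ∧
      ∀ h', SolvesRange2 F q.2.2.1 q.1 q.2.1 h' → ‖w‖ ≤ ‖h'‖ := ⟨h q, hsol, hmin⟩
  have hspec := Classical.epsilon_spec hex
  exact huniq _ ((hspec.2 _ hsol).trans_lt q4) hspec.1

/-- At a solution of the range equation the value of the family lies in the kernel, and its
components are given by the balance of the sites. -/
theorem kerCoord_value {q : Param} (hq : K.Admissible (q, h q)) (hsol : K.rangeEq (q, h q) = 0)
    (hpos : ∀ j, 0 < K.radial h j q) :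
    kerCoord q.2.2.1 (K.value (q, h q)) = q.2.1 • K.redBif h q := by
  ext j
  set G := kerCoord q.2.2.1 (K.value (q, h q)) with hG
  have h1 : K.value (q, h q) (site j) = (G j : ℂ) * kerDir q.2.2.1 j := by
    rw [← (rangeEq_eq_zero_iff.1 hsol).2, kerProj_eq_kerVec, kerVec_eq, embS_site]
  have h2 := K.balance hq.point hq.eps hq.mu j
  have h3 : starRingEnd ℂ (Complex.I * K.point (q, h q) (site j)) * K.value (q, h q) (site j) =
      (G j : ℂ) * (starRingEnd ℂ (K.solPoint h q (site j)) * phase q.2.2.1 j) := by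
    rw [h1, kerDir_eq, map_mul, Complex.conj_I, solPoint]
    linear_combination -(G j : ℂ) * starRingEnd ℂ (K.point (q, h q) (site j)) *
      phase q.2.2.1 j * Complex.I_sq
  have h4 : G j * K.radial h j q = q.2.1 * K.torque h j q := by
    rw [radial, ← Complex.re_ofReal_mul, ← h3]
    exact h2
  rw [PiLp.smul_apply, redBif_apply, smul_eq_mul, ← mul_div_assoc, ← h4,
    mul_div_cancel_right₀ _ (hpos j).ne']

theorem eventually_bifurcation_eq (hh : IsRangeSol K θ₀ h) :
    ∀ᶠ q in 𝓝 ((0, 0, θ₀, 0) : Param), ∀ F, K.Represents F q.2.2.1 q.2.2.2 →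
      bifurcation F q.2.2.1 q.1 q.2.1 = q.2.1 • K.redBif h q := by
  obtain ⟨η, hη, hη2, hgood⟩ := eventually_good hh
  filter_upwards [hgood, eventually_rangeSol2_eq hh]
    with q ⟨q1, q2, q3, q4, q5, q6, _⟩ hr F hF
  have adm : K.Admissible (q, h q) := admissible_of_lt q1 q2 q3 (q4.trans_le hη2)
  rw [← kerCoord_value adm q5 q6, ← hF.eq_value adm, bifurcation, hr F hF]
  rfl

theorem eventually_reducedBif_eq (hh : IsRangeSol K θ₀ h) :
    ∀ᶠ q in 𝓝 ((0, 0, θ₀, 0) : Param), ∀ F, K.Represents F q.2.2.1 q.2.2.2 →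
      reducedBif F q.2.2.1 q.1 q.2.1 = K.redBif h q := by
  filter_upwards [(eventually_bifurcation_eq hh).eventually_nhds,
    (contDiffAt_redBif hh).eventually (by simp)] with q hq hd F hF
  obtain ⟨κ, ε, ψ, μ⟩ := q
  unfold reducedBif
  split_ifs with hε
  · simp only at hε hF ⊢
    subst hε
    have h1 : ContinuousAt (fun e : ℝ => ((κ, e, ψ, μ) : Param)) 0 := by fun_prop
    have h2 : (fun e => bifurcation F ψ κ e) =ᶠ[𝓝 0] fun e => e • K.redBif h (κ, e, ψ, μ) :=
      (h1.eventually hq).mono fun e he => he F hF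
    have h3 : DifferentiableAt ℝ (fun e : ℝ => K.redBif h (κ, e, ψ, μ)) 0 :=
      DifferentiableAt.comp (g := K.redBif h) (f := fun e : ℝ => ((κ, e, ψ, μ) : Param)) 0
        (hd.differentiableAt one_ne_zero) (by fun_prop)
    rw [h2.deriv_eq]
    have h4 : HasDerivAt (fun e : ℝ => e • K.redBif h (κ, e, ψ, μ)) _ 0 :=
      (hasDerivAt_id (0 : ℝ)).smul h3.hasDerivAt
    rw [h4.deriv]
    simp
  · have h1 := hq.self_of_nhds F hF
    simp only at h1 hε ⊢
    rw [h1, inv_smul_smul₀ hε]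

end KernelFamily

/-! ### Symmetries of the bifurcation function -/

theorem gaugeDir_apply (j : Fin 4) : gaugeDir j = 1 := rfl

theorem phase_add_gauge (ψ : R4) (c : ℝ) (j : Fin 4) :
    phase (ψ + c • gaugeDir : R4) j = Complex.exp (-c * Complex.I) * phase ψ j := by
  rw [phase, phase, ← Complex.exp_add]
  congr 1
  rw [PiLp.add_apply, PiLp.smul_apply, gaugeDir_apply, smul_eq_mul, mul_one]
  push_cast
  ring

theorem rot_embS (c : ℝ) (f : Fin 4 → ℂ) :
    rot c (embS f) = embS fun j => Complex.exp (-c * Complex.I) * f j := by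
  refine embS_ext (fun j => ?_) fun i hi => ?_
  · rw [rot_apply, embS_site]
  · rw [rot_apply, embS_off _ hi, mul_zero]

theorem torusPoint_add_gauge (r : ℝ) (ψ : R4) (c : ℝ) :
    torusPoint r (ψ + c • gaugeDir : R4) = rot c (torusPoint r ψ) := by
  simp only [torusPoint_eq_phase, rot_embS, phase_add_gauge]
  congr 1
  funext j
  ring

theorem kerVec_add_gauge (ψ κ : R4) (c : ℝ) :
    kerVec (ψ + c • gaugeDir : R4) κ = rot c (kerVec ψ κ) := by
  simp only [kerVec_eq, kerDir_eq, rot_embS, phase_add_gauge]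
  congr 1
  funext j
  ring

theorem exp_mul_conj (c : ℝ) :
    starRingEnd ℂ (Complex.exp (-c * Complex.I)) * Complex.exp (-c * Complex.I) = 1 := by
  rw [mul_comm, Complex.mul_conj, Complex.normSq_eq_norm_sq, norm_exp_phase]
  norm_num

theorem kerProj_add_gauge (ψ : R4) (c : ℝ) (u : Chain) :
    kerProj (ψ + c • gaugeDir : R4) (rot c u) = rot c (kerProj ψ u) := by
  simp only [kerProj_apply, rot_embS, phase_add_gauge, rot_apply]
  congr 1
  funext j
  rw [map_mul]
  linear_combination -(1 / 2 : ℂ) * Complex.exp (-c * Complex.I) * phase ψ j ^ 2 *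
    starRingEnd ℂ (u (site j)) * exp_mul_conj c

namespace KernelFamily

variable {K : KernelFamily} {h : Param → Chain} {θ₀ : R4}

theorem rangeEq_add_gauge {κ ψ : R4} {ε μ : ℝ} {u : Chain} (c : ℝ)
    (hq : K.Admissible ((κ, ε, ψ, μ), u)) :
    K.rangeEq ((κ, ε, ψ + c • gaugeDir, μ), rot c u) = rot c (K.rangeEq ((κ, ε, ψ, μ), u)) := by
  have h1 : K.point ((κ, ε, ψ + c • gaugeDir, μ), rot c u) =
      rot c (K.point ((κ, ε, ψ, μ), u)) := by
    simp only [point, torusPoint_add_gauge, kerVec_add_gauge, map_add]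
  have h2 : K.value ((κ, ε, ψ + c • gaugeDir, μ), rot c u) =
      rot c (K.value ((κ, ε, ψ, μ), u)) := by
    rw [value, h1]
    exact K.N_rot hq.point hq.eps hq.mu c
  simp only [rangeEq, h2, kerProj_add_gauge, map_add, map_sub]

theorem eventually_redBif_add_gauge (hh : IsRangeSol K θ₀ h) :
    ∀ᶠ p in 𝓝 (((0, 0, θ₀, 0), 0) : Param × ℝ),
      K.redBif h (p.1.1, p.1.2.1, p.1.2.2.1 + p.2 • gaugeDir, p.1.2.2.2) = K.redBif h p.1 := by
  obtain ⟨η, hη, hη2, hgood⟩ := eventually_good hh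
  have c1 : ContinuousAt (fun p : Param × ℝ => p.1) ((0, 0, θ₀, 0), 0) := by fun_prop
  have c2 : ContinuousAt (fun p : Param × ℝ =>
      ((p.1.1, p.1.2.1, p.1.2.2.1 + p.2 • gaugeDir, p.1.2.2.2) : Param)) ((0, 0, θ₀, 0), 0) := by
    fun_prop
  have c3 : Tendsto (fun p : Param × ℝ =>
      ((p.1.1, p.1.2.1, p.1.2.2.1 + p.2 • gaugeDir, p.1.2.2.2) : Param)) (𝓝 ((0, 0, θ₀, 0), 0))
      (𝓝 (0, 0, θ₀, 0)) := by
    have := c2.tendsto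
    simpa only [zero_smul, add_zero] using this
  filter_upwards [c1.eventually hgood, c3.eventually hgood] with p hp hp'
  obtain ⟨⟨κ, ε, ψ, μ⟩, c⟩ := p
  obtain ⟨q1, q2, q3, q4, q5, -⟩ := hp
  obtain ⟨-, -, -, -, -, -, q7⟩ := hp'
  simp only at q1 q2 q3 q4 q5 q7 ⊢
  have adm : K.Admissible ((κ, ε, ψ, μ), h (κ, ε, ψ, μ)) :=
    admissible_of_lt q1 q2 q3 (q4.trans_le hη2)
  have h1 := q7 (rot c (h (κ, ε, ψ, μ))) ((norm_rot_le _ _).trans_lt q4)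
    (by rw [rangeEq_add_gauge c adm, q5, map_zero])
  have h2 : K.solPoint h (κ, ε, ψ + c • gaugeDir, μ) = rot c (K.solPoint h (κ, ε, ψ, μ)) := by
    simp only [solPoint, ← h1, point, torusPoint_add_gauge, kerVec_add_gauge, map_add]
  ext j
  rw [redBif_apply, redBif_apply]
  congr 1
  · rw [torque, h2]
    exact K.B_rot adm.point adm.eps adm.mu c j
  · simp only [radial, h2, rot_apply, phase_add_gauge, map_mul]
    congr 1
    linear_combination starRingEnd ℂ (K.solPoint h (κ, ε, ψ, μ) (site j)) * phase ψ j *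
      exp_mul_conj c

theorem eventually_conserved (hh : IsRangeSol K θ₀ h) :
    ∀ᶠ q in 𝓝 ((0, 0, θ₀, 0) : Param), ∑ j, K.radial h j q * K.redBif h q j = 0 := by
  obtain ⟨η, hη, hη2, hgood⟩ := eventually_good hh
  have h1 : ∀ᶠ q in 𝓝 ((0, 0, θ₀, 0) : Param), q.2.1 ≠ 0 → ∑ j, K.torque h j q = 0 := by
    filter_upwards [hgood] with q ⟨q1, q2, q3, q4, q5, q6, _⟩ hε
    have adm : K.Admissible (q, h q) := admissible_of_lt q1 q2 q3 (q4.trans_le hη2)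
    have h2 := K.conserved adm.point adm.eps adm.mu
    have h3 : ∀ i ∉ Set.range site, K.N (K.point (q, h q), q.2.1, q.2.2.2) i = 0 := fun i hi => by
      have := (rangeEq_eq_zero_iff.1 q5).2
      rw [← show K.value (q, h q) = K.N (K.point (q, h q), q.2.1, q.2.2.2) from rfl, ← this,
        kerProj_apply, embS_off _ fun j hj => hi ⟨j, hj.symm⟩]
    rw [← site_injective.hasSum_iff (fun i hi => by
      have := h3 i hi
      simp only at this ⊢
      rw [this, mul_zero, Complex.zero_re])] at h2
    have h4 := (hasSum_fintype _).unique h2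
    simp only [Function.comp_apply] at h4
    rw [Finset.sum_congr rfl fun j _ => K.balance adm.point adm.eps adm.mu j,
      ← Finset.mul_sum] at h4
    exact (mul_eq_zero.1 h4).resolve_left hε
  have hc : ∀ᶠ q in 𝓝 ((0, 0, θ₀, 0) : Param), ContinuousAt (fun q => ∑ j, K.torque h j q) q := by
    have : ContDiffAt ℝ 1 (fun q => ∑ j, K.torque h j q) (0, 0, θ₀, 0) :=
      ContDiffAt.sum fun j _ => contDiffAt_torque hh j
    exact (this.eventually (by simp)).mono fun q hq => hq.continuousAt
  filter_upwards [h1.eventually_nhds, hc, hgood] with q hq hqc ⟨_, _, _, _, _, q6, _⟩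
  have h5 : ∑ j, K.torque h j q = 0 := by
    -- At `ε = 0` the balance is trivial, and the sum vanishes as a limit.
    have c1 : ContinuousAt (fun e : ℝ => ((q.1, q.2.1 + e, q.2.2) : Param)) 0 := by fun_prop
    have c2 : Tendsto (fun e : ℝ => ((q.1, q.2.1 + e, q.2.2) : Param)) (𝓝[≠] 0) (𝓝 q) := by
      have := c1.tendsto
      rw [add_zero] at this
      exact this.mono_left nhdsWithin_le_nhds
    have c3 := hqc.tendsto.comp c2
    have c4 : ∀ᶠ e : ℝ in 𝓝[≠] 0, q.2.1 + e ≠ 0 := by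
      by_cases h0 : q.2.1 = 0
      · filter_upwards [self_mem_nhdsWithin] with e he
        rwa [h0, zero_add]
      · have : ContinuousAt (fun e : ℝ => q.2.1 + e) 0 := by fun_prop
        exact (this.eventually_ne (by simpa using h0)).filter_mono nhdsWithin_le_nhds
    refine tendsto_nhds_unique c3 (tendsto_const_nhds.congr' ?_)
    filter_upwards [c2.eventually hq, c4] with e he1 he2
    exact (he1 he2).symm
  rw [← h5]
  refine Finset.sum_congr rfl fun j _ => ?_
  rw [redBif_apply, mul_div_cancel₀ _ (q6 j).ne']

theorem tendsto_base (θ₀ : R4) : Tendsto (fun p : R4 × ℝ => ((0, 0, p.1, p.2) : Param))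
    (𝓝 (θ₀, 0)) (𝓝 (0, 0, θ₀, 0)) := by
  have : ContinuousAt (fun p : R4 × ℝ => ((0, 0, p.1, p.2) : Param)) (θ₀, 0) := by fun_prop
  exact this.tendsto

theorem eventually_solPoint_torus (hh : IsRangeSol K θ₀ h) :
    ∀ᶠ p in 𝓝 ((θ₀, 0) : R4 × ℝ), K.solPoint h (0, 0, p.1, p.2) = torusPoint (K.r p.2) p.1 := by
  obtain ⟨η, hη, hη2, hgood⟩ := eventually_good hh
  filter_upwards [(tendsto_base θ₀).eventually hgood] with p ⟨_, _, q3, _, _, _, q7⟩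
  have h1 := q7 0 (by simpa using hη) (rangeEq_base q3 p.1)
  rw [solPoint, ← h1, point_base, add_zero]

/-- The rotation of the phases by `-α` moves the torus point along `k + h(k, 0)`, where
`k_j = r sin α_j`. -/
theorem kerProj_torusPoint_sub (r : ℝ) (ψ α κ : R4) (hκ : ∀ j, κ j = r * Real.sin (α j)) :
    kerProj ψ (torusPoint r (ψ - α : R4) - torusPoint r ψ - kerVec ψ κ) = 0 ∧ ∀ j,
      (starRingEnd ℂ (torusPoint r (ψ - α : R4) (site j)) * phase ψ j).re =
        r * Real.cos (α j) := by
  have h1 : ∀ j, phase (ψ - α : R4) j = Complex.exp ((α j : ℝ) * Complex.I) * phase ψ j := by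
    intro j
    rw [phase, phase, ← Complex.exp_add, PiLp.sub_apply]
    push_cast
    congr 1
    ring
  constructor
  · rw [kerProj_eq_zero_iff]
    intro j
    rw [kerCoord_apply, site_sub, site_sub, mul_sub, Complex.sub_re, ← kerCoord_apply ψ (kerVec ψ κ),
      kerCoord_kerVec, hκ, torusPoint_eq_phase, torusPoint_eq_phase, embS_site, embS_site, h1,
      kerDir_eq]
    have h2 : starRingEnd ℂ (Complex.I * phase ψ j) *
        (r * (Complex.exp ((α j : ℝ) * Complex.I) * phase ψ j) - r * phase ψ j) =
        (r : ℂ) * (-Complex.I * (Complex.exp ((α j : ℝ) * Complex.I) - 1)) := by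
      rw [map_mul, Complex.conj_I]
      linear_combination (-Complex.I * r * (Complex.exp ((α j : ℝ) * Complex.I) - 1)) *
        phase_mul_conj ψ j
    rw [h2, Complex.re_ofReal_mul]
    simp [Complex.exp_ofReal_mul_I_im]
  · intro j
    rw [torusPoint_eq_phase, embS_site, h1]
    have h2 : starRingEnd ℂ (r * (Complex.exp ((α j : ℝ) * Complex.I) * phase ψ j)) * phase ψ j =
        (r : ℂ) * starRingEnd ℂ (Complex.exp ((α j : ℝ) * Complex.I)) := by
      simp only [map_mul, Complex.conj_ofReal]
      linear_combination (r : ℂ) * starRingEnd ℂ (Complex.exp ((α j : ℝ) * Complex.I)) *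
        phase_mul_conj ψ j
    rw [h2, Complex.re_ofReal_mul, Complex.conj_re, Complex.exp_ofReal_mul_I_re]

theorem hasDerivAt_sin_vec (r : ℝ) (η : R4) : HasDerivAt
    (fun t : ℝ => (WithLp.toLp 2 fun j => r * Real.sin (t * η j) : R4)) (r • η) 0 := by
  have h1 : HasDerivAt (fun t : ℝ => fun j : Fin 4 => r * Real.sin (t * η j))
      (fun j => r * η j) 0 := by
    refine hasDerivAt_pi.2 fun j => ?_
    have h2 := (((hasDerivAt_id (0 : ℝ)).mul_const (η j)).sin).const_mul r
    refine h2.congr_deriv ?_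
    simp
  exact (EuclideanSpace.equiv (Fin 4) ℝ).symm.hasFDerivAt.comp_hasDerivAt (0 : ℝ) h1

/-- At `κ = 0`, `ε = 0` the derivatives in `κ` and in the phases agree up to a factor, since the
solutions `v + k + h(k, 0)` run through the torus. -/
theorem eventually_fderiv_redBif (hh : IsRangeSol K θ₀ h) :
    ∀ᶠ p in 𝓝 ((θ₀, 0) : R4 × ℝ), ∀ η : R4,
      K.r p.2 • fderiv ℝ (K.redBif h) (0, 0, p.1, p.2) (η, 0, 0, 0) =
        -fderiv ℝ (K.redBif h) (0, 0, p.1, p.2) (0, 0, η, 0) := by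
  obtain ⟨ηb, hηb, hη2, hgood⟩ := eventually_good hh
  filter_upwards [(tendsto_base θ₀).eventually hgood.eventually_nhds,
    (tendsto_base θ₀).eventually ((contDiffAt_redBif hh).eventually (by simp)),
    (eventually_solPoint_torus hh).eventually_nhds] with p hp hd htor η
  obtain ⟨ψ, μ⟩ := p
  simp only at hp hd htor ⊢
  obtain ⟨-, -, hμ, -⟩ := hp.self_of_nhds
  simp only at hμ
  set P := K.redBif h
  have hP := (hd.differentiableAt one_ne_zero).hasFDerivAt
  set A := fderiv ℝ P (0, 0, ψ, μ)
  set r := K.r μ with hr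
  have hr0 : r ≠ 0 := by
    have := abs_lt.1 (K.r_mem hμ)
    intro h0
    linarith
  set κ : ℝ → R4 := fun t => WithLp.toLp 2 fun j => r * Real.sin (t * η j) with hκ
  have dκ : HasDerivAt κ (r • η) 0 := hasDerivAt_sin_vec r η
  have κ0 : κ 0 = 0 := by
    ext j
    simp [hκ]
  have dψ : HasDerivAt (fun t : ℝ => ψ - t • η) (-η) 0 := by
    simpa using ((hasDerivAt_id (0 : ℝ)).smul_const η).const_sub ψ
  have d1 : HasDerivAt (fun t : ℝ => P (κ t, 0, ψ, μ)) (A (r • η, 0, 0, 0)) 0 := by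
    refine HasFDerivAt.comp_hasDerivAt (0 : ℝ) (l := P) ?_
      (dκ.prodMk (hasDerivAt_const (0 : ℝ) ((0, ψ, μ) : ℝ × R4 × ℝ)))
    rw [κ0]
    exact hP
  have d2 : HasDerivAt (fun t : ℝ => P (0, 0, ψ - t • η, μ)) (A (0, 0, -η, 0)) 0 := by
    refine HasFDerivAt.comp_hasDerivAt (0 : ℝ) (l := P) ?_
      ((hasDerivAt_const (0 : ℝ) (0 : R4)).prodMk ((hasDerivAt_const (0 : ℝ) (0 : ℝ)).prodMk
        (dψ.prodMk (hasDerivAt_const (0 : ℝ) μ))))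
    rw [zero_smul, sub_zero]
    exact hP
  have t1 : Tendsto (fun t : ℝ => ((κ t, 0, ψ, μ) : Param)) (𝓝 0) (𝓝 (0, 0, ψ, μ)) := by
    have := (dκ.continuousAt.prodMk
      (continuousAt_const (y := ((0, ψ, μ) : ℝ × R4 × ℝ)))).tendsto
    rwa [κ0] at this
  have t2 : Tendsto (fun t : ℝ => ((ψ - t • η, μ) : R4 × ℝ)) (𝓝 0) (𝓝 (ψ, μ)) := by
    have := (dψ.continuousAt.prodMk (continuousAt_const (y := μ))).tendsto
    rwa [zero_smul, sub_zero] at this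
  set g : ℝ → Chain := fun t => torusPoint r (ψ - t • η : R4) - torusPoint r ψ - kerVec ψ (κ t)
    with hg
  have cg : Tendsto (fun t => ‖g t‖) (𝓝 0) (𝓝 0) := by
    have a1 : ContinuousAt (fun t : ℝ => torusPoint r (ψ - t • η : R4)) 0 :=
      ContinuousAt.comp (g := fun p : ℝ × R4 => torusPoint p.1 p.2)
        (f := fun t : ℝ => (r, ψ - t • η)) contDiff_torusPoint.continuous.continuousAt
        (continuousAt_const.prodMk dψ.continuousAt)
    have a2 : ContinuousAt (fun t : ℝ => kerVec ψ (κ t)) 0 :=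
      ContinuousAt.comp (g := fun p : R4 × R4 => kerVec p.1 p.2)
        (f := fun t : ℝ => (ψ, κ t)) contDiff_kerVec.continuous.continuousAt
        (continuousAt_const.prodMk dκ.continuousAt)
    have a3 := ((a1.sub (continuousAt_const (y := torusPoint r ψ))).sub a2).norm.tendsto
    simpa [hg, κ0, kerVec_zero] using a3
  have key : (fun t : ℝ => WithLp.ofLp (P (0, 0, ψ - t • η, μ))) =ᶠ[𝓝 0]
      fun t j => Real.cos (t * η j) * P (κ t, 0, ψ, μ) j := by
    have ecos : ∀ᶠ t : ℝ in 𝓝 0, ∀ j, Real.cos (t * η j) ≠ 0 := by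
      rw [eventually_all]
      intro j
      have : ContinuousAt (fun t : ℝ => Real.cos (t * η j)) 0 := by fun_prop
      exact this.eventually_ne (by simp)
    filter_upwards [t1.eventually hp, t2.eventually htor, cg.eventually_lt_const hηb, ecos]
      with t ⟨_, _, _, _, _, _, q7⟩ htor' hsmall hcos
    obtain ⟨b1, b2⟩ := kerProj_torusPoint_sub r ψ (t • η) (κ t) fun j => by
      simp [hκ]
    have b3 : K.point ((κ t, 0, ψ, μ), g t) = torusPoint r (ψ - t • η : R4) := by
      simp only [point, hg, ← hr]
      abel
    have b4 : K.rangeEq ((κ t, 0, ψ, μ), g t) = 0 := by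
      rw [rangeEq_eq_zero_iff]
      refine ⟨b1, ?_⟩
      rw [value, b3, K.torus hμ, map_zero]
    have b5 : K.solPoint h (κ t, 0, ψ, μ) = torusPoint r (ψ - t • η : R4) := by
      rw [solPoint, ← q7 _ hsmall b4, b3]
    funext j
    have b6 : K.radial h j (κ t, 0, ψ, μ) = r * Real.cos (t * η j) := by
      rw [radial, b5, b2]
      rfl
    have b7 : K.radial h j (0, 0, ψ - t • η, μ) = r := radial_torus htor' j
    change P (0, 0, ψ - t • η, μ) j = _
    rw [redBif_apply, redBif_apply, b6, b7, torque, torque, b5, htor']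
    have := hcos j
    field_simp
    rfl
  have hrη : ((r • η, 0, 0, 0) : Param) = r • ((η, 0, 0, 0) : Param) := by simp
  have hnη : ((0, 0, -η, 0) : Param) = -((0, 0, η, 0) : Param) := by simp
  rw [hrη, map_smul] at d1
  rw [hnη, map_neg] at d2
  ext j
  have e1 := (EuclideanSpace.proj (𝕜 := ℝ) j).hasFDerivAt.comp_hasDerivAt (0 : ℝ) d1
  have e2 := (EuclideanSpace.proj (𝕜 := ℝ) j).hasFDerivAt.comp_hasDerivAt (0 : ℝ) d2
  have e3 : HasDerivAt (fun t : ℝ => Real.cos (t * η j)) 0 0 := by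
    have := ((hasDerivAt_id (0 : ℝ)).mul_const (η j)).cos
    refine this.congr_deriv ?_
    simp
  have e4 := e3.mul e1
  have e5 := (e4.congr_of_eventuallyEq (key.mono fun t ht => congrFun ht j)).unique e2
  simpa using e5

end KernelFamily

/-! ### Linear algebra modulo the gauge direction -/

theorem inner_gaugeDir (κ : R4) : inner ℝ gaugeDir κ = ∑ j, κ j := by
  simp [PiLp.inner_apply, gaugeDir_apply]

theorem inner_gaugeDir_self : inner ℝ gaugeDir gaugeDir = (4 : ℝ) := by
  rw [inner_gaugeDir]
  simp [gaugeDir_apply]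

/-- The rank one map `κ ↦ ⟨g, κ⟩ g`, where `g` is the gauge direction. -/
def gaugePart : R4 →L[ℝ] R4 := (innerSL ℝ gaugeDir).smulRight gaugeDir

theorem gaugePart_apply (κ : R4) : gaugePart κ = (inner ℝ gaugeDir κ : ℝ) • gaugeDir := rfl

section Linear

variable {A : R4 →L[ℝ] R4}

/-- If the range of `A` is orthogonal to the gauge direction, the two parts of `A + gaugePart`
decouple. -/
theorem eq_of_add_gaugePart (hrange : ∀ κ, inner ℝ gaugeDir (A κ) = (0 : ℝ)) {κ y : R4}
    (hy : inner ℝ gaugeDir y = (0 : ℝ)) (h : A κ + gaugePart κ = y) :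
    A κ = y ∧ inner ℝ gaugeDir κ = (0 : ℝ) := by
  have h1 := congrArg (fun z => (inner ℝ gaugeDir z : ℝ)) h
  simp only [inner_add_right, hrange, gaugePart_apply, inner_smul_right, inner_gaugeDir_self, hy,
    zero_add] at h1
  have h2 : inner ℝ gaugeDir κ = (0 : ℝ) := by linarith
  rw [gaugePart_apply, h2, zero_smul, add_zero] at h
  exact ⟨h, h2⟩

theorem isInvertible_add_gaugePart (hrange : ∀ κ, inner ℝ gaugeDir (A κ) = (0 : ℝ))
    (hker : ∀ κ, A κ = 0 → ∃ c : ℝ, κ = c • gaugeDir) : (A + gaugePart).IsInvertible := by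
  have hinj : Function.Injective (A + gaugePart : R4 →L[ℝ] R4).toLinearMap := by
    rw [injective_iff_map_eq_zero]
    intro κ hκ
    obtain ⟨h1, h2⟩ := eq_of_add_gaugePart hrange (inner_zero_right _) hκ
    obtain ⟨c, rfl⟩ := hker κ h1
    rw [inner_smul_right, inner_gaugeDir_self] at h2
    rw [show c = 0 by linarith, zero_smul]
  refine ⟨(LinearEquiv.ofInjectiveEndo _ hinj).toContinuousLinearEquiv, ?_⟩
  ext κ
  rfl

/-- The linear equation with right-hand side orthogonal to the gauge direction is solvable
uniquely up to the gauge direction. -/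
theorem exists_solution_mod_gauge (hrange : ∀ κ, inner ℝ gaugeDir (A κ) = (0 : ℝ))
    (hg : A gaugeDir = 0) (hinv : (A + gaugePart).IsInvertible) {y : R4}
    (hy : inner ℝ gaugeDir y = (0 : ℝ)) :
    ∃ κ, ∀ κ', y + A κ' = 0 ↔ ∃ c : ℝ, κ' = κ + c • gaugeDir := by
  obtain ⟨e, he⟩ := hinv
  have he' : ∀ κ, e κ = A κ + gaugePart κ := fun κ => by
    rw [show e κ = (e : R4 →L[ℝ] R4) κ from rfl, he]
    rfl
  have h1 := he' (e.symm (-y))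
  rw [e.apply_symm_apply] at h1
  have h2 := (eq_of_add_gaugePart hrange (by rw [inner_neg_right, hy, neg_zero]) h1.symm).1
  refine ⟨e.symm (-y), fun κ' => ⟨fun h3 => ?_, ?_⟩⟩
  · set z := κ' - e.symm (-y) with hz
    have h4 : A z = 0 := by
      rw [hz, map_sub, h2, sub_neg_eq_add, add_comm, h3]
    refine ⟨inner ℝ gaugeDir z / 4, ?_⟩
    have h5 : z - (inner ℝ gaugeDir z / 4 : ℝ) • gaugeDir = 0 := by
      refine e.injective ?_
      rw [he', map_sub, map_smul, h4, hg, smul_zero, sub_zero, zero_add, gaugePart_apply,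
        inner_sub_right, inner_smul_right, inner_gaugeDir_self, div_mul_cancel₀ _ (by norm_num),
        sub_self, zero_smul, map_zero]
    rw [← sub_eq_zero.1 h5, hz]
    abel
  · rintro ⟨c, rfl⟩
    rw [map_add, map_smul, hg, smul_zero, add_zero, h2, add_neg_cancel]

end Linear

namespace KernelFamily

variable (K : KernelFamily) (h : Param → Chain)

/-- The derivative of `P` in `κ` at `κ = 0`, `ε = 0`. -/
def kerDeriv (p : R4 × ℝ) : R4 →L[ℝ] R4 :=
  (fderiv ℝ (K.redBif h) (0, 0, p.1, p.2)).comp (ContinuousLinearMap.inl ℝ R4 (ℝ × R4 × ℝ))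

variable {K h} {θ₀ : R4}

theorem kerDeriv_apply (p : R4 × ℝ) (κ : R4) :
    K.kerDeriv h p κ = fderiv ℝ (K.redBif h) (0, 0, p.1, p.2) (κ, 0, 0, 0) := rfl

theorem eventually_hasFDerivAt_redBif (hh : IsRangeSol K θ₀ h) : ∀ᶠ p in 𝓝 ((θ₀, 0) : R4 × ℝ),
    HasFDerivAt (K.redBif h) (fderiv ℝ (K.redBif h) (0, 0, p.1, p.2)) (0, 0, p.1, p.2) :=
  ((tendsto_base θ₀).eventually ((contDiffAt_redBif hh).eventually (by simp))).mono
    fun _ hp => (hp.differentiableAt one_ne_zero).hasFDerivAt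

theorem hasFDerivAt_redBif_ker {p : R4 × ℝ} (hp : HasFDerivAt (K.redBif h)
    (fderiv ℝ (K.redBif h) (0, 0, p.1, p.2)) (0, 0, p.1, p.2)) :
    HasFDerivAt (fun κ => K.redBif h (κ, 0, p.1, p.2)) (K.kerDeriv h p) 0 :=
  HasFDerivAt.comp (g := K.redBif h) (f := fun κ => ((κ, 0, p.1, p.2) : Param)) (0 : R4) hp
    (hasFDerivAt_prodMk_left _ _)

theorem hasDerivAt_redBif_eps {p : R4 × ℝ} (hp : HasFDerivAt (K.redBif h)
    (fderiv ℝ (K.redBif h) (0, 0, p.1, p.2)) (0, 0, p.1, p.2)) :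
    HasDerivAt (fun ε => K.redBif h (0, ε, p.1, p.2))
      (fderiv ℝ (K.redBif h) (0, 0, p.1, p.2) (0, 1, 0, 0)) 0 :=
  HasFDerivAt.comp_hasDerivAt (0 : ℝ) (l := K.redBif h) (f := fun ε => ((0, ε, p.1, p.2) : Param))
    hp ((hasDerivAt_const (0 : ℝ) (0 : R4)).prodMk ((hasDerivAt_id (0 : ℝ)).prodMk
      (hasDerivAt_const (0 : ℝ) ((p.1, p.2) : R4 × ℝ))))

/-- By conservation of the charge, all derivatives of `P` at a zero on the torus are orthogonal
to the gauge direction. -/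
theorem eventually_inner_fderiv (hh : IsRangeSol K θ₀ h) : ∀ᶠ p in 𝓝 ((θ₀, 0) : R4 × ℝ),
    K.redBif h (0, 0, p.1, p.2) = 0 → ∀ v,
      inner ℝ gaugeDir (fderiv ℝ (K.redBif h) (0, 0, p.1, p.2) v) = (0 : ℝ) := by
  obtain ⟨η, hη, hη2, hgood⟩ := eventually_good hh
  have hrad : ∀ᶠ q in 𝓝 ((0, 0, θ₀, 0) : Param), ∀ j, ContDiffAt ℝ 1 (K.radial h j) q := by
    rw [eventually_all]
    exact fun j => (contDiffAt_radial hh j).eventually (by simp)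
  filter_upwards [eventually_hasFDerivAt_redBif hh, (tendsto_base θ₀).eventually hrad,
    (tendsto_base θ₀).eventually (eventually_conserved hh).eventually_nhds,
    (tendsto_base θ₀).eventually hgood, eventually_solPoint_torus hh]
    with p hd hr hc ⟨_, _, _, _, _, q6, _⟩ htor h0 v
  set q : Param := (0, 0, p.1, p.2)
  have dl : HasDerivAt (fun t : ℝ => q + t • v) v 0 := by
    simpa using ((hasDerivAt_id (0 : ℝ)).smul_const v).const_add q
  have l0 : q + (0 : ℝ) • v = q := by rw [zero_smul, add_zero]
  have dP : HasDerivAt (fun t : ℝ => K.redBif h (q + t • v)) (fderiv ℝ (K.redBif h) q v) 0 := by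
    refine HasFDerivAt.comp_hasDerivAt (0 : ℝ) (l := K.redBif h) ?_ dl
    rw [l0]
    exact hd
  have dD : ∀ j, HasDerivAt (fun t : ℝ => K.radial h j (q + t • v))
      (fderiv ℝ (K.radial h j) q v) 0 := fun j => by
    refine HasFDerivAt.comp_hasDerivAt (0 : ℝ) (l := K.radial h j) ?_ dl
    rw [l0]
    exact ((hr j).differentiableAt one_ne_zero).hasFDerivAt
  have dS := HasDerivAt.fun_sum (u := Finset.univ) fun j _ => (dD j).mul
    ((EuclideanSpace.proj (𝕜 := ℝ) j).hasFDerivAt.comp_hasDerivAt (0 : ℝ) dP)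
  have hzero : (fun _ : ℝ => (0 : ℝ)) =ᶠ[𝓝 0] fun t =>
      ∑ j, K.radial h j (q + t • v) * K.redBif h (q + t • v) j := by
    have : Tendsto (fun t : ℝ => q + t • v) (𝓝 0) (𝓝 q) := by
      have := dl.continuousAt.tendsto
      rwa [l0] at this
    exact (this.eventually hc).mono fun t ht => ht.symm
  have e1 := (dS.congr_of_eventuallyEq hzero).unique (hasDerivAt_const (0 : ℝ) (0 : ℝ))
  have e2 : ∀ j, K.radial h j q = K.r p.2 := fun j => radial_torus htor j
  have e3 : ∀ j, K.redBif h q j = 0 := fun j => by rw [h0]; rfl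
  simp only [l0, Function.comp_apply, e2, show ∀ (x : Fin 4) (y : R4), EuclideanSpace.proj (𝕜 := ℝ) x y = y x from fun _ _ => rfl, e3, mul_zero, zero_add,
    ← Finset.mul_sum] at e1
  have e4 : K.r p.2 ≠ 0 := by
    have := (q6 0).ne'
    rwa [e2] at this
  rw [inner_gaugeDir]
  exact (mul_eq_zero.1 e1).resolve_left e4

theorem eventually_kerDeriv_gaugeDir (hh : IsRangeSol K θ₀ h) : ∀ᶠ p in 𝓝 ((θ₀, 0) : R4 × ℝ),
    K.kerDeriv h p gaugeDir = 0 := by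
  have t0 : Tendsto (fun p : R4 × ℝ => (((0, 0, p.1, p.2), 0) : Param × ℝ)) (𝓝 (θ₀, 0))
      (𝓝 ((0, 0, θ₀, 0), 0)) := by
    have : ContinuousAt (fun p : R4 × ℝ => (((0, 0, p.1, p.2), 0) : Param × ℝ)) (θ₀, 0) := by
      fun_prop
    exact this.tendsto
  obtain ⟨η, hη, hη2, hgood⟩ := eventually_good hh
  filter_upwards [eventually_hasFDerivAt_redBif hh,
    t0.eventually (eventually_redBif_add_gauge hh).eventually_nhds,
    eventually_fderiv_redBif hh, (tendsto_base θ₀).eventually hgood]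
    with p hd hg ht ⟨_, _, hμ, _⟩
  have dl : HasDerivAt (fun t : ℝ => p.1 + t • gaugeDir) gaugeDir 0 := by
    simpa using ((hasDerivAt_id (0 : ℝ)).smul_const gaugeDir).const_add p.1
  have d1 : HasDerivAt (fun t : ℝ => K.redBif h (0, 0, p.1 + t • gaugeDir, p.2))
      (fderiv ℝ (K.redBif h) (0, 0, p.1, p.2) (0, 0, gaugeDir, 0)) 0 := by
    refine HasFDerivAt.comp_hasDerivAt (0 : ℝ) (l := K.redBif h) ?_
      ((hasDerivAt_const (0 : ℝ) (0 : R4)).prodMk ((hasDerivAt_const (0 : ℝ) (0 : ℝ)).prodMk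
        (dl.prodMk (hasDerivAt_const (0 : ℝ) p.2))))
    rw [zero_smul, add_zero]
    exact hd
  have t1 : Tendsto (fun t : ℝ => (((0, 0, p.1, p.2), t) : Param × ℝ)) (𝓝 0)
      (𝓝 ((0, 0, p.1, p.2), 0)) := by
    have : ContinuousAt (fun t : ℝ => (((0, 0, p.1, p.2), t) : Param × ℝ)) 0 := by fun_prop
    exact this.tendsto
  have hconst : (fun _ : ℝ => K.redBif h (0, 0, p.1, p.2)) =ᶠ[𝓝 0]
      fun t : ℝ => K.redBif h (0, 0, p.1 + t • gaugeDir, p.2) :=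
    (t1.eventually hg).mono fun t ht => ht.symm
  have e1 := (d1.congr_of_eventuallyEq hconst).unique (hasDerivAt_const (0 : ℝ) _)
  have e2 := ht gaugeDir
  rw [e1, neg_zero] at e2
  have e3 := abs_lt.1 (K.r_mem hμ)
  exact (smul_eq_zero.1 e2).resolve_left (by linarith)

/-- The non-degeneracy of the linearized bifurcation equation is an open condition among the
zeros of `P` on the torus. -/
theorem eventually_linearizedUniquelySolvable (hh : IsRangeSol K θ₀ h)
    (hinv : (K.kerDeriv h (θ₀, 0) + gaugePart).IsInvertible) : ∀ᶠ p in 𝓝 ((θ₀, 0) : R4 × ℝ),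
    K.redBif h (0, 0, p.1, p.2) = 0 →
      LinearizedUniquelySolvable fun κ ε => K.redBif h (κ, ε, p.1, p.2) := by
  have hc : ContinuousAt (fun p : R4 × ℝ => K.kerDeriv h p + gaugePart) (θ₀, 0) := by
    have h1 : ContinuousAt (fderiv ℝ (K.redBif h)) (0, 0, θ₀, 0) :=
      ((contDiffAt_redBif hh).fderiv_right (m := 0) (by norm_num)).continuousAt
    have h2 : Tendsto (fun p : R4 × ℝ => fderiv ℝ (K.redBif h) (0, 0, p.1, p.2)) (𝓝 (θ₀, 0))
        (𝓝 (fderiv ℝ (K.redBif h) (0, 0, θ₀, 0))) := h1.tendsto.comp (tendsto_base θ₀)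
    have h3 : ContinuousAt (fun p : R4 × ℝ => fderiv ℝ (K.redBif h) (0, 0, p.1, p.2)) (θ₀, 0) := h2
    exact (h3.clm_comp continuousAt_const).add continuousAt_const
  have hinv' : ∀ᶠ p in 𝓝 ((θ₀, 0) : R4 × ℝ), (K.kerDeriv h p + gaugePart).IsInvertible := by
    obtain ⟨e, he⟩ := hinv
    refine hc.eventually (p := fun A : R4 →L[ℝ] R4 => A.IsInvertible) ?_
    have := e.nhds
    rw [he] at this
    exact this
  filter_upwards [eventually_hasFDerivAt_redBif hh, eventually_inner_fderiv hh,
    eventually_kerDeriv_gaugeDir hh, hinv'] with p hd hi hg hinv h0 ε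
  rw [(hasDerivAt_redBif_eps hd).deriv, (hasFDerivAt_redBif_ker hd).fderiv]
  refine exists_solution_mod_gauge (fun κ => hi h0 _) hg hinv ?_
  rw [inner_smul_right, hi h0, mul_zero]

theorem isInvertible_kerDeriv (hh : IsRangeSol K θ₀ h) (h0 : K.redBif h (0, 0, θ₀, 0) = 0)
    (hnon : LinearizedUniquelySolvable fun κ ε => K.redBif h (κ, ε, θ₀, 0)) :
    (K.kerDeriv h (θ₀, 0) + gaugePart).IsInvertible ∧
      (-K.kerDeriv h (θ₀, 0) + gaugePart).IsInvertible := by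
  have hd := (eventually_hasFDerivAt_redBif hh).self_of_nhds
  have hrange : ∀ κ, inner ℝ gaugeDir (K.kerDeriv h (θ₀, 0) κ) = (0 : ℝ) := fun κ =>
    (eventually_inner_fderiv hh).self_of_nhds h0 _
  have hker : ∀ κ, K.kerDeriv h (θ₀, 0) κ = 0 → ∃ c : ℝ, κ = c • gaugeDir := by
    obtain ⟨κ₀, hκ₀⟩ := hnon 0
    rw [(hasFDerivAt_redBif_ker hd).fderiv] at hκ₀
    simp only [zero_smul, zero_add] at hκ₀
    obtain ⟨c₀, hc₀⟩ := (hκ₀ 0).1 (map_zero _)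
    intro κ hκ
    obtain ⟨c, hc⟩ := (hκ₀ κ).1 hκ
    refine ⟨c - c₀, ?_⟩
    rw [sub_smul, hc, eq_sub_iff_add_eq, add_right_comm, ← hc₀, zero_add]
  refine ⟨isInvertible_add_gaugePart hrange hker, isInvertible_add_gaugePart (fun κ => ?_)
    fun κ hκ => hker κ ?_⟩
  · rw [neg_apply, inner_neg_right, hrange, neg_zero]
  · rwa [neg_apply, neg_eq_zero] at hκ

end KernelFamily

/-! ### The branches of solutions -/

theorem exists_box {θ₀ : R4} {R : Param → Prop} (hR : ∀ᶠ q in 𝓝 ((0, 0, θ₀, 0) : Param), R q) :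
    ∃ s > 0, ∀ κ ε ψ μ, ‖κ‖ < s → |ε| < s → ‖ψ - θ₀‖ < s → |μ| < s → R (κ, ε, ψ, μ) := by
  obtain ⟨s, hs, h⟩ := Metric.eventually_nhds_iff.1 hR
  refine ⟨s, hs, fun κ ε ψ μ h1 h2 h3 h4 => h ?_⟩
  simp only [Prod.dist_eq, max_lt_iff]
  simp only [dist_eq_norm, sub_zero, Real.norm_eq_abs]
  exact ⟨h1, h2, h3, h4⟩

theorem exists_box_real {R : ℝ × ℝ → Prop} (hR : ∀ᶠ x in 𝓝 ((0, 0) : ℝ × ℝ), R x) :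
    ∃ s > 0, ∀ μ ε, |μ| < s → |ε| < s → R (μ, ε) := by
  obtain ⟨s, hs, h⟩ := Metric.eventually_nhds_iff.1 hR
  refine ⟨s, hs, fun μ ε h1 h2 => h ?_⟩
  simp only [Prod.dist_eq, max_lt_iff]
  simp only [dist_eq_norm, sub_zero, Real.norm_eq_abs]
  exact ⟨h1, h2⟩

namespace KernelFamily

variable {K : KernelFamily} {h : Param → Chain} {θ₀ : R4}

/-- The bifurcation equation together with the orthogonality to the gauge direction, solved
for `κ`. -/
theorem exists_kernelSol (hh : IsRangeSol K θ₀ h) (h0 : K.redBif h (0, 0, θ₀, 0) = 0)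
    (hinv : (K.kerDeriv h (θ₀, 0) + gaugePart).IsInvertible) :
    ∃ g : ℝ × R4 × ℝ → R4, g (0, θ₀, 0) = 0 ∧ ContDiffAt ℝ 1 g (0, θ₀, 0) ∧
      (∀ᶠ x in 𝓝 ((0, θ₀, 0) : ℝ × R4 × ℝ), K.redBif h (g x, x) + gaugePart (g x) = 0) ∧
      ∀ᶠ q in 𝓝 ((0, 0, θ₀, 0) : Param), K.redBif h q + gaugePart q.1 = 0 → q.1 = g q.2 := by
  have hd := (eventually_hasFDerivAt_redBif hh).self_of_nhds
  have c1 : ContDiffAt ℝ 1 (fun p : (ℝ × R4 × ℝ) × R4 => K.redBif h (p.2, p.1) + gaugePart p.2)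
      ((0, θ₀, 0), 0) := by
    have a1 : ContDiffAt ℝ 1 (fun p : (ℝ × R4 × ℝ) × R4 => K.redBif h (p.2, p.1))
        ((0, θ₀, 0), 0) :=
      ContDiffAt.comp (g := K.redBif h) (f := fun p : (ℝ × R4 × ℝ) × R4 => ((p.2, p.1) : Param))
        ((0, θ₀, 0), 0) (contDiffAt_redBif hh) (by fun_prop)
    exact a1.add (gaugePart.contDiff.contDiffAt.comp _ contDiffAt_snd)
  have c2 : K.redBif h (0, 0, θ₀, 0) + gaugePart 0 = 0 := by rw [h0, map_zero, add_zero]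
  have c3 : HasFDerivAt (fun κ => K.redBif h (κ, 0, θ₀, 0) + gaugePart κ)
      (K.kerDeriv h (θ₀, 0) + gaugePart) 0 :=
    (hasFDerivAt_redBif_ker hd).add gaugePart.hasFDerivAt
  obtain ⟨g, g1, g2, g3, g4⟩ := exists_implicit c1 c2 c3 hinv
  refine ⟨g, g1, g2, g3, ?_⟩
  have t : Tendsto (fun q : Param => (q.2, q.1)) (𝓝 (0, 0, θ₀, 0)) (𝓝 ((0, θ₀, 0), 0)) := by
    have : ContinuousAt (fun q : Param => (q.2, q.1)) (0, 0, θ₀, 0) := by fun_prop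
    exact this.tendsto
  exact t.eventually g4

/-- The zeros of `P` on the torus, modulo the gauge direction. -/
theorem exists_torusZero (hh : IsRangeSol K θ₀ h) (h0 : K.redBif h (0, 0, θ₀, 0) = 0)
    (hinv : (-K.kerDeriv h (θ₀, 0) + gaugePart).IsInvertible) :
    ∃ g : ℝ → R4, g 0 = θ₀ ∧ ContDiffAt ℝ 1 g 0 ∧
      ∀ᶠ p in 𝓝 ((0, θ₀) : ℝ × R4), K.redBif h (0, 0, p.2, p.1) = 0 →
        inner ℝ gaugeDir (p.2 - θ₀) = (0 : ℝ) → p.2 = g p.1 := by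
  have hd := (eventually_hasFDerivAt_redBif hh).self_of_nhds
  have c1 : ContDiffAt ℝ 1 (fun p : ℝ × R4 => K.redBif h (0, 0, p.2, p.1) +
      gaugePart (p.2 - θ₀)) (0, θ₀) := by
    have a1 : ContDiffAt ℝ 1 (fun p : ℝ × R4 => K.redBif h (0, 0, p.2, p.1)) (0, θ₀) :=
      ContDiffAt.comp (g := K.redBif h) (f := fun p : ℝ × R4 => ((0, 0, p.2, p.1) : Param))
        (0, θ₀) (contDiffAt_redBif hh) (by fun_prop)
    have a2 : ContDiffAt ℝ 1 (fun p : ℝ × R4 => p.2 - θ₀) (0, θ₀) := by fun_prop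
    exact a1.add (gaugePart.contDiff.contDiffAt.comp _ a2)
  have c2 : K.redBif h (0, 0, θ₀, 0) + gaugePart (θ₀ - θ₀) = 0 := by
    rw [h0, sub_self, map_zero, add_zero]
  have c3 : HasFDerivAt (fun ψ => K.redBif h (0, 0, ψ, 0) + gaugePart (ψ - θ₀))
      (-K.kerDeriv h (θ₀, 0) + gaugePart) θ₀ := by
    have a1 : HasFDerivAt (fun ψ : R4 => ((0, 0, ψ, 0) : Param))
        ((ContinuousLinearMap.inr ℝ R4 (ℝ × R4 × ℝ)).comp
          ((ContinuousLinearMap.inr ℝ ℝ (R4 × ℝ)).comp (ContinuousLinearMap.inl ℝ R4 ℝ))) θ₀ :=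
      (hasFDerivAt_prodMk_right (0 : R4) ((0, θ₀, 0) : ℝ × R4 × ℝ)).comp θ₀
        ((hasFDerivAt_prodMk_right (0 : ℝ) ((θ₀, 0) : R4 × ℝ)).comp θ₀
          (hasFDerivAt_prodMk_left θ₀ (0 : ℝ)))
    have a2 := HasFDerivAt.comp (g := K.redBif h) (f := fun ψ : R4 => ((0, 0, ψ, 0) : Param))
      θ₀ hd a1
    have a3 : HasFDerivAt (fun ψ : R4 => gaugePart (ψ - θ₀)) gaugePart θ₀ :=
      gaugePart.hasFDerivAt.comp θ₀ ((hasFDerivAt_id θ₀).sub_const θ₀)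
    refine (a2.add a3).congr_fderiv ?_
    congr 1
    ext1 η
    have a4 := (eventually_fderiv_redBif hh).self_of_nhds η
    simp only [K.r_zero, one_smul] at a4
    rw [neg_apply, kerDeriv_apply, a4, neg_neg]
    rfl
  obtain ⟨g, g1, g2, -, g4⟩ := exists_implicit c1 c2 c3 hinv
  refine ⟨g, g1, g2, g4.mono fun p hp e1 e2 => hp ?_⟩
  rw [e1, gaugePart_apply, e2, zero_smul, add_zero]

/-- By conservation of the charge, the bifurcation equation may be completed in the gauge
direction. -/
theorem eventually_redBif_eq_zero_iff (hh : IsRangeSol K θ₀ h) :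
    ∀ᶠ q in 𝓝 ((0, 0, θ₀, 0) : Param), K.redBif h q + gaugePart q.1 = 0 ↔
      K.redBif h q = 0 ∧ inner ℝ gaugeDir q.1 = (0 : ℝ) := by
  obtain ⟨η, hη, hη2, hgood⟩ := eventually_good hh
  filter_upwards [hgood, eventually_conserved hh] with q ⟨_, _, _, _, _, q6, _⟩ hc
  constructor
  · intro h1
    set s : ℝ := inner ℝ gaugeDir q.1 with hs
    have h2 : ∀ j, K.redBif h q j = -s := fun j => by
      have := congrArg (fun z : R4 => z j) h1
      simp only [PiLp.add_apply, gaugePart_apply, PiLp.smul_apply, gaugeDir_apply, smul_eq_mul,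
        mul_one, PiLp.zero_apply] at this
      linarith
    simp only [h2, ← Finset.sum_mul] at hc
    have h3 : 0 < ∑ j, K.radial h j q := Finset.sum_pos (fun j _ => q6 j) Finset.univ_nonempty
    have h4 : s = 0 := by
      have := (mul_eq_zero.1 hc).resolve_left h3.ne'
      linarith
    refine ⟨?_, h4⟩
    ext j
    rw [h2, h4, neg_zero]
    rfl
  · rintro ⟨h1, h2⟩
    rw [h1, gaugePart_apply, h2, zero_smul, add_zero]

/-- All zeros of `P` on the torus near `θ₀` continue to branches over a common interval, which
depend on `μ` in a Lipschitz way. The predicate `R` is any property that holds near the base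
point. -/
theorem exists_branches (hh : IsRangeSol K θ₀ h) (h0 : K.redBif h (0, 0, θ₀, 0) = 0)
    (hnon : LinearizedUniquelySolvable fun κ ε => K.redBif h (κ, ε, θ₀, 0))
    {R : Param → Prop} (hR : ∀ᶠ q in 𝓝 ((0, 0, θ₀, 0) : Param), R q) :
    ∃ εs > 0, ∃ δ > 0, ∃ C > 0, ∃ ν > 0, ∃ k : ℝ → ℝ → R4,
      (∀ κ ε ψ μ, ‖κ‖ < δ → |ε| < εs → ‖ψ - θ₀‖ < ν → |μ| < ν → R (κ, ε, ψ, μ)) ∧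
      (∀ ψ μ, ‖ψ - θ₀‖ < ν → |μ| < ν → K.redBif h (0, 0, ψ, μ) = 0 →
        IsLocalBranch (fun κ ε => K.redBif h (κ, ε, ψ, μ)) εs δ (k μ)) ∧
      ∀ μ ε, |μ| < ν → |ε| < εs → ‖k μ ε - k 0 ε‖ ≤ C * |μ| := by
  obtain ⟨inv1, inv2⟩ := isInvertible_kerDeriv hh h0 hnon
  obtain ⟨g, g1, g2, g3, g4⟩ := exists_kernelSol hh h0 inv1
  obtain ⟨z, z1, z2, z3⟩ := exists_torusZero hh h0 inv2
  have hgauge := eventually_redBif_add_gauge hh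
  rw [nhds_prod_eq, eventually_prod_iff] at hgauge
  obtain ⟨pa, ha, pb, hb, hab⟩ := hgauge
  obtain ⟨s₁, hs₁, box⟩ := exists_box
    (hR.and (g4.and ((eventually_redBif_eq_zero_iff hh).and ha)))
  obtain ⟨s₂, hs₂, boxb⟩ := Metric.eventually_nhds_iff.1 hb
  obtain ⟨s₃, hs₃, boxz⟩ := Metric.eventually_nhds_iff.1 z3
  -- the branch at the parameter `μ`
  set k : ℝ → ℝ → R4 := fun μ ε => g (ε, z μ, μ) with hk
  have cz : ContinuousAt z 0 := z2.continuousAt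
  have cin : ContDiffAt ℝ 1 (fun x : ℝ × ℝ => ((x.2, z x.1, x.1) : ℝ × R4 × ℝ)) (0, 0) := by
    have : ContDiffAt ℝ 1 (fun x : ℝ × ℝ => z x.1) (0, 0) :=
      ContDiffAt.comp (g := z) (f := fun x : ℝ × ℝ => x.1) (0, 0) z2 contDiffAt_fst
    exact contDiffAt_snd.prodMk (this.prodMk contDiffAt_fst)
  have ck : ContDiffAt ℝ 1 (fun x : ℝ × ℝ => k x.1 x.2) (0, 0) := by
    refine ContDiffAt.comp (g := g) (f := fun x : ℝ × ℝ => ((x.2, z x.1, x.1) : ℝ × R4 × ℝ))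
      (0, 0) ?_ cin
    rw [z1]
    exact g2
  have tin : Tendsto (fun x : ℝ × ℝ => ((x.2, z x.1, x.1) : ℝ × R4 × ℝ)) (𝓝 (0, 0))
      (𝓝 (0, θ₀, 0)) := by
    have := cin.continuousAt.tendsto
    rwa [z1] at this
  obtain ⟨L, t, ht, hL⟩ := ck.exists_lipschitzOnWith
  have k0 : k 0 0 = 0 := by rw [hk]; simp only [z1, g1]
  have esmall : ∀ᶠ x in 𝓝 ((0, 0) : ℝ × ℝ), ‖k x.1 x.2‖ < s₁ := by
    refine ck.continuousAt.norm.eventually_lt_const ?_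
    simpa only [k0, norm_zero] using hs₁
  have econt : ∀ᶠ x in 𝓝 ((0, 0) : ℝ × ℝ), ContinuousAt (fun x : ℝ × ℝ => k x.1 x.2) x :=
    (ck.eventually (by simp)).mono fun x hx => hx.continuousAt
  have ez : ∀ᶠ x in 𝓝 ((0, 0) : ℝ × ℝ), ‖z x.1 - θ₀‖ < s₁ := by
    have : ContinuousAt (fun x : ℝ × ℝ => z x.1) (0, 0) :=
      ContinuousAt.comp (g := z) (f := fun x : ℝ × ℝ => x.1) (x := (0, 0)) cz continuousAt_fst
    refine (this.sub (continuousAt_const (y := θ₀))).norm.eventually_lt_const ?_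
    simpa [z1] using hs₁
  obtain ⟨s₄, hs₄, boxk⟩ := exists_box_real
    (esmall.and (econt.and (ez.and ((tin.eventually g3).and ht))))
  -- the gauge component of the phases is removed
  have ec : ∀ᶠ ψ in 𝓝 θ₀, |(inner ℝ gaugeDir (ψ - θ₀) / 4 : ℝ)| < s₂ ∧
      ‖ψ - (inner ℝ gaugeDir (ψ - θ₀) / 4 : ℝ) • gaugeDir - θ₀‖ < s₃ := by
    have a1 : ContinuousAt (fun ψ : R4 => |(inner ℝ gaugeDir (ψ - θ₀) / 4 : ℝ)|) θ₀ := by fun_prop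
    have a2 : ContinuousAt (fun ψ : R4 =>
        ‖ψ - (inner ℝ gaugeDir (ψ - θ₀) / 4 : ℝ) • gaugeDir - θ₀‖) θ₀ := by fun_prop
    exact (a1.eventually_lt_const (by simpa using hs₂)).and
      (a2.eventually_lt_const (by simpa using hs₃))
  obtain ⟨s₅, hs₅, boxc⟩ := Metric.eventually_nhds_iff.1 ec
  set ν := min (min s₁ s₃) (min s₄ s₅) with hν
  have hν0 : 0 < ν := by positivity
  set εs := min s₁ s₄ with hεs
  have hεs0 : 0 < εs := by positivity
  refine ⟨εs, hεs0, s₁, hs₁, L + 1, by positivity, ν, hν0, k, ?_, ?_, ?_⟩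
  · intro κ ε ψ μ h1 h2 h3 h4
    exact (box κ ε ψ μ h1 (h2.trans_le (min_le_left _ _))
      (h3.trans_le ((min_le_left _ _).trans (min_le_left _ _)))
      (h4.trans_le ((min_le_left _ _).trans (min_le_left _ _)))).1
  · intro ψ μ hψ hμ hP
    have hψ₁ : ‖ψ - θ₀‖ < s₁ := hψ.trans_le ((min_le_left _ _).trans (min_le_left _ _))
    have hμ₁ : |μ| < s₁ := hμ.trans_le ((min_le_left _ _).trans (min_le_left _ _))
    have hμ₃ : |μ| < s₃ := hμ.trans_le ((min_le_left _ _).trans (min_le_right _ _))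
    have hμ₄ : |μ| < s₄ := hμ.trans_le ((min_le_right _ _).trans (min_le_left _ _))
    have hψ₅ : ‖ψ - θ₀‖ < s₅ := hψ.trans_le ((min_le_right _ _).trans (min_le_right _ _))
    set c : ℝ := inner ℝ gaugeDir (ψ - θ₀) / 4 with hc
    obtain ⟨hc1, hc2⟩ := boxc (y := ψ) (by rwa [dist_eq_norm])
    rw [← hc] at hc1 hc2
    have inv : ∀ κ ε, ‖κ‖ < s₁ → |ε| < s₁ →
        K.redBif h (κ, ε, ψ - c • gaugeDir, μ) = K.redBif h (κ, ε, ψ, μ) := fun κ ε e1 e2 => by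
      have := hab (box κ ε ψ μ e1 e2 hψ₁ hμ₁).2.2.2 (y := -c)
        (boxb (by rwa [dist_zero_right, norm_neg, Real.norm_eq_abs]))
      simp only [neg_smul, ← sub_eq_add_neg] at this
      exact this
    have hz : ψ - c • gaugeDir = z μ := by
      refine boxz (y := (μ, ψ - c • gaugeDir)) ?_ ?_ ?_
      · simp only [Prod.dist_eq, max_lt_iff]
        simp only [dist_eq_norm, sub_zero, Real.norm_eq_abs]
        exact ⟨hμ₃, hc2⟩
      · exact (inv 0 0 (by simpa using hs₁) (by simpa using hs₁)).trans hP
      · simp only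
        rw [sub_right_comm, inner_sub_right, inner_smul_right, inner_gaugeDir_self, hc]
        ring
    rw [hz] at inv
    have main : ∀ ε, |ε| < εs → ∀ κ : R4, (K.redBif h (κ, ε, ψ, μ) = 0 ∧
        inner ℝ gaugeDir κ = (0 : ℝ) ∧ ‖κ‖ < s₁) ↔ κ = k μ ε := by
      intro ε hε κ
      have hε₁ : |ε| < s₁ := hε.trans_le (min_le_left _ _)
      obtain ⟨b1, -, b3, b4, -⟩ := boxk μ ε hμ₄ (hε.trans_le (min_le_right _ _))
      constructor
      · rintro ⟨e1, e2, e3⟩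
        obtain ⟨-, a2, a3, -⟩ := box κ ε (z μ) μ e3 hε₁ b3 hμ₁
        exact a2 (a3.2 ⟨(inv κ ε e3 hε₁).trans e1, e2⟩)
      · rintro rfl
        obtain ⟨-, -, a3, -⟩ := box (k μ ε) ε (z μ) μ b1 hε₁ b3 hμ₁
        obtain ⟨e1, e2⟩ := a3.1 b4
        exact ⟨(inv _ ε b1 hε₁).symm.trans e1, e2, b1⟩
    refine ⟨?_, ?_, main⟩
    · exact ((main 0 (by simpa using hεs0) 0).1 ⟨hP, inner_zero_right _, by simpa using hs₁⟩).symm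
    · intro ε hε
      have hε₄ : |ε| < s₄ := (abs_lt.2 hε).trans_le (min_le_right _ _)
      have a1 := (boxk μ ε hμ₄ hε₄).2.1
      have a2 : ContinuousAt (fun e : ℝ => k μ e) ε :=
        ContinuousAt.comp (g := fun x : ℝ × ℝ => k x.1 x.2) (f := fun e : ℝ => (μ, e)) (x := ε) a1
          (by fun_prop)
      exact a2.continuousWithinAt
  · intro μ ε hμ hε
    have hμ₄ : |μ| < s₄ := hμ.trans_le ((min_le_right _ _).trans (min_le_left _ _))
    have hε₄ : |ε| < s₄ := hε.trans_le (min_le_right _ _)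
    have a1 := (boxk μ ε hμ₄ hε₄).2.2.2.2
    have a2 := (boxk 0 ε (by simpa using hs₄) hε₄).2.2.2.2
    have a3 := hL.dist_le_mul _ a1 _ a2
    rw [dist_eq_norm, Prod.dist_eq, dist_self, max_eq_left dist_nonneg, dist_zero_right,
      Real.norm_eq_abs] at a3
    refine a3.trans ?_
    gcongr
    linarith

end KernelFamily

/-! ### Transfer to the two models -/

/-- The second decomposition depends on the phases only through `e^{-iθ_j}`. -/
theorem reducedBif_congr_phase (F : Chain → ℝ → Chain) {θ ψ : Fin 4 → ℝ}
    (hθ : ∀ j, phase θ j = phase ψ j) : reducedBif F θ = reducedBif F ψ := by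
  have h1 : kerDir θ = kerDir ψ := funext fun j => by rw [kerDir_eq, kerDir_eq, hθ]
  have h2 : kerVec θ = kerVec ψ := funext fun κ => by rw [kerVec, kerVec, h1]
  unfold reducedBif bifurcation rangeSol2 SolvesRange2
  rw [h1, h2]

theorem LinearizedUniquelySolvable.congr {P P' : R4 → ℝ → R4} {ε₀ δ : ℝ} (hε₀ : 0 < ε₀)
    (hδ : 0 < δ) (hP : LinearizedUniquelySolvable P)
    (h : ∀ κ ε, ‖κ‖ < δ → |ε| < ε₀ → P κ ε = P' κ ε) : LinearizedUniquelySolvable P' := by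
  have h1 : (fun e => P 0 e) =ᶠ[𝓝 0] fun e => P' 0 e := by
    have : ContinuousAt (fun e : ℝ => |e|) 0 := by fun_prop
    exact (this.eventually_lt_const (by simpa using hε₀)).mono fun e he => h 0 e (by simpa) he
  have h2 : (fun q => P q 0) =ᶠ[𝓝 0] fun q => P' q 0 := by
    have : ContinuousAt (fun q : R4 => ‖q‖) 0 := by fun_prop
    exact (this.eventually_lt_const (by simpa using hδ)).mono fun q hq => h q 0 hq (by simpa)
  intro ε
  obtain ⟨κ, hκ⟩ := hP ε
  refine ⟨κ, fun κ' => ?_⟩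
  rw [← h1.deriv_eq, ← h2.fderiv_eq]
  exact hκ κ'

theorem IsLocalBranch.congr {P P' : R4 → ℝ → R4} {ε₀ δ : ℝ} {k : ℝ → R4}
    (hP : IsLocalBranch P ε₀ δ k) (h : ∀ κ ε, ‖κ‖ < δ → |ε| < ε₀ → P κ ε = P' κ ε) :
    IsLocalBranch P' ε₀ δ k where
  zero := hP.zero
  cont := hP.cont
  sol_iff ε hε κ := by
    rw [← hP.sol_iff ε hε κ]
    constructor
    · rintro ⟨h1, h2, h3⟩
      exact ⟨(h κ ε h3 hε).trans h1, h2, h3⟩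
    · rintro ⟨h1, h2, h3⟩
      exact ⟨(h κ ε h3 hε).symm.trans h1, h2, h3⟩

theorem norm_phase (θ : Fin 4 → ℝ) (j : Fin 4) : ‖phase θ j‖ = 1 := norm_exp_phase _

/-- Convergence of the unit vectors `e^{-iθ_j}` gives convergence of suitable phases. -/
theorem exists_phase_lift {X : Type*} {l : Filter X} (θ : X → Fin 4 → ℝ) (θ₀ : R4)
    (h : ∀ j, Tendsto (fun x => phase (θ x) j) l (𝓝 (phase θ₀ j))) :
    ∃ ψ : X → R4, (∀ x j, phase (ψ x) j = phase (θ x) j) ∧ Tendsto ψ l (𝓝 θ₀) := by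
  have hne : ∀ j, phase θ₀ j ≠ 0 := fun j => by
    rw [← norm_ne_zero_iff, norm_phase]
    exact one_ne_zero
  refine ⟨fun x => WithLp.toLp 2 fun j => θ₀ j - Complex.arg (phase (θ x) j / phase θ₀ j), ?_, ?_⟩
  · intro x j
    set w := phase (θ x) j / phase θ₀ j with hw
    have h1 : Complex.exp (Complex.arg w * Complex.I) = w := by
      have := Complex.norm_mul_exp_arg_mul_I w
      rwa [hw, norm_div, norm_phase, norm_phase, div_one, Complex.ofReal_one, one_mul, ← hw] at this
    have h2 : Complex.exp (-((θ₀ j - Complex.arg w : ℝ) : ℂ) * Complex.I) =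
        phase θ₀ j * Complex.exp (Complex.arg w * Complex.I) := by
      rw [phase, ← Complex.exp_add]
      congr 1
      push_cast
      ring
    change Complex.exp (-((θ₀ j - Complex.arg w : ℝ) : ℂ) * Complex.I) = _
    rw [h2, h1, hw, mul_div_cancel₀ _ (hne j)]
  · have h3 : Tendsto (fun x => fun j => θ₀ j - Complex.arg (phase (θ x) j / phase θ₀ j)) l
        (𝓝 fun j => θ₀ j) := by
      rw [tendsto_pi_nhds]
      intro j
      have h4 : Tendsto (fun x => phase (θ x) j / phase θ₀ j) l (𝓝 1) := by
        have := (h j).div_const (phase θ₀ j)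
        rwa [div_self (hne j)] at this
      have h5 := (Complex.continuousAt_arg Complex.one_mem_slitPlane).tendsto.comp h4
      rw [Complex.arg_one] at h5
      simpa using h5.const_sub (θ₀ j)
    exact ((PiLp.continuous_toLp 2 fun _ : Fin 4 => ℝ).tendsto _).comp h3

theorem torusPoint_congr_phase (r : ℝ) {θ ψ : Fin 4 → ℝ} (h : ∀ j, phase θ j = phase ψ j) :
    torusPoint r θ = torusPoint r ψ := by
  rw [torusPoint_eq_phase, torusPoint_eq_phase]
  congr 1
  funext j
  rw [h]

/-- Convergence of torus points gives convergence of the unit vectors. -/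
theorem tendsto_phase {X : Type*} {l : Filter X} {r : X → ℝ} {θ : X → Fin 4 → ℝ} {θ₀ : Fin 4 → ℝ}
    (hr : Tendsto r l (𝓝 1))
    (h : Tendsto (fun x => torusPoint (r x) (θ x)) l (𝓝 (torusPoint 1 θ₀))) (j : Fin 4) :
    Tendsto (fun x => phase (θ x) j) l (𝓝 (phase θ₀ j)) := by
  have h1 : ∀ (s : ℝ) (ψ : Fin 4 → ℝ), torusPoint s ψ (site j) = s * phase ψ j := fun s ψ => by
    rw [torusPoint_eq_phase, embS_site]
  have h2 := ((evalSite ℂ (site j)).continuous.tendsto _).comp h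
  simp only [Function.comp_def, evalSite_apply, h1, Complex.ofReal_one, one_mul] at h2
  have h3 : Tendsto (fun x => ((r x : ℝ) : ℂ)) l (𝓝 1) := by
    have := (Complex.continuous_ofReal.tendsto 1).comp hr
    rwa [Complex.ofReal_one] at this
  have h4 := h2.div h3 one_ne_zero
  rw [div_one] at h4
  refine h4.congr' ?_
  filter_upwards [h3.eventually_ne one_ne_zero] with x hx
  rw [Pi.div_apply, mul_div_cancel_left₀ _ hx]

end KGChain

end

open KGChain
theorem proposition3p1 (k₂ k₃ : ℝ)
    (γ : ℝ → ℝ) (x : ℝ → ℝ → ℝ) (hx : ∀ ρ, ρ ≠ 0 → IsOscillation ρ (γ ρ) (x ρ))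
    (θ : ℝ → Fin 4 → ℝ) (θ₀ : Fin 4 → ℝ)
    (hpers : ∀ᶠ ρ in 𝓝[≠] (0 : ℝ), Persistence k₂ k₃ (x ρ) (θ ρ))
    (hlim : Tendsto (fun ρ => vKG ρ (x ρ) (θ ρ)) (𝓝[≠] (0 : ℝ)) (𝓝 (vDNLS θ₀)))
    (hnondeg : LinearizedUniquelySolvable (PDNLS k₂ k₃ θ₀)) :
    ∃ ρs > 0, ∃ εs > 0, ∃ δ > 0, ∃ C > 0, ∃ k : ℝ → R4,
      IsLocalBranch (PDNLS k₂ k₃ θ₀) εs δ k ∧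
      ∀ ρ : ℝ, 0 < |ρ| → |ρ| < ρs →
        LinearizedUniquelySolvable (PKG k₂ k₃ ρ (γ ρ) (x ρ) (θ ρ)) ∧
        ∃ kρ : ℝ → R4, IsLocalBranch (PKG k₂ k₃ ρ (γ ρ) (x ρ) (θ ρ)) εs δ kρ ∧
          ∀ ε : ℝ, |ε| < εs → ‖kρ ε - k ε‖ < C * ρ ^ 2 := by
  obtain ⟨K, hdnls, hkg⟩ := exists_kernelFamily k₂ k₃
  set ψ₀ : R4 := WithLp.toLp 2 θ₀ with hψ₀
  obtain ⟨h, a1, a2, a3, a4⟩ := KernelFamily.exists_rangeSol K ψ₀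
  have hh : IsRangeSol K ψ₀ h := ⟨a1, a2, a3, a4⟩
  have hrep₀ : K.Represents (mapDNLS k₂ k₃ θ₀) ψ₀ 0 := fun w ε _ _ => hdnls θ₀ w ε
  have hred := KernelFamily.eventually_reducedBif_eq hh
  -- the parameter `ρ ^ 2` and the phases of the reference solutions
  have tsq : Tendsto (fun ρ : ℝ => ρ ^ 2) (𝓝[≠] 0) (𝓝 0) := by
    have : Tendsto (fun ρ : ℝ => ρ ^ 2) (𝓝 0) (𝓝 (0 ^ 2)) := (continuous_pow 2).tendsto 0
    rw [zero_pow two_ne_zero] at this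
    exact this.mono_left nhdsWithin_le_nhds
  have enear : ∀ᶠ ρ : ℝ in 𝓝[≠] 0, ρ ≠ 0 ∧ ρ ^ 2 < K.bound :=
    (eventually_mem_nhdsWithin.mono fun ρ hρ => hρ).and (tsq.eventually_lt_const K.pos)
  have tr : Tendsto (fun ρ : ℝ => K.r (ρ ^ 2)) (𝓝[≠] 0) (𝓝 1) := by
    have := (K.smooth_r (μ := 0) (by simpa using K.pos)).continuousAt.tendsto
    rw [K.r_zero] at this
    exact this.comp tsq
  have ttorus : Tendsto (fun ρ : ℝ => torusPoint (K.r (ρ ^ 2)) (θ ρ)) (𝓝[≠] 0)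
      (𝓝 (torusPoint 1 θ₀)) := by
    refine hlim.congr' ?_
    filter_upwards [enear] with ρ ⟨h1, h2⟩
    exact (hkg ρ (γ ρ) (x ρ) h1 h2 (hx ρ h1) (θ ρ)).1
  obtain ⟨ψ, hψ, tψ⟩ := exists_phase_lift θ ψ₀ (tendsto_phase tr ttorus)
  have tpar : Tendsto (fun ρ : ℝ => (ψ ρ, ρ ^ 2)) (𝓝[≠] 0) (𝓝 (ψ₀, 0)) := tψ.prodMk_nhds tsq
  have hrep : ∀ ρ, ρ ≠ 0 → ρ ^ 2 < K.bound →
      K.Represents (mapKG k₂ k₃ ρ (γ ρ) (x ρ) (θ ρ)) (ψ ρ) (ρ ^ 2) := fun ρ h1 h2 w ε h3 h4 => by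
    rw [torusPoint_congr_phase _ (hψ ρ)] at h3 ⊢
    exact (hkg ρ (γ ρ) (x ρ) h1 h2 (hx ρ h1) (θ ρ)).2.2 w ε h3 h4
  -- the persistence conditions say that the reference solutions are zeros of `P`
  have ezero : ∀ᶠ ρ : ℝ in 𝓝[≠] 0, K.redBif h (0, 0, ψ ρ, ρ ^ 2) = 0 := by
    filter_upwards [enear, hpers, tpar.eventually (KernelFamily.eventually_solPoint_torus hh)]
      with ρ ⟨h1, h2⟩ h3 h4
    ext j
    have h5 := (hkg ρ (γ ρ) (x ρ) h1 h2 (hx ρ h1) (θ ρ)).2.1 h3 j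
    rw [← torusPoint_congr_phase _ (hψ ρ)] at h5
    rw [KernelFamily.redBif_apply, KernelFamily.torque, h4, h5, zero_div]
    rfl
  have h0 : K.redBif h (0, 0, ψ₀, 0) = 0 := by
    have h1 : Tendsto (fun ρ : ℝ => K.redBif h (0, 0, ψ ρ, ρ ^ 2)) (𝓝[≠] 0)
        (𝓝 (K.redBif h (0, 0, ψ₀, 0))) := by
      have h2 : ContinuousAt (K.redBif h) (0, 0, ψ₀, 0) :=
        (KernelFamily.contDiffAt_redBif hh).continuousAt
      have h3 : Tendsto (fun ρ : ℝ => ((0, 0, ψ ρ, ρ ^ 2) : Param)) (𝓝[≠] 0)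
        (𝓝 (0, 0, ψ₀, 0)) := (KernelFamily.tendsto_base ψ₀).comp tpar
      exact h2.tendsto.comp h3
    exact tendsto_nhds_unique h1 (tendsto_const_nhds.congr' (ezero.mono fun ρ hρ => hρ.symm))
  have hnon : LinearizedUniquelySolvable fun κ ε => K.redBif h (κ, ε, ψ₀, 0) := by
    obtain ⟨s, hs, box⟩ := exists_box hred
    exact hnondeg.congr hs hs fun κ ε h1 h2 =>
      box κ ε ψ₀ 0 h1 h2 (by simpa using hs) (by simpa using hs) _ hrep₀
  obtain ⟨εs, hεs, δ, hδ, C, hC, ν, hν, k, hbox, hbranch, hlip⟩ :=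
    KernelFamily.exists_branches hh h0 hnon hred
  have egood : ∀ᶠ ρ : ℝ in 𝓝[≠] 0, ρ ^ 2 < K.bound ∧ ‖ψ ρ - ψ₀‖ < ν ∧ |ρ ^ 2| < ν ∧
      K.redBif h (0, 0, ψ ρ, ρ ^ 2) = 0 ∧
      LinearizedUniquelySolvable fun κ ε => K.redBif h (κ, ε, ψ ρ, ρ ^ 2) := by
    have h1 : Tendsto (fun ρ => ‖ψ ρ - ψ₀‖) (𝓝[≠] 0) (𝓝 0) := by
      simpa using (tψ.sub_const ψ₀).norm
    have h2 : Tendsto (fun ρ : ℝ => |ρ ^ 2|) (𝓝[≠] 0) (𝓝 0) := by simpa using tsq.abs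
    filter_upwards [enear, h1.eventually_lt_const hν, h2.eventually_lt_const hν, ezero,
      tpar.eventually (KernelFamily.eventually_linearizedUniquelySolvable hh
        (KernelFamily.isInvertible_kerDeriv hh h0 hnon).1)] with ρ b1 b2 b3 b4 b5
    exact ⟨b1.2, b2, b3, b4, b5 b4⟩
  obtain ⟨ρs, hρs, hgood⟩ := eventually_abs_lt (eventually_nhdsWithin_iff.1 egood)
  refine ⟨ρs, hρs, εs, hεs, δ, hδ, C + 1, by positivity, k 0, ?_, fun ρ hρ0 hρ => ?_⟩
  · refine (hbranch ψ₀ 0 (by simpa using hν) (by simpa using hν) h0).congr fun κ ε h1 h2 => ?_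
    exact (hbox κ ε ψ₀ 0 h1 h2 (by simpa using hν) (by simpa using hν) _ hrep₀).symm
  · have hne : ρ ≠ 0 := abs_pos.1 hρ0
    obtain ⟨b1, b2, b3, b4, b5⟩ := hgood ρ hρ hne
    have heq : ∀ κ ε, ‖κ‖ < δ → |ε| < εs →
        K.redBif h (κ, ε, ψ ρ, ρ ^ 2) = PKG k₂ k₃ ρ (γ ρ) (x ρ) (θ ρ) κ ε := fun κ ε h1 h2 => by
      rw [PKG, ← reducedBif_congr_phase _ (hψ ρ)]
      exact (hbox κ ε (ψ ρ) (ρ ^ 2) h1 h2 b2 b3 _ (hrep ρ hne b1)).symm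
    refine ⟨b5.congr hεs hδ heq, k (ρ ^ 2), (hbranch _ _ b2 b3 b4).congr heq, fun ε hε => ?_⟩
    have hpos : 0 < ρ ^ 2 := by positivity
    refine (hlip _ ε b3 hε).trans_lt ?_
    rw [abs_of_pos hpos]
    linarith
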